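/- Let $k,n$ be integers with $2\le k\le n-2$, and let $[n]=\{1,\dots,n\}$. **Total positivity.** For an $m\times n$ matrix $A$ and an $m$-element subset $I\subset[n]$, let $\Delta_I(A)$ be the maximal minor of $A$ with column set $I$. Let $\mathrm{Gr}_{>0}(m,n)$ be the set of $m$-dimensional subspaces of $\mathbb R^n$ that are row spans of $m\times n$ matrices all of whose maximal minors are positive, and let $\mathrm{alt}$ be the linear map $(v_1,v_2,v_3,\dots)\mapsto(v_1,-v_2,v_3,\dots)$ on $\mathbb R^n$. Let $\mathrm{Fl}_{>0}(k-2,k+2)$ be the set of pairs $(V_{k-2},V_{k+2})$, where $V_m$ is the span of the first $m$ rows of a matrix $M$, for $M$ an $n\times n$ real matrix with positive minors of all sizes. **Matchings.** A $(k,n)$-partial non-crossing matching is a pair $(\tau,T)$, where $\tau:[n]\to[n]$ is an involution such that there are no $a<b<c<d$ with $\tau(a)=c$, $\tau(b)=d$, and $T\subset[n]$ is disjoint from $S(\tau):=\{l:\tau(l)\ne l\}$ with $2|T|+|S(\tau)|=2k$. The arcs of $\tau$ are the sets $\{l,\tau(l)\}$, $l\in S(\tau)$. For integers $i,j$ with $i+2\le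 j\le i+n-2$, let $I_{(i,j]}\subset[n]$ be the set of the elements $i+1,\dots,j$ taken modulo $n$. An arc is $I_{(i,j]}$-special if exactly one of its endpoints belongs to $I_{(i,j]}$. **Markings.** A $(\tau,T,i,j)$-marking is a map $\mu:S(\tau)\to\{L,R,J\}$ such that exactly two arcs $\{l_1,r_1\},\{l_2,r_2\}$ of $\tau$ have an endpoint marked by $J$, say $\mu(l_1)=\mu(l_2)=J$, and these satisfy $l_1,l_2\in I_{(i,j]}$, $r_1,r_2\notin I_{(i,j]}$, $\mu(r_1)=\mu(r_2)=R$, while each other arc has one endpoint marked by $L$ and the other one by $R$. Put $L_\mu=T\sqcup\mu^{-1}(L)$, $R_\mu=T\sqcup\mu^{-1}(R)$, $J_\mu=\mu^{-1}(J)$, and let $d_\mu$ be the number of $I_{(i,j]}$-special arcs of $\tau$ located strictly between $\{l_1,r_1\}$ and $\{l_2,r_2\}$, that is, which, drawn as chords of a disk with boundary points $1,\dots,n$ in cyclic order, separate the chord $\{l_1,r_1\}$ from the chord $\{l_2,r_2\}$. **Coefficients.** For a pair $(\Lambda,\tilde\Lambda)$ of subspaces of $\mathbb R^n$ with $\Lambda^\perp\in\mathrm{Gr}_{>0}(k-2,n)$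 and $\tilde\Lambda\in\mathrm{Gr}_{>0}(k+2,n)$, let $$c^{(i,j]}_{\tau,T}(\Lambda,\tilde\Lambda)=\sum_{\mu}(-1)^{d_\mu}\,\Delta_{L_\mu}(\Lambda^\perp)\,\Delta_{R_\mu\sqcup J_\mu}(\tilde\Lambda),$$ where the sum is over all $(\tau,T,i,j)$-markings $\mu$, and $\Delta_I(\Lambda^\perp)$, $\Delta_I(\tilde\Lambda)$ denote the maximal minors of matrices with row spans $\Lambda^\perp$, $\tilde\Lambda$ chosen such that all their maximal minors are positive. (A different such choice multiplies all these coefficients by a common positive number.) **Theorem.** Let $\Lambda,\tilde\Lambda$ be subspaces of $\mathbb R^n$ with $(\Lambda^\perp,\tilde\Lambda)\in\mathrm{Fl}_{>0}(k-2,k+2)$. Then $(\Lambda,\tilde\Lambda)$ is immanant-positive, that is, $(\Lambda,\tilde\Lambda)\in\mathrm{alt}(\mathrm{Gr}_{>0}(n-k+2,n))\times\mathrm{Gr}_{>0}(k+2,n)$, and $c^{(i,j]}_{\tau,T}(\Lambda,\tilde\Lambda)>0$ for all integers $i,j$ with $i+2\le j\le i+n-2$ and all $(k,n)$-partial non-crossing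 matchings $(\tau,T)$ such that $\tau$ has at least two $I_{(i,j]}$-special arcs. -/

import Mathlib

open scoped Matrix

namespace TwoStepFlag

/-! ### Grassmannians and total positivity

The set `{1, …, n}` is modelled by `Fin n`, the element `p : Fin n` standing for `p + 1`.
Points of `Gr(m, n)` are subspaces of `EuclideanSpace ℝ (Fin n)`. -/

/-- The `r`-th row of a matrix as a vector of `ℝⁿ`. -/
noncomputable def row {m n : ℕ} (A : Matrix (Fin m) (Fin n) ℝ) (r : Fin m) :
    EuclideanSpace ℝ (Fin n) :=
  WithLp.toLp 2 (A r)

/-- The maximal minor `Δ_I(A)` of an `m × n` matrix with column set `I`, where `|I| = m`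
(and the value `0` if `|I| ≠ m`). -/
noncomputable def maxMinor {m n : ℕ} (A : Matrix (Fin m) (Fin n) ℝ) (I : Finset (Fin n)) : ℝ :=
  if h : I.card = m then (A.submatrix id (I.orderEmbOfFin h)).det else 0

/-- `A` is an `m × n` matrix of rank `m` with row span `V`, all of whose maximal minors are
positive. -/
structure IsPositiveRep {m n : ℕ} (A : Matrix (Fin m) (Fin n) ℝ)
    (V : Submodule ℝ (EuclideanSpace ℝ (Fin n))) : Prop where
  linearIndependent : LinearIndependent ℝ (row A)
  span_eq : Submodule.span ℝ (Set.range (row A)) = V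
  minor_pos : ∀ I : Finset (Fin n), I.card = m → 0 < maxMinor A I

/-- The totally positive Grassmannian `Gr_{>0}(m, n)`: all maximal minors are nonzero and have
the same sign, i.e. they are all positive for some choice of the representing matrix. -/
def GrPos (m n : ℕ) : Set (Submodule ℝ (EuclideanSpace ℝ (Fin n))) :=
  {V | ∃ A : Matrix (Fin m) (Fin n) ℝ, IsPositiveRep A V}

/-- The linear map `(v₁, v₂, v₃, …) ↦ (v₁, -v₂, v₃, …)` changing the sign of every second
coordinate. -/
noncomputable def altMap (n : ℕ) : EuclideanSpace ℝ (Fin n) →ₗ[ℝ] EuclideanSpace ℝ (Fin n) where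
  toFun v := WithLp.toLp 2 (fun p => (-1 : ℝ) ^ (p : ℕ) * v p)
  map_add' v w := by ext p; simp [mul_add]
  map_smul' c v := by ext p; simp [mul_left_comm]

/-- The pairs `(Λ, Λ')` in `alt(Gr_{>0}(n-k+2, n)) × Gr_{>0}(k+2, n)`. It is used only for
`2 ≤ k ≤ n - 2`. -/
def PositivePairs (k n : ℕ) : Set (Submodule ℝ (EuclideanSpace ℝ (Fin n)) ×
    Submodule ℝ (EuclideanSpace ℝ (Fin n))) :=
  (Submodule.map (altMap n) '' GrPos (n - k + 2) n) ×ˢ GrPos (k + 2) n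

/-- A square matrix is totally positive if all of its minors, of all sizes, are positive. -/
def IsTotallyPositive {n : ℕ} (M : Matrix (Fin n) (Fin n) ℝ) : Prop :=
  ∀ (m : ℕ) (r c : Fin m ↪o Fin n), 0 < (M.submatrix r c).det

/-- The span of the first `m` rows of `M`. -/
noncomputable def firstRowsSpan {n : ℕ} (M : Matrix (Fin n) (Fin n) ℝ) (m : ℕ) :
    Submodule ℝ (EuclideanSpace ℝ (Fin n)) :=
  Submodule.span ℝ (row M '' {r : Fin n | (r : ℕ) < m})

/-- The totally positive part `Fl_{>0}(a, b)` of the two-step flag variety in `ℝⁿ`. -/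
def FlPos (a b n : ℕ) : Set (Submodule ℝ (EuclideanSpace ℝ (Fin n)) ×
    Submodule ℝ (EuclideanSpace ℝ (Fin n))) :=
  {V | ∃ M : Matrix (Fin n) (Fin n) ℝ,
    IsTotallyPositive M ∧ V = (firstRowsSpan M a, firstRowsSpan M b)}

/-! ### Partial non-crossing matchings, special arcs and markings -/

open Classical in
/-- The set `I_{(i,j]}`: the elements `i+1, …, j` taken modulo `n`. -/
noncomputable def cyclicInterval (n : ℕ) (i j : ℤ) : Finset (Fin n) :=
  Finset.univ.filter fun p => ∃ m : ℤ, i < m ∧ m ≤ j ∧ m ≡ ((p : ℕ) : ℤ) + 1 [ZMOD (n : ℤ)]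

/-- A `(k, n)`-partial non-crossing matching `(τ, T)`. The set `S(τ)` of points moved by `τ` is
`τ.support`. -/
structure PartialMatching (k n : ℕ) where
  /-- the involution -/
  τ : Equiv.Perm (Fin n)
  /-- the distinguished set of unmatched points -/
  T : Finset (Fin n)
  involutive : Function.Involutive τ
  noncrossing : ∀ a b c d : Fin n, a < b → b < c → c < d → ¬ (τ a = c ∧ τ b = d)
  disjoint : Disjoint T τ.support
  card_eq : 2 * T.card + τ.support.card = 2 * k

/-- The labels of a marking. -/
inductive Label where
  | L
  | R
  | J
  deriving DecidableEq

instance : Fintype Label where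
  elems := {Label.L, Label.R, Label.J}
  complete a := by cases a <;> simp

namespace PartialMatching

variable {k n : ℕ}

/-- The arc `{p, τ(p)}` through the point `p`. -/
def arc (x : PartialMatching k n) (p : Fin n) : Finset (Fin n) := {p, x.τ p}

/-- The arcs of `τ`: the two-element sets `{l, τ(l)}` for `l ∈ S(τ)`. -/
def arcs (x : PartialMatching k n) : Finset (Finset (Fin n)) := x.τ.support.image x.arc

/-- The `I`-special arcs: exactly one of the two endpoints belongs to `I`. -/
def specialArcs (x : PartialMatching k n) (I : Finset (Fin n)) : Finset (Finset (Fin n)) :=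
  x.arcs.filter fun e => (e ∩ I).card = 1

/-- The other endpoint of the arc through `l ∈ S(τ)`. -/
def partner (x : PartialMatching k n) (l : x.τ.support) : x.τ.support :=
  ⟨x.τ l, Equiv.Perm.apply_mem_support.mpr l.2⟩

/-- A map `μ : S(τ) → {L, R, J}` is a marking with respect to `I` if exactly two arcs have an
endpoint marked `J`, for both of them this endpoint lies in `I` while the other endpoint does not
lie in `I` and is marked `R`, and every other arc has one endpoint marked `L` and the other one
marked `R`. -/
structure IsMarking (x : PartialMatching k n) (I : Finset (Fin n)) (μ : x.τ.support → Label) :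
    Prop where
  card_J : (Finset.univ.filter fun l => μ l = Label.J).card = 2
  of_J : ∀ l, μ l = Label.J →
    (l : Fin n) ∈ I ∧ (x.partner l : Fin n) ∉ I ∧ μ (x.partner l) = Label.R
  of_not_J : ∀ l, μ l ≠ Label.J → μ (x.partner l) ≠ Label.J →
    (μ l = Label.L ∧ μ (x.partner l) = Label.R) ∨ (μ l = Label.R ∧ μ (x.partner l) = Label.L)

/-- The set `μ⁻¹(a)` of the points with label `a`. -/
def labelled (x : PartialMatching k n) (μ : x.τ.support → Label) (a : Label) : Finset (Fin n) :=
  (Finset.univ.filter fun l => μ l = a).map (Function.Embedding.subtype _)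

end PartialMatching

/-- The chord `e` is located strictly between the chords `e₁` and `e₂` of the disk with boundary
points `1, …, n`: writing `e = {a, b}` with `a < b`, one of `e₁`, `e₂` lies in the open interval
from `a` to `b` and the other one lies in the complement of the closed interval. -/
def StrictlyBetween {n : ℕ} (e e₁ e₂ : Finset (Fin n)) : Prop :=
  ∃ a b : Fin n, a < b ∧ e = {a, b} ∧
    ((e₁ ⊆ Finset.Ioo a b ∧ Disjoint e₂ (Finset.Icc a b)) ∨
      (e₂ ⊆ Finset.Ioo a b ∧ Disjoint e₁ (Finset.Icc a b)))

namespace PartialMatching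

variable {k n : ℕ}

open Classical in
/-- The number `d_μ` of `I`-special arcs of `τ` located strictly between the two arcs that have an
endpoint marked `J`. -/
noncomputable def numBetween (x : PartialMatching k n) (I : Finset (Fin n))
    (μ : x.τ.support → Label) : ℕ :=
  ((x.specialArcs I).filter fun e => ∃ l₁ l₂ : x.τ.support,
    μ l₁ = Label.J ∧ μ l₂ = Label.J ∧ StrictlyBetween e (x.arc l₁) (x.arc l₂)).card

open Classical in
/-- The coefficient
`c_{τ,T} = ∑_μ (-1)^{d_μ} Δ_{T ⊔ μ⁻¹(L)}(A) Δ_{T ⊔ μ⁻¹(R) ⊔ μ⁻¹(J)}(B)`,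
where `A` and `B` are matrices with `k - 2` and `k + 2` rows representing `Λ^⊥` and `Λ'`. -/
noncomputable def coeff (x : PartialMatching k n) (I : Finset (Fin n))
    (A : Matrix (Fin (k - 2)) (Fin n) ℝ) (B : Matrix (Fin (k + 2)) (Fin n) ℝ) : ℝ :=
  ∑ μ : x.τ.support → Label with x.IsMarking I μ,
    (-1 : ℝ) ^ x.numBetween I μ *
      maxMinor A (x.T ∪ x.labelled μ Label.L) *
      maxMinor B (x.T ∪ x.labelled μ Label.R ∪ x.labelled μ Label.J)

end PartialMatching

/-- A pair `(Λ, Λ')` is immanant-positive if it belongs to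
`alt(Gr_{>0}(n-k+2, n)) × Gr_{>0}(k+2, n)` and all coefficients `c^{(i,j]}_{τ,T}(Λ, Λ')`, for
`i + 2 ≤ j ≤ i + n - 2` and `τ` with at least two `I_{(i,j]}`-special arcs, are positive.
Plücker coordinates are homogeneous, so the coefficients are computed from matrices representing
`Λ^⊥` and `Λ'`, normalized so that their maximal minors are positive; another such choice
multiplies all coefficients by one positive number. -/
def IsImmanantPositive (k n : ℕ) (Λ Λ' : Submodule ℝ (EuclideanSpace ℝ (Fin n))) : Prop :=
  (Λ, Λ') ∈ PositivePairs k n ∧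
    ∀ (A : Matrix (Fin (k - 2)) (Fin n) ℝ) (B : Matrix (Fin (k + 2)) (Fin n) ℝ),
      IsPositiveRep A Λᗮ → IsPositiveRep B Λ' →
      ∀ i j : ℤ, i + 2 ≤ j → j ≤ i + n - 2 →
        ∀ x : PartialMatching k n, 2 ≤ (x.specialArcs (cyclicInterval n i j)).card →
          0 < x.coeff (cyclicInterval n i j) A B

end TwoStepFlag

/-!
The coefficient of `(τ, T)` is the value of a linear functional on a polynomial. In variables
`ℓ_x`, `ρ_x`, for `x` in `{0, …, n - 1}`, let `pairing α β` be the functional on polynomials with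
`∏_{x ∈ I} ℓ_x ∏_{y ∈ J} ρ_y ↦ α(I) β(J)` and with value `0` on the monomials that are not
squarefree. The generating polynomial of a matching is (`NCMatching.poly`)
`∏_{x ∈ T} ℓ_x ρ_x * ∏_{arcs {x, y}} (ℓ_x ρ_y + ρ_x ℓ_y + (h x + h y) ρ_x ρ_y)`, where `h` is the
indicator function of the interval `I_{(i,j]}` times alternating signs on the matched points. As an
arc encloses an even number of matched points, `h x + h y` is `±1` for special arcs and `0` for the
other ones (up to a constant in the indicator function, which cancels). Expanding the product, the
number of rows of the two matrices forces exactly two arcs to contribute `ρ_x ρ_y`, and the product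
of their signs is `-(-1)^d`, where `d` is the number of special arcs separating them. Hence the
coefficient is `NCMatching.value`, minus the pairing of this polynomial with the maximal minors of
the first `k - 2` and the first `k + 2` rows (`PartialMatching.sum_markings_eq_value`).

Adding `t ≥ 0` times a column to the next one changes a coefficient in a controlled way: the new
coefficient is the old one plus a combination, with nonnegative coefficients in `t`, of coefficients
of matchings modified at the two adjacent points `p` and `q = p + 1`. An endpoint or a point of `T`
moves from `q` to `p`, a point of `T` is split into an arc, an arc `{p, q}` is contracted, or the
arcs through `p` and `q` are merged (`NCMatching.value_swap_free`,
`NCMatching.value_swap_distinguished`, `NCMatching.value_split`, `NCMatching.value_contract`,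
`NCMatching.value_merge`). Merging rests on the identity
`f(p, a) f(p, b) = ℓ_p ρ_p f(a, b)` modulo squares, in which the weights `h` are added; no sign
arises because the interval can be chosen not to separate `p` from `q`
(`NCMatching.exists_cuts_ne`).

By Neville elimination (`ConsecutivePos.induction`), the first rows of a totally positive matrix are
obtained from lower triangular rows by such column operations. For lower triangular rows only the
leading minors are nonzero, and the coefficients are nonnegative by inspection of the two
non-crossing matchings of four points (`NCMatching.IsInitial.exists_value`). So all coefficients are
nonnegative (`NCMatching.value_nonneg`). For strict positivity (`NCMatching.value_pos`), the
positivity conditions used by the elimination are open, so a column operation with small `t > 0` can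
be split off from the matrix between any two neighbouring columns. It can be chosen such that a
modified matching occurs that still has two special arcs and has its points further to the left, to
which induction applies: move a point to the left, if possible; otherwise merge a special with an
adjacent non-special arc; and if all arcs are special, contract one of them unless only two are
left.

That `Λ` itself is the image of a totally positive subspace under the alternating sign change is
Jacobi's identity between complementary minors of a matrix and of a matrix spanning its kernel
(`mem_image_altMap_of_orthogonal`).
-/

namespace TwoStepFlag

/-! ### Column operations and Neville elimination -/

/-- Adding `t` times a column to the next one moves the column index `q` of a maximal minor down to
its predecessor `p`. No sign appears, because `p` and `q` are adjacent. -/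
lemma maxMinor_add_adjacent_col {m n : ℕ} {p q : Fin n} (hpq : (q : ℕ) = p + 1) (t : ℝ)
    {A A' : Matrix (Fin m) (Fin n) ℝ}
    (hA : ∀ i j, A' i j = A i j + if j = q then t * A i p else 0) (I : Finset (Fin n)) :
    maxMinor A' I =
      maxMinor A I + if q ∈ I ∧ p ∉ I then t * maxMinor A (insert p (I.erase q)) else 0 := by
  have hne : p ≠ q := by rintro rfl; omega
  by_cases hI : I.card = m
  swap
  · have h0 : ¬ (q ∈ I ∧ p ∉ I ∧ (insert p (I.erase q)).card = m) := by
      rintro ⟨h1, h2, h3⟩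
      rw [Finset.card_insert_of_notMem (by simp [h2]), Finset.card_erase_add_one h1] at h3
      exact hI h3
    unfold maxMinor
    rw [dif_neg hI, dif_neg hI]
    split_ifs <;> simp_all
  · by_cases hq : q ∈ I
    swap
    · rw [if_neg (by tauto), add_zero]
      unfold maxMinor
      rw [dif_pos hI, dif_pos hI]
      congr 1
      ext i j
      have : I.orderEmbOfFin hI j ≠ q := fun h => hq (h ▸ Finset.orderEmbOfFin_mem I hI j)
      simp [hA, this]
    · obtain ⟨a, ha⟩ : ∃ a, I.orderEmbOfFin hI a = q := by
        have : q ∈ Set.range (I.orderEmbOfFin hI) := by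
          rw [Finset.range_orderEmbOfFin]; exact hq
        exact this
      have hdet : maxMinor A' I = maxMinor A I +
          t * ((A.submatrix id (I.orderEmbOfFin hI)).updateCol a fun i => A i p).det := by
        unfold maxMinor
        rw [dif_pos hI, dif_pos hI]
        have : A'.submatrix id (I.orderEmbOfFin hI) =
            (A.submatrix id (I.orderEmbOfFin hI)).updateCol a
              ((fun i => A i q) + t • fun i => A i p) := by
          ext i j
          by_cases hj : j = a
          · subst hj; simp [hA, ha]
          · have : I.orderEmbOfFin hI j ≠ q := fun h =>
              hj ((I.orderEmbOfFin hI).injective (h.trans ha.symm))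
            simp [hA, this, hj]
        rw [this, Matrix.det_updateCol_add, Matrix.det_updateCol_smul]
        congr 2
        ext i j
        by_cases hj : j = a
        · subst hj; simp [ha]
        · simp [hj]
      rw [hdet]
      congr 1
      by_cases hp : p ∈ I
      · rw [if_neg (by tauto)]
        obtain ⟨b, hb⟩ : ∃ b, I.orderEmbOfFin hI b = p := by
          have : p ∈ Set.range (I.orderEmbOfFin hI) := by
            rw [Finset.range_orderEmbOfFin]; exact hp
          exact this
        have hab : b ≠ a := by rintro rfl; exact hne (hb.symm.trans ha)
        rw [Matrix.det_zero_of_column_eq hab, mul_zero]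
        intro i
        simp [hab, hb]
      · rw [if_pos ⟨hq, hp⟩]
        congr 1
        have hc : (insert p (I.erase q)).card = m := by
          rw [Finset.card_insert_of_notMem (by simp [hp]), Finset.card_erase_add_one hq, hI]
        have hnp : ∀ x, (I.orderEmbOfFin hI x : ℕ) ≠ p := fun x h =>
          hp (Fin.ext h ▸ Finset.orderEmbOfFin_mem I hI x)
        have hf := Finset.orderEmbOfFin_unique hc
          (f := fun x => if x = a then p else I.orderEmbOfFin hI x) (by
            intro x
            by_cases hx : x = a
            · simp [hx]
            · have h1 : I.orderEmbOfFin hI x ≠ q := fun h =>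
                hx ((I.orderEmbOfFin hI).injective (h.trans ha.symm))
              simp [hx, h1]) (by
            intro x y hxy
            have h1 : ((I.orderEmbOfFin hI x : Fin n) : ℕ) < I.orderEmbOfFin hI y :=
              (I.orderEmbOfFin hI).strictMono hxy
            have hx := hnp x
            have hy := hnp y
            have haq : ((I.orderEmbOfFin hI a : Fin n) : ℕ) = p + 1 := by rw [ha, hpq]
            rw [Fin.lt_def]
            dsimp only
            split_ifs with h2 h3 h3
            · subst h2 h3; omega
            · subst h2; omega
            · subst h3; omega
            · exact h1)
        unfold maxMinor
        rw [dif_pos hc]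
        congr 1
        ext i j
        rw [Matrix.submatrix_apply, ← hf]
        by_cases hj : j = a
        · simp [hj]
        · simp [hj]

/-- The `m × n` upper left corner of an infinite matrix. -/
def corner (m n : ℕ) (M : ℕ → ℕ → ℝ) : Matrix (Fin m) (Fin n) ℝ :=
  Matrix.of fun i j => M i j

/-- The column operation that adds `t` times column `p` to column `p + 1`. -/
def addCol (p : ℕ) (t : ℝ) (M : ℕ → ℕ → ℝ) : ℕ → ℕ → ℝ :=
  fun i j => M i j + if j = p + 1 then t * M i p else 0

lemma addCol_addCol_neg (p : ℕ) (t : ℝ) (M : ℕ → ℕ → ℝ) :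
    addCol p t (addCol p (-t) M) = M := by
  funext i j
  unfold addCol
  split_ifs <;> first | omega | simp

lemma maxMinor_corner_addCol {n : ℕ} {p q : Fin n} (hpq : (q : ℕ) = p + 1) (t : ℝ) (m : ℕ)
    (M : ℕ → ℕ → ℝ) (I : Finset (Fin n)) :
    maxMinor (corner m n (addCol p t M)) I = maxMinor (corner m n M) I +
      if q ∈ I ∧ p ∉ I then t * maxMinor (corner m n M) (insert p (I.erase q)) else 0 := by
  apply maxMinor_add_adjacent_col hpq
  intro i j
  simp [corner, addCol, ← hpq, Fin.ext_iff]

/-- The `m × m` block of consecutive rows and columns with upper left entry `(r, c)`. -/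
def block (M : ℕ → ℕ → ℝ) (r c m : ℕ) : Matrix (Fin m) (Fin m) ℝ :=
  Matrix.of fun i j => M (r + i) (c + j)

/-- All minors formed by the first `m ≤ R` rows and by `m` consecutive columns are positive. This
open condition is what makes Neville elimination run with positive multipliers. -/
def ConsecutivePos (R n : ℕ) (M : ℕ → ℕ → ℝ) : Prop :=
  ∀ m j, m ≤ R → j + m ≤ n → 0 < (block M 0 j m).det

/-- The state of Neville elimination after `r` rows: the first `r` rows are lower triangular with
positive diagonal, and the remaining block still satisfies `ConsecutivePos`. -/
structure Eliminated (R n r : ℕ) (M : ℕ → ℕ → ℝ) : Prop where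
  zero : ∀ i j, i < r → i < j → j < n → M i j = 0
  diag : ∀ i, i < r → 0 < M i i
  minor : ∀ m j, r + m ≤ R → r ≤ j → j + m ≤ n → 0 < (block M r j m).det

/-- Elimination of the entries of row `r` in the columns `≥ c`, each by means of the previous
column. -/
noncomputable def eliminate (r n c : ℕ) (M : ℕ → ℕ → ℝ) : ℕ → ℕ → ℝ :=
  fun i j => M i j - if c ≤ j ∧ j < n then M r j / M r (j - 1) * M i (j - 1) else 0

lemma eliminate_succ (r n c : ℕ) (hc : c + 1 < n) (M : ℕ → ℕ → ℝ) :
    eliminate r n (c + 2) M =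
      addCol c (M r (c + 1) / M r c) (eliminate r n (c + 1) M) := by
  funext i j
  unfold addCol eliminate
  by_cases hj : j = c + 1
  · subst hj
    simp [hc]
  · have : (c + 2 ≤ j ∧ j < n) ↔ (c + 1 ≤ j ∧ j < n) := by omega
    simp [hj, this]

lemma Eliminated.entry_pos {R n r : ℕ} {M : ℕ → ℕ → ℝ} (h : Eliminated R n r M) (hr : r < R)
    {j : ℕ} (h1 : r ≤ j) (h2 : j < n) : 0 < M r j := by
  simpa [block] using h.minor 1 j hr h1 h2

lemma Eliminated.eliminate {R n r : ℕ} {M : ℕ → ℕ → ℝ} (h : Eliminated R n r M) (hr : r < R)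
    (hR : R ≤ n) : Eliminated R n (r + 1) (eliminate r n (r + 1) M) where
  zero i j hi hij hj := by
    unfold TwoStepFlag.eliminate
    rcases Nat.lt_succ_iff_lt_or_eq.mp hi with hi | rfl
    · rw [h.zero i j hi hij hj]
      split_ifs with hc
      · rw [h.zero i (j - 1) hi (by omega) (by omega)]; simp
      · simp
    · rw [if_pos ⟨hij, hj⟩, div_mul_cancel₀, sub_self]
      exact (h.entry_pos hr (by omega) (by omega)).ne'
  diag i hi := by
    unfold TwoStepFlag.eliminate
    rw [if_neg (by omega), sub_zero]
    rcases Nat.lt_succ_iff_lt_or_eq.mp hi with hi | rfl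
    · exact h.diag i hi
    · exact h.entry_pos hr le_rfl (by omega)
  minor m j hm hj hjm := by
    rcases Nat.eq_zero_or_pos m with rfl | hm0
    · simp
    obtain ⟨c, rfl⟩ : ∃ c, j = c + 1 := ⟨j - 1, by omega⟩
    have hpos := h.minor (m + 1) c (by omega) (by omega) (by omega)
    have hc := h.entry_pos hr (j := c) (by omega) (by omega)
    -- The new block bordered by row `r` and column `c`: the column operations turn row `r` of
    -- this larger block into `(M r c, 0, …, 0)`.
    have hdet : (block M r c (m + 1)).det = M r c * (block (TwoStepFlag.eliminate r n (r + 1) M)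
        (r + 1) (c + 1) m).det := by
      rw [Matrix.det_eq_of_forall_col_eq_smul_add_pred
        (B := Matrix.of fun i j : Fin (m + 1) => Fin.cases (M (r + i) c)
          (fun b => TwoStepFlag.eliminate r n (r + 1) M (r + i) (c + 1 + b)) j)
        (fun b => M r (c + 1 + b) / M r (c + b))]
      · rw [Matrix.det_succ_row_zero, Fin.sum_univ_succ]
        simp only [Fin.val_zero, pow_zero, Matrix.of_apply, Fin.cases_zero, add_zero, one_mul,
          Fin.cases_succ]
        rw [Finset.sum_eq_zero, add_zero]
        · congr 2
          ext a b
          simp [block, Matrix.submatrix, add_comm, add_left_comm]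
        · intro b _
          have : TwoStepFlag.eliminate r n (r + 1) M r (c + 1 + b) = 0 := by
            unfold TwoStepFlag.eliminate
            rw [if_pos ⟨by omega, by omega⟩, div_mul_cancel₀, sub_self]
            exact (h.entry_pos hr (by omega) (by omega)).ne'
          rw [this]
          simp
      · intro i
        simp [block]
      · intro i b
        have hb : c + 1 + (b : ℕ) - 1 = c + b := by omega
        simp only [block, Matrix.of_apply, Fin.cases_succ, Fin.val_succ, Fin.val_castSucc]
        unfold TwoStepFlag.eliminate
        rw [if_pos ⟨by omega, by omega⟩, hb, ← add_assoc, add_right_comm c]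
        ring
    rw [hdet] at hpos
    exact pos_of_mul_pos_right hpos hc.le

/-- Neville elimination as an induction principle: a property of matrices that holds for lower
triangular matrices with positive diagonal and is preserved by adding a nonnegative multiple of a
column to the next one holds for all matrices with `ConsecutivePos`. -/
theorem ConsecutivePos.induction {R n : ℕ} (hR : R ≤ n) (Good : (ℕ → ℕ → ℝ) → Prop)
    (base : ∀ M, (∀ i j, i < R → i < j → j < n → M i j = 0) → (∀ i, i < R → 0 < M i i) → Good M)
    (step : ∀ M p t, p + 1 < n → 0 ≤ t → Good M → Good (addCol p t M))
    {M : ℕ → ℕ → ℝ} (hM : ConsecutivePos R n M) : Good M := by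
  have key : ∀ d r, r + d = R → ∀ M, Eliminated R n r M → Good M := by
    intro d
    induction d with
    | zero =>
      rintro r rfl M h
      exact base M h.zero h.diag
    | succ d ih =>
      intro r hr M h
      have h1 : Good (eliminate r n (r + 1) M) :=
        ih (r + 1) (by omega) _ (h.eliminate (by omega) hR)
      have h2 : ∀ e, r + 1 + e ≤ n → Good (eliminate r n (r + 1 + e) M) := by
        intro e
        induction e with
        | zero => exact fun _ => h1
        | succ e ihe =>
          intro he
          have : r + 1 + (e + 1) = (r + e) + 2 := by omega
          rw [this, eliminate_succ r n (r + e) (by omega)]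
          refine step _ _ _ (by omega) ?_ ?_
          · exact (div_pos (h.entry_pos (by omega) (by omega) (by omega))
              (h.entry_pos (by omega) (by omega) (by omega))).le
          · have : r + e + 1 = r + 1 + e := by omega
            rw [this]
            exact ihe (by omega)
      have h3 := h2 (n - (r + 1)) (by omega)
      have h4 : eliminate r n (r + 1 + (n - (r + 1))) M = M := by
        funext i j
        unfold eliminate
        rw [if_neg (by omega), sub_zero]
      rwa [h4] at h3
  refine key R 0 (by omega) M ⟨by omega, by omega, ?_⟩
  intro m j hm _ hjm
  exact hM m j (by omega) hjm

/-- `ConsecutivePos` is an open condition along the column operations. -/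
lemma ConsecutivePos.exists_addCol_neg {R n : ℕ} {M : ℕ → ℕ → ℝ} (hM : ConsecutivePos R n M)
    (p : ℕ) : ∃ t : ℝ, 0 < t ∧ ConsecutivePos R n (addCol p (-t) M) := by
  have hcont : ∀ m j, Continuous fun t : ℝ => (block (addCol p (-t) M) 0 j m).det := by
    intro m j
    refine Continuous.matrix_det (continuous_matrix fun a b => ?_)
    simp only [block, addCol, Matrix.of_apply]
    split_ifs <;> fun_prop
  have h0 : addCol p (-(0 : ℝ)) M = M := by
    funext i j; simp [addCol]
  have hev : ∀ᶠ t : ℝ in nhds 0, ∀ m ∈ Finset.range (R + 1), ∀ j ∈ Finset.range (n + 1),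
      j + m ≤ n → 0 < (block (addCol p (-t) M) 0 j m).det := by
    simp only [Finset.eventually_all]
    intro m hm j hj
    by_cases hjm : j + m ≤ n
    · have hpos : 0 < (block (addCol p (-(0 : ℝ)) M) 0 j m).det := by
        rw [h0]
        exact hM m j (by simpa [Nat.lt_succ_iff] using hm) hjm
      filter_upwards [(hcont m j).continuousAt.eventually (lt_mem_nhds hpos)] with t ht _
      exact ht
    · exact Filter.Eventually.of_forall fun t h => absurd h hjm
  obtain ⟨t, ht, ht0⟩ := ((hev.filter_mono nhdsWithin_le_nhds).and
    (self_mem_nhdsWithin : Set.Ioi (0 : ℝ) ∈ nhdsWithin 0 (Set.Ioi 0))).exists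
  refine ⟨t, ht0, fun m j hm hjm => ht m ?_ j ?_ hjm⟩ <;> simp <;> omega

/-! ### Generating polynomials of matchings -/

section Polynomial

open MvPolynomial

variable {n : ℕ}

/-- The points `x` with `ℓ_x` in the monomial `m`. -/
def leftSet (m : Fin n ⊕ Fin n →₀ ℕ) : Finset (Fin n) :=
  Finset.univ.filter fun x => m (Sum.inl x) ≠ 0

/-- The points `x` with `ρ_x` in the monomial `m`. -/
def rightSet (m : Fin n ⊕ Fin n →₀ ℕ) : Finset (Fin n) :=
  Finset.univ.filter fun x => m (Sum.inr x) ≠ 0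

/-- The monomials in which every variable has degree at most one. -/
def IsMultilinear (m : Fin n ⊕ Fin n →₀ ℕ) : Prop := ∀ i, m i ≤ 1

open Classical in
/-- The value `α(I) β(J)` of the monomial `∏_{x ∈ I} ℓ_x ∏_{y ∈ J} ρ_y`, and `0` for monomials that
are not squarefree. -/
noncomputable def monomialValue (α β : Finset (Fin n) → ℝ) (m : Fin n ⊕ Fin n →₀ ℕ) : ℝ :=
  if IsMultilinear m then α (leftSet m) * β (rightSet m) else 0

/-- The linear functional on polynomials in the variables `ℓ_x = X (inl x)`, `ρ_x = X (inr x)` with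
the values `monomialValue α β` on monomials. -/
noncomputable def pairing (α β : Finset (Fin n) → ℝ) :
    MvPolynomial (Fin n ⊕ Fin n) ℝ →ₗ[ℝ] ℝ :=
  (basisMonomials (Fin n ⊕ Fin n) ℝ).constr ℝ (monomialValue α β)

lemma pairing_monomial (α β : Finset (Fin n) → ℝ) (m : Fin n ⊕ Fin n →₀ ℕ) :
    pairing α β (monomial m 1) = monomialValue α β m := by
  have := (basisMonomials (Fin n ⊕ Fin n) ℝ).constr_basis ℝ (monomialValue α β) m
  rwa [coe_basisMonomials] at this

/-- The variable `ℓ_x`. -/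
noncomputable def lv (x : Fin n) : MvPolynomial (Fin n ⊕ Fin n) ℝ := X (Sum.inl x)

/-- The variable `ρ_x`. -/
noncomputable def rv (x : Fin n) : MvPolynomial (Fin n ⊕ Fin n) ℝ := X (Sum.inr x)

lemma lv_mul_monomial (x : Fin n) (m : Fin n ⊕ Fin n →₀ ℕ) :
    lv x * monomial m 1 = monomial (Finsupp.single (Sum.inl x) 1 + m) (1 : ℝ) := by
  rw [lv, X, monomial_mul, one_mul]

lemma rv_mul_monomial (x : Fin n) (m : Fin n ⊕ Fin n →₀ ℕ) :
    rv x * monomial m 1 = monomial (Finsupp.single (Sum.inr x) 1 + m) (1 : ℝ) := by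
  rw [rv, X, monomial_mul, one_mul]

lemma leftSet_single_inl (x : Fin n) (m : Fin n ⊕ Fin n →₀ ℕ) :
    leftSet (Finsupp.single (Sum.inl x) 1 + m) = insert x (leftSet m) := by
  classical
  ext y
  by_cases h : y = x
  · subst h; simp [leftSet]
  · simp [leftSet, Finsupp.single_apply, h, Ne.symm h]

lemma leftSet_single_inr (x : Fin n) (m : Fin n ⊕ Fin n →₀ ℕ) :
    leftSet (Finsupp.single (Sum.inr x) 1 + m) = leftSet m := by
  ext y
  simp [leftSet]

lemma rightSet_single_inr (x : Fin n) (m : Fin n ⊕ Fin n →₀ ℕ) :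
    rightSet (Finsupp.single (Sum.inr x) 1 + m) = insert x (rightSet m) := by
  classical
  ext y
  by_cases h : y = x
  · subst h; simp [rightSet]
  · simp [rightSet, Finsupp.single_apply, h, Ne.symm h]

lemma rightSet_single_inl (x : Fin n) (m : Fin n ⊕ Fin n →₀ ℕ) :
    rightSet (Finsupp.single (Sum.inl x) 1 + m) = rightSet m := by
  ext y
  simp [rightSet]

lemma isMultilinear_single_add {i : Fin n ⊕ Fin n} {m : Fin n ⊕ Fin n →₀ ℕ} :
    IsMultilinear (Finsupp.single i 1 + m) ↔ IsMultilinear m ∧ m i = 0 := by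
  classical
  constructor
  · intro h
    refine ⟨fun j => ?_, ?_⟩
    · have := h j
      rw [Finsupp.add_apply] at this
      omega
    · have := h i
      rw [Finsupp.add_apply, Finsupp.single_eq_same] at this
      omega
  · rintro ⟨h1, h2⟩ j
    by_cases hj : j = i
    · subst hj; simp [h2]
    · simpa [Finsupp.single_apply, Ne.symm hj] using h1 j

lemma mem_leftSet {m : Fin n ⊕ Fin n →₀ ℕ} {x : Fin n} :
    x ∈ leftSet m ↔ ¬ m (Sum.inl x) = 0 := by simp [leftSet]

lemma mem_rightSet {m : Fin n ⊕ Fin n →₀ ℕ} {x : Fin n} :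
    x ∈ rightSet m ↔ ¬ m (Sum.inr x) = 0 := by simp [rightSet]

/-- The effect of adding `t` times column `p` to the next column `q` on the maximal minors. -/
def IsColOp (p q : Fin n) (t : ℝ) (α α' : Finset (Fin n) → ℝ) : Prop :=
  ∀ I, α' I = α I + if q ∈ I ∧ p ∉ I then t * α (insert p (I.erase q)) else 0

lemma IsColOp.of_notMem {p q : Fin n} {t : ℝ} {α α' : Finset (Fin n) → ℝ}
    (h : IsColOp p q t α α') {I : Finset (Fin n)} (hq : q ∉ I) : α' I = α I := by
  rw [h I, if_neg (by tauto), add_zero]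

lemma IsColOp.insert {p q : Fin n} {t : ℝ} {α α' : Finset (Fin n) → ℝ} (hpq : p ≠ q)
    (h : IsColOp p q t α α') {I : Finset (Fin n)} (hq : q ∉ I) :
    α' (insert q I) = α (insert q I) + if p ∈ I then 0 else t * α (insert p I) := by
  rw [h, Finset.erase_insert hq]
  by_cases hp : p ∈ I <;> simp [hp, hpq]

/-- The subalgebra of the polynomials that do not involve the variables `ℓ_q` and `ρ_q`. -/
noncomputable def withoutPoint (q : Fin n) : Subalgebra ℝ (MvPolynomial (Fin n ⊕ Fin n) ℝ) :=
  supported ℝ {i | i ≠ Sum.inl q ∧ i ≠ Sum.inr q}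

lemma lv_mem_withoutPoint {x q : Fin n} (h : x ≠ q) : lv x ∈ withoutPoint q := by
  unfold withoutPoint lv
  rw [X_mem_supported]
  simpa using h

lemma rv_mem_withoutPoint {x q : Fin n} (h : x ≠ q) : rv x ∈ withoutPoint q := by
  unfold withoutPoint rv
  rw [X_mem_supported]
  simpa using h

lemma eq_of_eq_on_withoutPoint {q : Fin n} (F G : MvPolynomial (Fin n ⊕ Fin n) ℝ →ₗ[ℝ] ℝ)
    (h : ∀ m : Fin n ⊕ Fin n →₀ ℕ, m (Sum.inl q) = 0 → m (Sum.inr q) = 0 →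
      F (monomial m 1) = G (monomial m 1))
    {U : MvPolynomial (Fin n ⊕ Fin n) ℝ} (hU : U ∈ withoutPoint q) : F U = G U := by
  unfold withoutPoint at hU
  rw [mem_supported] at hU
  rw [U.as_sum, map_sum, map_sum]
  refine Finset.sum_congr rfl fun m hm => ?_
  have hv : ∀ i, m i ≠ 0 → i ≠ Sum.inl q ∧ i ≠ Sum.inr q := fun i hi =>
    hU (by
      rw [Finset.mem_coe, mem_vars_iff_mem_support]
      exact ⟨m, hm, by simpa using hi⟩)
  have h1 : m (Sum.inl q) = 0 := by
    by_contra h1; exact (hv _ h1).1 rfl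
  have h2 : m (Sum.inr q) = 0 := by
    by_contra h2; exact (hv _ h2).2 rfl
  have : monomial m (coeff m U) = (coeff m U) • monomial m (1 : ℝ) := by
    rw [smul_monomial, smul_eq_mul, mul_one]
  rw [this, map_smul, map_smul, h m h1 h2]

section ColOp

variable {p q : Fin n} {t : ℝ} {α α' β β' : Finset (Fin n) → ℝ}

lemma pairing_colOp (hα : IsColOp p q t α α') (hβ : IsColOp p q t β β')
    {U : MvPolynomial (Fin n ⊕ Fin n) ℝ} (hU : U ∈ withoutPoint q) :
    pairing α' β' U = pairing α β U := by
  refine eq_of_eq_on_withoutPoint _ _ (fun m h1 h2 => ?_) hU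
  rw [pairing_monomial, pairing_monomial, monomialValue, monomialValue,
    hα.of_notMem (by simp [mem_leftSet, h1]), hβ.of_notMem (by simp [mem_rightSet, h2])]

lemma pairing_colOp_lv (hpq : p ≠ q) (hα : IsColOp p q t α α') (hβ : IsColOp p q t β β')
    {U : MvPolynomial (Fin n ⊕ Fin n) ℝ} (hU : U ∈ withoutPoint q) :
    pairing α' β' (lv q * U) = pairing α β (lv q * U) + t * pairing α β (lv p * U) := by
  refine eq_of_eq_on_withoutPoint (pairing α' β' ∘ₗ LinearMap.mulLeft ℝ (lv q))
    (pairing α β ∘ₗ LinearMap.mulLeft ℝ (lv q) + t • (pairing α β ∘ₗ LinearMap.mulLeft ℝ (lv p)))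
    (fun m h1 h2 => ?_) hU
  classical
  have hl : q ∉ leftSet m := by simp [mem_leftSet, h1]
  have hr : q ∉ rightSet m := by simp [mem_rightSet, h2]
  simp only [LinearMap.comp_apply, LinearMap.mulLeft_apply, LinearMap.add_apply,
    LinearMap.smul_apply, lv_mul_monomial, pairing_monomial, monomialValue, leftSet_single_inl,
    rightSet_single_inl, isMultilinear_single_add, hα.insert hpq hl, hβ.of_notMem hr, smul_eq_mul,
    h1, mem_leftSet]
  by_cases h3 : IsMultilinear m <;> by_cases h4 : m (Sum.inl p) = 0 <;> simp [h3, h4]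
  ring

lemma pairing_colOp_rv (hpq : p ≠ q) (hα : IsColOp p q t α α') (hβ : IsColOp p q t β β')
    {U : MvPolynomial (Fin n ⊕ Fin n) ℝ} (hU : U ∈ withoutPoint q) :
    pairing α' β' (rv q * U) = pairing α β (rv q * U) + t * pairing α β (rv p * U) := by
  refine eq_of_eq_on_withoutPoint (pairing α' β' ∘ₗ LinearMap.mulLeft ℝ (rv q))
    (pairing α β ∘ₗ LinearMap.mulLeft ℝ (rv q) + t • (pairing α β ∘ₗ LinearMap.mulLeft ℝ (rv p)))
    (fun m h1 h2 => ?_) hU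
  classical
  have hl : q ∉ leftSet m := by simp [mem_leftSet, h1]
  have hr : q ∉ rightSet m := by simp [mem_rightSet, h2]
  simp only [LinearMap.comp_apply, LinearMap.mulLeft_apply, LinearMap.add_apply,
    LinearMap.smul_apply, rv_mul_monomial, pairing_monomial, monomialValue, leftSet_single_inr,
    rightSet_single_inr, isMultilinear_single_add, hβ.insert hpq hr, hα.of_notMem hl, smul_eq_mul,
    h2, mem_rightSet]
  by_cases h3 : IsMultilinear m <;> by_cases h4 : m (Sum.inr p) = 0 <;> simp [h3, h4]
  ring

lemma pairing_colOp_lv_rv (hpq : p ≠ q) (hα : IsColOp p q t α α') (hβ : IsColOp p q t β β')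
    {U : MvPolynomial (Fin n ⊕ Fin n) ℝ} (hU : U ∈ withoutPoint q) :
    pairing α' β' (lv q * (rv q * U)) = pairing α β (lv q * (rv q * U)) +
      t * (pairing α β (lv p * (rv q * U)) + pairing α β (lv q * (rv p * U))) +
      t ^ 2 * pairing α β (lv p * (rv p * U)) := by
  refine eq_of_eq_on_withoutPoint
    (pairing α' β' ∘ₗ LinearMap.mulLeft ℝ (lv q) ∘ₗ LinearMap.mulLeft ℝ (rv q))
    (pairing α β ∘ₗ LinearMap.mulLeft ℝ (lv q) ∘ₗ LinearMap.mulLeft ℝ (rv q) +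
      t • (pairing α β ∘ₗ LinearMap.mulLeft ℝ (lv p) ∘ₗ LinearMap.mulLeft ℝ (rv q) +
        pairing α β ∘ₗ LinearMap.mulLeft ℝ (lv q) ∘ₗ LinearMap.mulLeft ℝ (rv p)) +
      t ^ 2 • (pairing α β ∘ₗ LinearMap.mulLeft ℝ (lv p) ∘ₗ LinearMap.mulLeft ℝ (rv p)))
    (fun m h1 h2 => ?_) hU
  classical
  have hl : q ∉ leftSet m := by simp [mem_leftSet, h1]
  have hr : q ∉ rightSet m := by simp [mem_rightSet, h2]
  simp only [LinearMap.comp_apply, LinearMap.mulLeft_apply, LinearMap.add_apply,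
    LinearMap.smul_apply, rv_mul_monomial, lv_mul_monomial, pairing_monomial, monomialValue,
    leftSet_single_inr, leftSet_single_inl, rightSet_single_inl,
    rightSet_single_inr, isMultilinear_single_add, hβ.insert hpq hr, hα.insert hpq hl, smul_eq_mul,
    h2, mem_rightSet, mem_leftSet]
  by_cases h3 : IsMultilinear m <;> by_cases h4 : m (Sum.inr p) = 0 <;>
    by_cases h5 : m (Sum.inl p) = 0 <;> simp [h1, h3, h4, h5] <;> ring

end ColOp

lemma pairing_lv_sq (α β : Finset (Fin n) → ℝ) (p : Fin n) (U : MvPolynomial (Fin n ⊕ Fin n) ℝ) :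
    pairing α β (lv p * (lv p * U)) = 0 := by
  induction U using MvPolynomial.induction_on' with
  | monomial m c =>
    have : monomial m c = c • monomial m (1 : ℝ) := by
      rw [smul_monomial, smul_eq_mul, mul_one]
    rw [this, mul_smul_comm, mul_smul_comm, map_smul, lv_mul_monomial, lv_mul_monomial,
      pairing_monomial, monomialValue, if_neg, smul_zero]
    rw [isMultilinear_single_add]
    simp
  | add a b ha hb => rw [mul_add, mul_add, map_add, ha, hb, add_zero]

lemma pairing_rv_sq (α β : Finset (Fin n) → ℝ) (p : Fin n) (U : MvPolynomial (Fin n ⊕ Fin n) ℝ) :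
    pairing α β (rv p * (rv p * U)) = 0 := by
  induction U using MvPolynomial.induction_on' with
  | monomial m c =>
    have : monomial m c = c • monomial m (1 : ℝ) := by
      rw [smul_monomial, smul_eq_mul, mul_one]
    rw [this, mul_smul_comm, mul_smul_comm, map_smul, rv_mul_monomial, rv_mul_monomial,
      pairing_monomial, monomialValue, if_neg, smul_zero]
    rw [isMultilinear_single_add]
    simp
  | add a b ha hb => rw [mul_add, mul_add, map_add, ha, hb, add_zero]

/-- The factor of an arc `{x, y}`: the arc either has its endpoints in different sets, or, with the
weight `z`, both in the right set. -/
noncomputable def arcFactor (x y : Fin n) (z : ℝ) : MvPolynomial (Fin n ⊕ Fin n) ℝ :=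
  lv x * rv y + rv x * lv y + C z * (rv x * rv y)

lemma arcFactor_comm (x y : Fin n) (z : ℝ) : arcFactor x y z = arcFactor y x z := by
  unfold arcFactor; ring

lemma arcFactor_mem {x y q : Fin n} (hx : x ≠ q) (hy : y ≠ q) (z : ℝ) :
    arcFactor x y z ∈ withoutPoint q := by
  have hC : (C z : MvPolynomial (Fin n ⊕ Fin n) ℝ) ∈ withoutPoint q :=
    (withoutPoint q).algebraMap_mem z
  exact add_mem (add_mem
    (mul_mem (lv_mem_withoutPoint hx) (rv_mem_withoutPoint hy))
    (mul_mem (rv_mem_withoutPoint hx) (lv_mem_withoutPoint hy)))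
    (mul_mem hC (mul_mem (rv_mem_withoutPoint hx) (rv_mem_withoutPoint hy)))

lemma pairing_C_mul (α β : Finset (Fin n) → ℝ) (z : ℝ) (U : MvPolynomial (Fin n ⊕ Fin n) ℝ) :
    pairing α β (C z * U) = z * pairing α β U := by
  rw [C_mul', map_smul, smul_eq_mul]

lemma pairing_colOp_arcFactor {p q : Fin n} {t : ℝ} {α α' β β' : Finset (Fin n) → ℝ}
    (hpq : p ≠ q) (hα : IsColOp p q t α α') (hβ : IsColOp p q t β β') {b : Fin n} (hb : b ≠ q)
    (z : ℝ) {U : MvPolynomial (Fin n ⊕ Fin n) ℝ} (hU : U ∈ withoutPoint q) :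
    pairing α' β' (arcFactor q b z * U) =
      pairing α β (arcFactor q b z * U) + t * pairing α β (arcFactor p b z * U) := by
  have expand : ∀ x, arcFactor x b z * U =
      lv x * (rv b * U) + rv x * (lv b * U) + C z * (rv x * (rv b * U)) := by
    intro x; unfold arcFactor; ring
  have hr := mul_mem (rv_mem_withoutPoint hb) hU
  have hl := mul_mem (lv_mem_withoutPoint hb) hU
  simp only [expand, map_add, pairing_C_mul, pairing_colOp_lv hpq hα hβ hr,
    pairing_colOp_rv hpq hα hβ hr, pairing_colOp_rv hpq hα hβ hl]
  ring

/-- Two arcs meeting in `p` merge: modulo the squares of the variables,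
`f(p, a) f(p, b) = ℓ_p ρ_p f(a, b)`, and the weights add up. -/
lemma pairing_arcFactor_mul (α β : Finset (Fin n) → ℝ) (p a b : Fin n) (z w : ℝ)
    (U : MvPolynomial (Fin n ⊕ Fin n) ℝ) :
    pairing α β (arcFactor p a z * (arcFactor p b w * U)) =
      pairing α β (lv p * rv p * (arcFactor a b (z + w) * U)) := by
  have : arcFactor p a z * (arcFactor p b w * U) =
      lv p * rv p * (arcFactor a b (z + w) * U) +
      (lv p * (lv p * (rv a * rv b * U)) +
        rv p * (rv p * ((lv a * lv b + C w * (lv a * rv b) + C z * (rv a * lv b) +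
          C z * C w * (rv a * rv b)) * U))) := by
    unfold arcFactor
    rw [C_add]
    ring
  rw [this, map_add, map_add, pairing_lv_sq, pairing_rv_sq, add_zero, add_zero]

lemma pairing_lv_rv_arcFactor (α β : Finset (Fin n) → ℝ) (p a : Fin n) (z : ℝ)
    (U : MvPolynomial (Fin n ⊕ Fin n) ℝ) :
    pairing α β (lv p * rv p * (arcFactor p a z * U)) = 0 := by
  have : lv p * rv p * (arcFactor p a z * U) = lv p * (lv p * (rv p * rv a * U)) +
      rv p * (rv p * ((lv p * lv a + C z * (lv p * rv a)) * U)) := by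
    unfold arcFactor; ring
  rw [this, map_add, pairing_lv_sq, pairing_rv_sq, add_zero]

lemma pairing_arcFactor_self (α β : Finset (Fin n) → ℝ) (p : Fin n) (z : ℝ)
    (U : MvPolynomial (Fin n ⊕ Fin n) ℝ) :
    pairing α β (arcFactor p p z * U) = 2 * pairing α β (lv p * rv p * U) := by
  have : arcFactor p p z * U = (2 : ℝ) • (lv p * rv p * U) + rv p * (rv p * (C z * U)) := by
    unfold arcFactor; rw [two_smul]; ring
  rw [this, map_add, pairing_rv_sq, map_smul, smul_eq_mul, add_zero]

lemma pairing_colOp_lv_mul_rv {p q : Fin n} {t : ℝ} {α α' β β' : Finset (Fin n) → ℝ}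
    (hpq : p ≠ q) (hα : IsColOp p q t α α') (hβ : IsColOp p q t β β')
    {U : MvPolynomial (Fin n ⊕ Fin n) ℝ} (hU : U ∈ withoutPoint q) :
    pairing α' β' (lv q * rv q * U) = pairing α β (lv q * rv q * U) +
      t * pairing α β (arcFactor p q 0 * U) + t ^ 2 * pairing α β (lv p * rv p * U) := by
  have h1 : arcFactor p q 0 * U = lv p * (rv q * U) + lv q * (rv p * U) := by
    unfold arcFactor; rw [C_0]; ring
  rw [h1, mul_assoc, mul_assoc, map_add, pairing_colOp_lv_rv hpq hα hβ hU]

end Polynomial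

/-! ### Non-crossing matchings and their local moves -/

/-- A non-crossing matching `τ` of some points of `{0, …, n - 1}`, the other points being fixed,
with a set `T` of distinguished fixed points. The non-crossing condition says that the points
enclosed by an arc are matched among themselves. -/
structure NCMatching (n : ℕ) where
  /-- the involution -/
  τ : Fin n → Fin n
  /-- the distinguished fixed points -/
  T : Finset (Fin n)
  involutive : ∀ x, τ (τ x) = x
  nested : ∀ x y, x < y → y < τ x → x < τ y ∧ τ y < τ x
  fixed : ∀ x ∈ T, τ x = x

namespace NCMatching

variable {n : ℕ} (c : NCMatching n)

/-- The matched points. -/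
def support : Finset (Fin n) := Finset.univ.filter fun x => c.τ x ≠ x

lemma mem_support {x : Fin n} : x ∈ c.support ↔ c.τ x ≠ x := by simp [support]

/-- The sign `(-1)^r` of the `r`-th matched point (counting from `0`). -/
noncomputable def sgn (x : Fin n) : ℝ := (-1) ^ (c.support.filter (· < x)).card

/-- The two endpoints of an arc have opposite signs, as an arc encloses an even number of matched
points. -/
lemma sgn_partner {x : Fin n} (hx : c.τ x ≠ x) : c.sgn (c.τ x) = - c.sgn x := by
  have key : ∀ x, x < c.τ x → c.sgn (c.τ x) = - c.sgn x := by
    intro x hlt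
    set F := c.support.filter fun y => x < y ∧ y < c.τ x with hF
    have heven : ((-1 : ℝ)) ^ F.card = 1 := by
      rw [← Finset.prod_const]
      refine Finset.prod_involution (fun y _ => c.τ y) ?_ ?_ ?_ ?_
      · intros; norm_num
      · intro y hy _
        simp only [hF, Finset.mem_filter, mem_support] at hy
        exact hy.1
      · intro y hy
        simp only [hF, Finset.mem_filter, mem_support] at hy ⊢
        refine ⟨by rw [c.involutive]; exact hy.1.symm, c.nested x y hy.2.1 hy.2.2⟩
      · intro y _; exact c.involutive y
    have hsplit : c.support.filter (· < c.τ x) = insert x (c.support.filter (· < x) ∪ F) := by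
      ext y
      simp only [hF, Finset.mem_filter, mem_support, Finset.mem_insert, Finset.mem_union]
      constructor
      · rintro ⟨h1, h2⟩
        rcases lt_trichotomy y x with h | h | h <;> simp [h, h1, h2]
      · rintro (h | ⟨h1, h2⟩ | ⟨h1, -, h2⟩)
        · subst h; exact ⟨hlt.ne', hlt⟩
        · exact ⟨h1, h2.trans hlt⟩
        · exact ⟨h1, h2⟩
    unfold sgn
    rw [hsplit, Finset.card_insert_of_notMem (by simp [hF]), Finset.card_union_of_disjoint, pow_succ,
      pow_add, heven]
    · ring
    · rw [Finset.disjoint_left]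
      intro y h1 h2
      simp only [hF, Finset.mem_filter] at h1 h2
      exact absurd h1.2 (not_lt.mpr h2.2.1.le)
  rcases lt_or_gt_of_ne hx with h | h
  · have := key (c.τ x) (by rw [c.involutive]; exact h)
    rw [c.involutive] at this
    linarith
  · exact key x h

lemma sgn_ne_zero (x : Fin n) : c.sgn x ≠ 0 := by unfold sgn; positivity

/-- The contribution `sgn x` of a point `x` to the left of the cut `u`. -/
noncomputable def cut (u : ℕ) (x : Fin n) : ℝ := if (x : ℕ) < u then c.sgn x else 0

/-- The signed indicator function of the interval between the cuts `u` and `v`. An arc `{x, y}` is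
separated by the two cuts if and only if `height x + height y` is nonzero. -/
noncomputable def height (u v : ℕ) (x : Fin n) : ℝ := c.cut v x - c.cut u x

/-- The sum of `height` over the endpoints of the arc through `x`: it is `±1` if the arc is
separated by the cuts `u` and `v`, and `0` otherwise. -/
noncomputable def arcHeight (u v : ℕ) (x : Fin n) : ℝ :=
  c.height u v x + c.height u v (c.τ x)

lemma arcHeight_partner (u v : ℕ) (x : Fin n) : c.arcHeight u v (c.τ x) = c.arcHeight u v x := by
  unfold arcHeight; rw [c.involutive, add_comm]

/-- A cut between two neighbours `p` and `q` that are not matched with each other can be moved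
across the region enclosed by one of the arcs through `p` and `q` without changing which arcs it
separates. -/
lemma exists_cut_ne {p q : Fin n} (hpq : (q : ℕ) = p + 1) (hτ : c.τ p ≠ q) (u : ℕ) :
    ∃ u' : ℕ, u' ≠ q ∧ ∀ x, c.τ x ≠ x →
      c.cut u' x + c.cut u' (c.τ x) = c.cut u x + c.cut u (c.τ x) := by
  by_cases hu : u = q
  swap
  · exact ⟨u, hu, fun _ _ => rfl⟩
  by_cases h1 : q ≤ c.τ q
  · have hcl : ∀ x, q ≤ x → x ≤ c.τ q → q ≤ c.τ x ∧ c.τ x ≤ c.τ q := by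
      intro x hx1 hx2
      rcases hx1.eq_or_lt with rfl | hx1
      · exact ⟨h1, le_rfl⟩
      rcases hx2.eq_or_lt with rfl | hx2
      · rw [c.involutive]; exact ⟨le_rfl, h1⟩
      have := c.nested q x hx1 hx2
      exact ⟨this.1.le, this.2.le⟩
    refine ⟨(c.τ q : ℕ) + 1, ?_, ?_⟩
    · rw [Fin.le_def] at h1; omega
    · intro x hx
      have hs := c.sgn_partner hx
      have h2 := hcl x
      have h3 := hcl (c.τ x)
      rw [c.involutive] at h3
      simp only [Fin.le_def] at h1 h2 h3
      unfold cut
      split_ifs <;> first | omega | linarith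
  · by_cases h2 : c.τ p ≤ p
    · have hcl : ∀ x, c.τ p ≤ x → x ≤ p → c.τ p ≤ c.τ x ∧ c.τ x ≤ p := by
        intro x hx1 hx2
        rcases hx1.eq_or_lt with rfl | hx1
        · rw [c.involutive]; exact ⟨h2, le_rfl⟩
        rcases hx2.eq_or_lt with rfl | hx2
        · exact ⟨le_rfl, h2⟩
        have := c.nested (c.τ p) x hx1 (by rw [c.involutive]; exact hx2)
        rw [c.involutive] at this
        exact ⟨this.1.le, this.2.le⟩
      refine ⟨(c.τ p : ℕ), ?_, ?_⟩
      · rw [Fin.le_def] at h2; omega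
      · intro x hx
        have hs := c.sgn_partner hx
        have h3 := hcl x
        have h4 := hcl (c.τ x)
        rw [c.involutive] at h4
        simp only [Fin.le_def] at h2 h3 h4
        unfold cut
        split_ifs <;> first | omega | linarith
    · exfalso
      have h3 : ((c.τ p : Fin n) : ℕ) ≠ q := fun h => hτ (Fin.ext h)
      simp only [Fin.le_def] at h1 h2
      have := c.nested p q (by rw [Fin.lt_def]; omega) (by rw [Fin.lt_def]; omega)
      have h4 : ((c.τ q : Fin n) : ℕ) ≤ p := by omega
      rw [Fin.lt_def] at this
      omega

/-- The arcs as a set of unordered pairs. -/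
def arcs : Finset (Sym2 (Fin n)) := c.support.image fun x => s(x, c.τ x)

lemma mem_arcs {x y : Fin n} : s(x, y) ∈ c.arcs ↔ c.τ x = y ∧ x ≠ y := by
  simp only [arcs, Finset.mem_image, mem_support, Sym2.eq_iff]
  constructor
  · rintro ⟨a, ha, ⟨rfl, rfl⟩ | ⟨rfl, rfl⟩⟩
    · exact ⟨rfl, ha.symm⟩
    · exact ⟨c.involutive a, ha⟩
  · rintro ⟨rfl, h⟩
    exact ⟨x, h.symm, Or.inl ⟨rfl, rfl⟩⟩

/-- The factor of an arc whose endpoints carry the weights `h x` and `h y`. -/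
noncomputable def arcPoly (h : Fin n → ℝ) : Sym2 (Fin n) → MvPolynomial (Fin n ⊕ Fin n) ℝ :=
  Sym2.lift ⟨fun x y => arcFactor x y (h x + h y), fun x y => by
    dsimp only
    rw [arcFactor_comm, add_comm]⟩

@[simp] lemma arcPoly_mk (h : Fin n → ℝ) (x y : Fin n) :
    arcPoly h s(x, y) = arcFactor x y (h x + h y) := rfl

/-- The generating polynomial of a matching: every point of `T` belongs to both sets, and the arcs
are distributed as in `arcFactor`. -/
noncomputable def poly (h : Fin n → ℝ) : MvPolynomial (Fin n ⊕ Fin n) ℝ :=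
  (∏ x ∈ c.T, lv x * rv x) * ∏ e ∈ c.arcs, arcPoly h e

/-- The coefficient of a matching with the special arcs cut out by `u` and `v`. -/
noncomputable def value (α β : Finset (Fin n) → ℝ) (u v : ℕ) : ℝ :=
  - pairing α β (c.poly (c.height u v))

lemma poly_congr {h h' : Fin n → ℝ}
    (hh : ∀ x, c.τ x ≠ x → h x + h (c.τ x) = h' x + h' (c.τ x)) : c.poly h = c.poly h' := by
  unfold poly
  congr 1
  refine Finset.prod_congr rfl fun e he => ?_
  induction e with
  | h x y =>
    obtain ⟨rfl, hxy⟩ := c.mem_arcs.mp he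
    rw [arcPoly_mk, arcPoly_mk, hh x hxy.symm]

lemma exists_cuts_ne {p q : Fin n} (hpq : (q : ℕ) = p + 1) (hτ : c.τ p ≠ q) (u v : ℕ) :
    ∃ u' v' : ℕ, u' ≠ q ∧ v' ≠ q ∧ (∀ x, c.τ x ≠ x → c.arcHeight u' v' x = c.arcHeight u v x) ∧
      ∀ α β, c.value α β u v = c.value α β u' v' := by
  obtain ⟨u', hu, hu'⟩ := c.exists_cut_ne hpq hτ u
  obtain ⟨v', hv, hv'⟩ := c.exists_cut_ne hpq hτ v
  have key : ∀ x, c.τ x ≠ x → c.arcHeight u' v' x = c.arcHeight u v x := by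
    intro x hx
    have h1 := hu' x hx
    have h2 := hv' x hx
    unfold arcHeight height
    linarith
  refine ⟨u', v', hu, hv, key, fun α β => ?_⟩
  unfold value
  rw [c.poly_congr fun x hx => (key x hx).symm]

/-- The matching obtained by deleting two adjacent matched points `p` and `q`, where their partners
get matched with each other if `p` and `q` are on different arcs. The point `p` becomes
distinguished. -/
def remove {p q : Fin n} (hpq : (q : ℕ) = p + 1) (hp : c.τ p ≠ p) (hq : c.τ q ≠ q) :
    NCMatching n where
  τ x := if x = p ∨ x = q then x else if c.τ x = p then c.τ q else if c.τ x = q then c.τ p else c.τ x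
  T := insert p c.T
  involutive x := by
    have h1 := c.involutive x
    have h2 := c.involutive p
    have h3 := c.involutive q
    split_ifs <;> grind
  nested x y hxy hy := by
    have hi := c.involutive
    have h1 : ∀ x y : Fin n, (x : ℕ) < y → (y : ℕ) < c.τ x →
        (x : ℕ) < c.τ y ∧ (c.τ y : ℕ) < c.τ x :=
      c.nested
    have hpq' : p ≠ q := by rintro rfl; omega
    by_cases hyp : y = p ∨ y = q
    · rw [if_pos hyp]; exact ⟨hxy, hy⟩
    by_cases hxp : x = p ∨ x = q
    · rw [if_pos hxp] at hy; exact absurd hxy (not_lt.mpr hy.le)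
    rw [if_neg hyp]
    rw [if_neg hxp] at hy ⊢
    have hneq : ∀ a b : Fin n, (a : ℕ) = b ↔ a = b := fun a b => Fin.ext_iff.symm
    have e1 := h1 x y
    have e2 := h1 x p
    have e3 := h1 x q
    have e4 := h1 q y
    have e5 := h1 p y
    have e6 := h1 p (c.τ y)
    have e7 := h1 q (c.τ y)
    have e8 := h1 (c.τ p) y
    have e9 := h1 (c.τ q) y
    have e10 := h1 (c.τ p) (c.τ y)
    have e11 := h1 (c.τ q) (c.τ y)
    simp only [hi] at e6 e7 e8 e9 e10 e11
    have i1 := hi x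
    have i2 := hi y
    have i3 := hi p
    have i4 := hi q
    rw [Fin.lt_def] at hxy hy
    rw [Fin.lt_def, Fin.lt_def]
    clear hi h1
    split_ifs at hy ⊢ <;> grind
  fixed x hx := by
    have h1 := c.fixed x
    have h2 := c.involutive x
    simp only [Finset.mem_insert] at hx
    split_ifs <;> grind

lemma swap_lt_swap {p q : Fin n} (hpq : (q : ℕ) = p + 1) {a b : Fin n} (h1 : ¬ (a = p ∧ b = q))
    (h2 : ¬ (a = q ∧ b = p)) : Equiv.swap p q a < Equiv.swap p q b ↔ a < b := by
  simp only [Equiv.swap_apply_def, Fin.lt_def]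
  simp only [Fin.ext_iff] at *
  split_ifs <;> omega

/-- The matching obtained by exchanging the roles of two adjacent points `p` and `q`, at least one
of which is not matched. -/
def swapPoints {p q : Fin n} (hpq : (q : ℕ) = p + 1) (h : c.τ p = p ∨ c.τ q = q) :
    NCMatching n where
  τ x := Equiv.swap p q (c.τ (Equiv.swap p q x))
  T := c.T.map (Equiv.swap p q).toEmbedding
  involutive x := by simp [c.involutive]
  nested x y hxy hy := by
    have hS : ∀ a b, c.τ a ≠ a → c.τ b ≠ b →
        (Equiv.swap p q a < Equiv.swap p q b ↔ a < b) := by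
      intro a b ha hb
      apply swap_lt_swap hpq <;> rintro ⟨rfl, rfl⟩ <;> tauto
    obtain ⟨X, rfl⟩ := (Equiv.swap p q).surjective x
    obtain ⟨Y, rfl⟩ := (Equiv.swap p q).surjective y
    simp only [Equiv.swap_apply_self] at hy ⊢
    by_cases hY : c.τ Y = Y
    · rw [hY]; exact ⟨hxy, hy⟩
    by_cases hX : c.τ X = X
    · rw [hX] at hy; exact absurd hxy (not_lt.mpr hy.le)
    have hX' : c.τ (c.τ X) ≠ c.τ X := by rw [c.involutive]; exact Ne.symm hX
    have hY' : c.τ (c.τ Y) ≠ c.τ Y := by rw [c.involutive]; exact Ne.symm hY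
    rw [hS _ _ hX hY] at hxy
    rw [hS _ _ hY hX'] at hy
    rw [hS _ _ hX hY', hS _ _ hY' hX']
    exact c.nested X Y hxy hy
  fixed x hx := by
    simp only [Finset.mem_map_equiv, Equiv.symm_swap] at hx
    rw [c.fixed _ hx]
    simp

/-- The matching obtained by matching two adjacent unmatched points `p` and `q`. -/
def create {p q : Fin n} (hpq : (q : ℕ) = p + 1) (hp : c.τ p = p) (hq : c.τ q = q)
    (hpT : p ∉ c.T) : NCMatching n where
  τ x := if x = p then q else if x = q then p else c.τ x
  T := c.T.erase q
  involutive x := by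
    have h1 := c.involutive x
    grind
  nested x y hxy hy := by
    have e := c.nested x y
    have e1 := c.nested x p
    have e2 := c.nested x q
    have hi := c.involutive x
    have i1 : (c.τ x : ℕ) = q → c.τ x = q := Fin.ext
    have i2 : (c.τ x : ℕ) = p → c.τ x = p := Fin.ext
    simp only [Fin.lt_def] at *
    grind
  fixed x hx := by
    have := c.fixed x
    grind

end NCMatching

/-! ### The effect of a column operation on the coefficients -/

namespace NCMatching

variable {n : ℕ} (c : NCMatching n) {p q : Fin n}

lemma ne_of_adjacent (hpq : (q : ℕ) = p + 1) : p ≠ q := by rintro rfl; omega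

lemma lt_iff_lt_of_adjacent (hpq : (q : ℕ) = p + 1) {x : Fin n} (hxq : x ≠ q) :
    p < x ↔ q < x := by
  simp only [Fin.lt_def, ne_eq, Fin.ext_iff] at *
  omega

lemma neg_one_pow_card_insert_insert (hpq : (q : ℕ) = p + 1) {S : Finset (Fin n)} (hp : p ∉ S)
    (hq : q ∉ S) {x : Fin n} (hxq : x ≠ q) :
    (-1 : ℝ) ^ ((insert p (insert q S)).filter (· < x)).card =
      (-1) ^ (S.filter (· < x)).card := by
  rw [Finset.filter_insert, Finset.filter_insert]
  have h := lt_iff_lt_of_adjacent hpq hxq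
  by_cases hq' : q < x
  · rw [if_pos hq', if_pos (h.mpr hq'), Finset.card_insert_of_notMem, Finset.card_insert_of_notMem,
      pow_succ, pow_succ]
    · ring
    · simp [hq]
    · simp [hp, ne_of_adjacent hpq]
  · rw [if_neg hq', if_neg (fun h' => hq' (h.mp h'))]

lemma sgn_adjacent (hpq : (q : ℕ) = p + 1) (hp : c.τ p ≠ p) : c.sgn q = - c.sgn p := by
  unfold sgn
  have : c.support.filter (· < q) = insert p (c.support.filter (· < p)) := by
    ext x
    simp only [Finset.mem_filter, Finset.mem_insert, mem_support, Fin.lt_def]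
    constructor
    · rintro ⟨h1, h2⟩
      have : (x : ℕ) = p ∨ (x : ℕ) < p := by omega
      exact this.imp Fin.ext fun h => ⟨h1, h⟩
    · rintro (h | h)
      · subst h
        exact ⟨fun h' => hp h', by omega⟩
      · exact ⟨h.1, by omega⟩
  rw [this, Finset.card_insert_of_notMem (by simp), pow_succ]
  ring

lemma cut_congr {c' : NCMatching n} {x : Fin n} (h : c'.sgn x = c.sgn x) (u : ℕ) :
    c'.cut u x = c.cut u x := by unfold cut; rw [h]

lemma height_congr {c' : NCMatching n} {x : Fin n} (h : c'.sgn x = c.sgn x) (u v : ℕ) :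
    c'.height u v x = c.height u v x := by
  unfold height; rw [c.cut_congr h, c.cut_congr h]

lemma height_add_height_adjacent (hpq : (q : ℕ) = p + 1) (hs : c.sgn q = - c.sgn p) {u v : ℕ}
    (hu : u ≠ q) (hv : v ≠ q) : c.height u v p + c.height u v q = 0 := by
  have h : ∀ w : ℕ, w ≠ q → c.cut w q = - c.cut w p := by
    intro w hw
    unfold cut
    split_ifs <;> first | omega | exact hs | simp
  unfold height
  rw [h u hu, h v hv]
  ring

lemma prod_arcPoly_congr {E : Finset (Sym2 (Fin n))} {h h' : Fin n → ℝ}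
    (hh : ∀ e ∈ E, ∀ x ∈ e, h x = h' x) : ∏ e ∈ E, arcPoly h e = ∏ e ∈ E, arcPoly h' e := by
  refine Finset.prod_congr rfl fun e he => ?_
  have := hh e he
  induction e with
  | h x y => simp only [arcPoly_mk, this x (by simp), this y (by simp)]

lemma prod_arcPoly_mem {E : Finset (Sym2 (Fin n))} (h : Fin n → ℝ) (hE : ∀ e ∈ E, q ∉ e) :
    ∏ e ∈ E, arcPoly h e ∈ withoutPoint q := by
  refine prod_mem fun e he => ?_
  have := hE e he
  induction e with
  | h x y =>
    simp only [Sym2.mem_iff, not_or] at this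
    exact arcFactor_mem (Ne.symm this.1) (Ne.symm this.2) _

lemma prod_points_mem {T : Finset (Fin n)} (hT : q ∉ T) :
    ∏ x ∈ T, lv x * rv x ∈ withoutPoint q :=
  prod_mem fun _ hx => mul_mem (lv_mem_withoutPoint fun h => hT (h ▸ hx))
    (rv_mem_withoutPoint fun h => hT (h ▸ hx))

/-- The arcs that do not end in `p` or `q`. -/
def arcsAway (p q : Fin n) : Finset (Sym2 (Fin n)) :=
  c.arcs.filter fun e => p ∉ e ∧ q ∉ e

lemma mem_arcsAway {x y : Fin n} : s(x, y) ∈ c.arcsAway p q ↔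
    (c.τ x = y ∧ x ≠ y) ∧ (p ≠ x ∧ p ≠ y) ∧ q ≠ x ∧ q ≠ y := by
  simp [arcsAway, mem_arcs, not_or]

lemma prod_arcsAway_mem (h : Fin n → ℝ) : ∏ e ∈ c.arcsAway p q, arcPoly h e ∈ withoutPoint q :=
  prod_arcPoly_mem h fun e he => by
    simp only [arcsAway, Finset.mem_filter] at he
    exact he.2.2

lemma prod_arcsAway_congr {h h' : Fin n → ℝ}
    (hh : ∀ x, c.τ x ≠ x → x ≠ p → x ≠ q → h x = h' x) :
    ∏ e ∈ c.arcsAway p q, arcPoly h e = ∏ e ∈ c.arcsAway p q, arcPoly h' e := by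
  refine prod_arcPoly_congr fun e he => ?_
  induction e with
  | h x y =>
    obtain ⟨⟨rfl, h1⟩, h2, h3⟩ := c.mem_arcsAway.mp he
    intro z hz
    rcases Sym2.mem_iff.mp hz with rfl | rfl
    · exact hh _ (Ne.symm h1) h2.1.symm h3.1.symm
    · exact hh _ (by rw [c.involutive]; exact h1) h2.2.symm h3.2.symm

/-! #### Removing two adjacent points -/

lemma notMem_T {x : Fin n} (hx : c.τ x ≠ x) : x ∉ c.T := fun h => hx (c.fixed x h)

section Remove

variable (hpq : (q : ℕ) = p + 1) (hp : c.τ p ≠ p) (hq : c.τ q ≠ q)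

lemma support_remove : c.support = insert p (insert q (c.remove hpq hp hq).support) := by
  ext x
  have h1 := c.involutive x
  have h2 := c.involutive p
  have h3 := c.involutive q
  have h4 := ne_of_adjacent hpq
  simp only [mem_support, Finset.mem_insert, remove]
  split_ifs <;> grind

lemma sgn_remove {x : Fin n} (hxq : x ≠ q) :
    (c.remove hpq hp hq).sgn x = c.sgn x := by
  unfold sgn
  rw [c.support_remove hpq hp hq, neg_one_pow_card_insert_insert hpq _ _ hxq] <;>
    simp [mem_support, remove]

lemma prod_T_remove : ∏ x ∈ (c.remove hpq hp hq).T, lv x * rv x =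
    lv p * rv p * ∏ x ∈ c.T, lv x * rv x :=
  Finset.prod_insert (c.notMem_T hp)

/-- Contracting the arc between two neighbours. -/
lemma value_contract {t : ℝ} {α α' β β' : Finset (Fin n) → ℝ} (hα : IsColOp p q t α α')
    (hβ : IsColOp p q t β β') (hτ : c.τ p = q) (u v : ℕ) :
    c.value α' β' u v = c.value α β u v + 2 * t * (c.remove hpq hp hq).value α β u v := by
  have hne := ne_of_adjacent hpq
  have hτ' : c.τ q = p := by rw [← hτ, c.involutive]
  have h1 : c.arcs = insert s(q, p) (c.arcsAway p q) := by
    ext e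
    induction e with
    | h x y =>
      have := c.involutive x
      simp only [Finset.mem_insert, mem_arcs, mem_arcsAway, Sym2.eq_iff]
      grind
  have h2 : s(q, p) ∉ c.arcsAway p q := by simp [mem_arcsAway]
  have h3 : (c.remove hpq hp hq).arcs = c.arcsAway p q := by
    ext e
    induction e with
    | h x y =>
      have := c.involutive x
      simp only [mem_arcs, mem_arcsAway, remove]
      grind
  set U := (∏ x ∈ c.T, lv x * rv x) * ∏ e ∈ c.arcsAway p q, arcPoly (c.height u v) e
  have hU : U ∈ withoutPoint q :=
    mul_mem (prod_points_mem (c.notMem_T hq)) (c.prod_arcsAway_mem _)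
  have e1 : c.poly (c.height u v) = arcFactor q p (c.height u v q + c.height u v p) * U := by
    rw [poly, h1, Finset.prod_insert h2, arcPoly_mk]; ring
  have e2 : (c.remove hpq hp hq).poly ((c.remove hpq hp hq).height u v) = lv p * rv p * U := by
    rw [poly, h3, prod_T_remove, c.prod_arcsAway_congr (h' := c.height u v)]
    · ring
    · intro x _ _ hx
      exact c.height_congr (c.sgn_remove hpq hp hq hx) u v
  rw [value, value, value, e1, e2, pairing_colOp_arcFactor hne hα hβ hne _ hU,
    pairing_arcFactor_self]
  ring

/-- Merging two different arcs ending in neighbours `p` and `q`. -/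
lemma value_merge {t : ℝ} {α α' β β' : Finset (Fin n) → ℝ} (hα : IsColOp p q t α α')
    (hβ : IsColOp p q t β β') (hτ : c.τ p ≠ q) {u v : ℕ} (hu : u ≠ q) (hv : v ≠ q) :
    c.value α' β' u v = c.value α β u v + t * (c.remove hpq hp hq).value α β u v := by
  have hne := ne_of_adjacent hpq
  have hip := c.involutive p
  have hiq := c.involutive q
  have hτ' : c.τ q ≠ p := by rintro h; rw [h] at hiq; exact hτ hiq
  have h1 : c.arcs = insert s(q, c.τ q) (insert s(p, c.τ p) (c.arcsAway p q)) := by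
    ext e
    induction e with
    | h x y =>
      have := c.involutive x
      simp only [Finset.mem_insert, mem_arcs, mem_arcsAway, Sym2.eq_iff]
      grind
  have h2 : s(p, c.τ p) ∉ c.arcsAway p q := by simp [mem_arcsAway]
  have h2' : s(q, c.τ q) ∉ insert s(p, c.τ p) (c.arcsAway p q) := by
    simp only [Finset.mem_insert, mem_arcsAway, Sym2.eq_iff]
    grind
  have h3 : (c.remove hpq hp hq).arcs =
      insert s(c.τ p, c.τ q) (c.arcsAway p q) := by
    ext e
    induction e with
    | h x y =>
      have := c.involutive x
      simp only [Finset.mem_insert, mem_arcs, mem_arcsAway, Sym2.eq_iff, remove]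
      grind
  have h4 : s(c.τ p, c.τ q) ∉ c.arcsAway p q := by
    rw [mem_arcsAway, hip]
    rintro ⟨⟨h, -⟩, -⟩
    exact hτ' h.symm
  set U := (∏ x ∈ c.T, lv x * rv x) * ∏ e ∈ c.arcsAway p q, arcPoly (c.height u v) e
  have hU : U ∈ withoutPoint q :=
    mul_mem (prod_points_mem (c.notMem_T hq)) (c.prod_arcsAway_mem _)
  have e1 : c.poly (c.height u v) = arcFactor q (c.τ q) (c.height u v q + c.height u v (c.τ q)) *
      (arcFactor p (c.τ p) (c.height u v p + c.height u v (c.τ p)) * U) := by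
    rw [poly, h1, Finset.prod_insert h2', Finset.prod_insert h2, arcPoly_mk, arcPoly_mk]; ring
  have e2 : (c.remove hpq hp hq).poly ((c.remove hpq hp hq).height u v) = lv p * rv p *
      (arcFactor (c.τ q) (c.τ p) (c.height u v (c.τ q) + c.height u v (c.τ p)) * U) := by
    rw [poly, h3, prod_T_remove, Finset.prod_insert h4, arcPoly_mk,
      c.prod_arcsAway_congr (h' := c.height u v),
      c.height_congr (c.sgn_remove hpq hp hq hτ), c.height_congr (c.sgn_remove hpq hp hq hq),
      arcFactor_comm (c.τ q), add_comm (c.height u v (c.τ q))]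
    · ring
    · intro x _ _ hx
      exact c.height_congr (c.sgn_remove hpq hp hq hx) u v
  have h5 := c.height_add_height_adjacent hpq (c.sgn_adjacent hpq hp) hu hv
  have h6 : c.height u v q + c.height u v (c.τ q) + (c.height u v p + c.height u v (c.τ p)) =
      c.height u v (c.τ q) + c.height u v (c.τ p) := by linarith
  rw [value, value, value, e1, e2, pairing_colOp_arcFactor hne hα hβ hq _
    (mul_mem (arcFactor_mem hne hτ _) hU), pairing_arcFactor_mul, h6]
  ring

end Remove

/-! #### Exchanging and matching two adjacent points -/

lemma sgn_swapPoints (hpq : (q : ℕ) = p + 1) (h : c.τ p = p ∨ c.τ q = q) {x : Fin n}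
    (hx : c.τ x ≠ x) : (c.swapPoints hpq h).sgn (Equiv.swap p q x) = c.sgn x := by
  have : (c.swapPoints hpq h).support.filter (· < Equiv.swap p q x) =
      (c.support.filter (· < x)).map (Equiv.swap p q).toEmbedding := by
    ext y
    obtain ⟨y, rfl⟩ := (Equiv.swap p q).surjective y
    simp only [Finset.mem_filter, Finset.mem_map_equiv, Equiv.symm_swap, Equiv.swap_apply_self,
      mem_support, swapPoints, ne_eq, EmbeddingLike.apply_eq_iff_eq]
    refine and_congr_right fun hy => swap_lt_swap hpq ?_ ?_ <;> rintro ⟨rfl, rfl⟩ <;> tauto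
  rw [sgn, this, Finset.card_map, sgn]

lemma height_swapPoints (hpq : (q : ℕ) = p + 1) (h : c.τ p = p ∨ c.τ q = q) {x : Fin n}
    (hx : c.τ x ≠ x) {u v : ℕ} (hu : u ≠ q) (hv : v ≠ q) :
    (c.swapPoints hpq h).height u v (Equiv.swap p q x) = c.height u v x := by
  have hlt : ∀ w : ℕ, w ≠ q → (((Equiv.swap p q x : Fin n) : ℕ) < w ↔ (x : ℕ) < w) := by
    intro w hw
    simp only [Equiv.swap_apply_def]
    split_ifs with h1 h2 <;> (try subst h1) <;> (try subst h2) <;> omega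
  simp only [height, cut, c.sgn_swapPoints hpq h hx, hlt u hu, hlt v hv]

lemma height_swapPoints_of_ne (hpq : (q : ℕ) = p + 1) (h : c.τ p = p ∨ c.τ q = q) {x : Fin n}
    (hx : c.τ x ≠ x) {u v : ℕ} (hu : u ≠ q) (hv : v ≠ q) (hxp : x ≠ p) (hxq : x ≠ q) :
    (c.swapPoints hpq h).height u v x = c.height u v x := by
  have := c.height_swapPoints hpq h hx hu hv
  rwa [Equiv.swap_apply_of_ne_of_ne hxp hxq] at this

/-- Moving an endpoint of an arc to a free neighbour. -/
lemma value_swap_free {t : ℝ} {α α' β β' : Finset (Fin n) → ℝ} (hα : IsColOp p q t α α')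
    (hβ : IsColOp p q t β β') (hpq : (q : ℕ) = p + 1) (hp : c.τ p = p) (hpT : p ∉ c.T)
    (hq : c.τ q ≠ q) {u v : ℕ} (hu : u ≠ q) (hv : v ≠ q) :
    c.value α' β' u v =
      c.value α β u v + t * (c.swapPoints hpq (Or.inl hp)).value α β u v := by
  have hne := ne_of_adjacent hpq
  have hiq := c.involutive q
  have hqT := c.notMem_T hq
  have hτ : c.τ q ≠ p := by rintro h; rw [h] at hiq; exact hne (hp ▸ hiq)
  have h1 : c.arcs = insert s(q, c.τ q) (c.arcsAway p q) := by
    ext e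
    induction e with
    | h x y =>
      have := c.involutive x
      simp only [Finset.mem_insert, mem_arcs, mem_arcsAway, Sym2.eq_iff]
      grind
  have h2 : s(q, c.τ q) ∉ c.arcsAway p q := by simp [mem_arcsAway]
  have h3 : (c.swapPoints hpq (Or.inl hp)).arcs = insert s(p, c.τ q) (c.arcsAway p q) := by
    ext e
    induction e with
    | h x y =>
      have := c.involutive x
      simp only [Finset.mem_insert, mem_arcs, mem_arcsAway, Sym2.eq_iff, swapPoints,
        Equiv.swap_apply_def]
      grind
  have h4 : s(p, c.τ q) ∉ c.arcsAway p q := by simp [mem_arcsAway]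
  have h5 : (c.swapPoints hpq (Or.inl hp)).T = c.T := by
    ext x
    simp only [swapPoints, Finset.mem_map_equiv, Equiv.symm_swap, Equiv.swap_apply_def]
    grind
  set U := (∏ x ∈ c.T, lv x * rv x) * ∏ e ∈ c.arcsAway p q, arcPoly (c.height u v) e
  have hU : U ∈ withoutPoint q :=
    mul_mem (prod_points_mem hqT) (c.prod_arcsAway_mem _)
  have e1 : c.poly (c.height u v) =
      arcFactor q (c.τ q) (c.height u v q + c.height u v (c.τ q)) * U := by
    rw [poly, h1, Finset.prod_insert h2, arcPoly_mk]; ring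
  have hhp := c.height_swapPoints hpq (Or.inl hp) hq hu hv
  rw [Equiv.swap_apply_right] at hhp
  have e2 : (c.swapPoints hpq (Or.inl hp)).poly ((c.swapPoints hpq (Or.inl hp)).height u v) =
      arcFactor p (c.τ q) (c.height u v q + c.height u v (c.τ q)) * U := by
    rw [poly, h3, h5, Finset.prod_insert h4, arcPoly_mk, hhp,
      c.height_swapPoints_of_ne hpq _ (by rw [hiq]; exact hq.symm) hu hv hτ hq,
      c.prod_arcsAway_congr (h' := c.height u v)]
    · ring
    · intro x hx hxp hxq
      exact c.height_swapPoints_of_ne hpq _ hx hu hv hxp hxq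
  rw [value, value, value, e1, e2, pairing_colOp_arcFactor hne hα hβ hq _ hU]
  ring

/-- Exchanging an endpoint of an arc with a distinguished neighbour. -/
lemma value_swap_distinguished {t : ℝ} {α α' β β' : Finset (Fin n) → ℝ}
    (hα : IsColOp p q t α α') (hβ : IsColOp p q t β β') (hpq : (q : ℕ) = p + 1)
    (hp : c.τ p ≠ p) (hqT : q ∈ c.T) {u v : ℕ} (hu : u ≠ q) (hv : v ≠ q) :
    c.value α' β' u v = c.value α β u v +
      t * (c.swapPoints hpq (Or.inr (c.fixed q hqT))).value α β u v := by
  have hne := ne_of_adjacent hpq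
  have hip := c.involutive p
  have hq := c.fixed q hqT
  have hpT := c.notMem_T hp
  have hτ : c.τ p ≠ q := by rintro h; rw [h, hq] at hip; exact hne hip.symm
  have h1 : c.arcs = insert s(p, c.τ p) (c.arcsAway p q) := by
    ext e
    induction e with
    | h x y =>
      have := c.involutive x
      simp only [Finset.mem_insert, mem_arcs, mem_arcsAway, Sym2.eq_iff]
      grind
  have h2 : s(p, c.τ p) ∉ c.arcsAway p q := by simp [mem_arcsAway]
  have h3 : (c.swapPoints hpq (Or.inr hq)).arcs = insert s(q, c.τ p) (c.arcsAway p q) := by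
    ext e
    induction e with
    | h x y =>
      have := c.involutive x
      simp only [Finset.mem_insert, mem_arcs, mem_arcsAway, Sym2.eq_iff, swapPoints,
        Equiv.swap_apply_def]
      grind
  have h4 : s(q, c.τ p) ∉ c.arcsAway p q := by simp [mem_arcsAway]
  have h5 : (c.swapPoints hpq (Or.inr hq)).T = insert p (c.T.erase q) := by
    ext x
    simp only [swapPoints, Finset.mem_map_equiv, Equiv.symm_swap, Equiv.swap_apply_def,
      Finset.mem_insert, Finset.mem_erase]
    grind
  set U := (∏ x ∈ c.T.erase q, lv x * rv x) * ∏ e ∈ c.arcsAway p q, arcPoly (c.height u v) e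
  have hU : U ∈ withoutPoint q :=
    mul_mem (prod_points_mem (by simp)) (c.prod_arcsAway_mem _)
  have e1 : c.poly (c.height u v) = lv q * rv q *
      (arcFactor p (c.τ p) (c.height u v p + c.height u v (c.τ p)) * U) := by
    rw [poly, h1, Finset.prod_insert h2, arcPoly_mk, ← Finset.mul_prod_erase _ _ hqT]; ring
  have hhp := c.height_swapPoints hpq (Or.inr hq) hp hu hv
  rw [Equiv.swap_apply_left] at hhp
  have e2 : (c.swapPoints hpq (Or.inr hq)).poly ((c.swapPoints hpq (Or.inr hq)).height u v) =
      lv p * rv p * (arcFactor q (c.τ p) (c.height u v p + c.height u v (c.τ p)) * U) := by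
    rw [poly, h3, h5, Finset.prod_insert h4, Finset.prod_insert (by simp [hpT]), arcPoly_mk, hhp,
      c.height_swapPoints_of_ne hpq _ (by rw [hip]; exact hp.symm) hu hv hp hτ,
      c.prod_arcsAway_congr (h' := c.height u v)]
    · ring
    · intro x hx hxp hxq
      exact c.height_swapPoints_of_ne hpq _ hx hu hv hxp hxq
  rw [value, value, value, e1, e2, pairing_colOp_lv_mul_rv hne hα hβ
    (mul_mem (arcFactor_mem hne hτ _) hU), pairing_arcFactor_mul, pairing_lv_rv_arcFactor, zero_add]
  ring

lemma sgn_create (hpq : (q : ℕ) = p + 1) (hp : c.τ p = p) (hq : c.τ q = q) (hpT : p ∉ c.T)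
    {x : Fin n} (hxq : x ≠ q) : (c.create hpq hp hq hpT).sgn x = c.sgn x := by
  have : (c.create hpq hp hq hpT).support = insert p (insert q c.support) := by
    ext x
    have h1 := c.involutive x
    have h4 := ne_of_adjacent hpq
    simp only [mem_support, Finset.mem_insert, create]
    grind
  unfold sgn
  rw [this, neg_one_pow_card_insert_insert hpq _ _ hxq] <;> simp [mem_support, hp, hq]

/-- A distinguished point next to a free point is split into an arc, or moved. -/
lemma value_split {t : ℝ} {α α' β β' : Finset (Fin n) → ℝ} (hα : IsColOp p q t α α')
    (hβ : IsColOp p q t β β') (hpq : (q : ℕ) = p + 1) (hp : c.τ p = p) (hpT : p ∉ c.T)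
    (hqT : q ∈ c.T) {u v : ℕ} (hu : u ≠ q) (hv : v ≠ q) :
    c.value α' β' u v = c.value α β u v +
      t * (c.create hpq hp (c.fixed q hqT) hpT).value α β u v +
      t ^ 2 * (c.swapPoints hpq (Or.inl hp)).value α β u v := by
  have hne := ne_of_adjacent hpq
  have hq := c.fixed q hqT
  have h1 : c.arcs = c.arcsAway p q := by
    ext e
    induction e with
    | h x y =>
      have := c.involutive x
      simp only [mem_arcs, mem_arcsAway]
      grind
  have h3 : (c.swapPoints hpq (Or.inl hp)).arcs = c.arcsAway p q := by
    ext e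
    induction e with
    | h x y =>
      have := c.involutive x
      simp only [mem_arcs, mem_arcsAway, swapPoints, Equiv.swap_apply_def]
      grind
  have h4 : (c.create hpq hp hq hpT).arcs = insert s(p, q) (c.arcsAway p q) := by
    ext e
    induction e with
    | h x y =>
      have := c.involutive x
      simp only [Finset.mem_insert, mem_arcs, mem_arcsAway, Sym2.eq_iff, create]
      grind
  have h4' : s(p, q) ∉ c.arcsAway p q := by simp [mem_arcsAway]
  have h5 : (c.swapPoints hpq (Or.inl hp)).T = insert p (c.T.erase q) := by
    ext x
    simp only [swapPoints, Finset.mem_map_equiv, Equiv.symm_swap, Equiv.swap_apply_def,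
      Finset.mem_insert, Finset.mem_erase]
    grind
  set U := (∏ x ∈ c.T.erase q, lv x * rv x) * ∏ e ∈ c.arcsAway p q, arcPoly (c.height u v) e
  have hU : U ∈ withoutPoint q :=
    mul_mem (prod_points_mem (by simp)) (c.prod_arcsAway_mem _)
  have e1 : c.poly (c.height u v) = lv q * rv q * U := by
    rw [poly, h1, ← Finset.mul_prod_erase _ _ hqT]; ring
  have e2 : (c.swapPoints hpq (Or.inl hp)).poly ((c.swapPoints hpq (Or.inl hp)).height u v) =
      lv p * rv p * U := by
    rw [poly, h3, h5, Finset.prod_insert (by simp [hpT]),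
      c.prod_arcsAway_congr (h' := c.height u v)]
    · ring
    · intro x hx hxp hxq
      exact c.height_swapPoints_of_ne hpq _ hx hu hv hxp hxq
  have hs : (c.create hpq hp hq hpT).sgn q = - (c.create hpq hp hq hpT).sgn p := by
    have h6 : (c.create hpq hp hq hpT).τ p = q := by simp [create]
    have h7 := (c.create hpq hp hq hpT).sgn_partner (x := p) (by rw [h6]; exact hne.symm)
    rwa [h6] at h7
  have e3 : (c.create hpq hp hq hpT).poly ((c.create hpq hp hq hpT).height u v) =
      arcFactor p q 0 * U := by
    rw [poly, h4, Finset.prod_insert h4', arcPoly_mk, height_add_height_adjacent _ hpq hs hu hv,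
      c.prod_arcsAway_congr (h' := c.height u v)]
    · have : (c.create hpq hp hq hpT).T = c.T.erase q := rfl
      rw [this]
      ring
    · intro x hx hxp hxq
      exact c.height_congr (c.sgn_create hpq hp hq hpT hxq) u v
  rw [value, value, value, value, e1, e2, e3, pairing_colOp_lv_mul_rv hne hα hβ hU]
  ring

/-- A column operation between `p` and `q` is not seen by a matching in which `q` is free. -/
lemma value_of_free {t : ℝ} {α α' β β' : Finset (Fin n) → ℝ} (hα : IsColOp p q t α α')
    (hβ : IsColOp p q t β β') (hq : c.τ q = q) (hqT : q ∉ c.T) (u v : ℕ) :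
    c.value α' β' u v = c.value α β u v := by
  rw [value, value, pairing_colOp hα hβ]
  refine mul_mem (prod_points_mem hqT) (prod_arcPoly_mem _ fun e he => ?_)
  induction e with
  | h x y =>
    obtain ⟨h1, h2⟩ := c.mem_arcs.mp he
    have := c.involutive x
    rw [Sym2.mem_iff]
    grind

/-- A column operation between `p` and `q` is not seen by a matching in which `p` is
distinguished. -/
lemma value_of_distinguished {t : ℝ} {α α' β β' : Finset (Fin n) → ℝ} (hα : IsColOp p q t α α')
    (hβ : IsColOp p q t β β') (hpq : (q : ℕ) = p + 1) (hpT : p ∈ c.T) (u v : ℕ) :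
    c.value α' β' u v = c.value α β u v := by
  have hne := ne_of_adjacent hpq
  have hp := c.fixed p hpT
  by_cases hqT : q ∈ c.T
  · have hq := c.fixed q hqT
    set U := (∏ x ∈ (c.T.erase q).erase p, lv x * rv x) * ∏ e ∈ c.arcs, arcPoly (c.height u v) e
    have hU : U ∈ withoutPoint q := by
      refine mul_mem (prod_points_mem (by simp)) (prod_arcPoly_mem _ fun e he => ?_)
      induction e with
      | h x y =>
        obtain ⟨h1, h2⟩ := c.mem_arcs.mp he
        have := c.involutive x
        rw [Sym2.mem_iff]
        grind
    have e1 : c.poly (c.height u v) = lv q * rv q * (lv p * rv p * U) := by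
      rw [poly, ← Finset.mul_prod_erase _ _ hqT,
        ← Finset.mul_prod_erase _ _ (Finset.mem_erase.mpr ⟨hne, hpT⟩)]
      ring
    have e2 : arcFactor p q 0 * (lv p * rv p * U) = lv p * rv p * (arcFactor p q 0 * U) := by ring
    have e3 : lv p * rv p * (lv p * rv p * U) = lv p * (lv p * (rv p * rv p * U)) := by ring
    rw [value, value, e1, pairing_colOp_lv_mul_rv hne hα hβ
      (mul_mem (mul_mem (lv_mem_withoutPoint hne) (rv_mem_withoutPoint hne)) hU), e2,
      pairing_lv_rv_arcFactor, e3, pairing_lv_sq]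
    ring
  by_cases hq : c.τ q = q
  · exact c.value_of_free hα hβ hq hqT u v
  have hiq := c.involutive q
  have h1 : c.arcs = insert s(q, c.τ q) (c.arcsAway p q) := by
    ext e
    induction e with
    | h x y =>
      have := c.involutive x
      simp only [Finset.mem_insert, mem_arcs, mem_arcsAway, Sym2.eq_iff]
      grind
  have h2 : s(q, c.τ q) ∉ c.arcsAway p q := by simp [mem_arcsAway]
  set U := (∏ x ∈ c.T.erase p, lv x * rv x) * ∏ e ∈ c.arcsAway p q, arcPoly (c.height u v) e
  have hU : U ∈ withoutPoint q :=
    mul_mem (prod_points_mem (by simp [hqT])) (c.prod_arcsAway_mem _)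
  have e1 : c.poly (c.height u v) = arcFactor q (c.τ q)
      (c.height u v q + c.height u v (c.τ q)) * (lv p * rv p * U) := by
    rw [poly, h1, Finset.prod_insert h2, arcPoly_mk, ← Finset.mul_prod_erase _ _ hpT]
    ring
  have e2 : ∀ z, arcFactor p (c.τ q) z * (lv p * rv p * U) =
      lv p * rv p * (arcFactor p (c.τ q) z * U) := fun z => by ring
  rw [value, value, e1, pairing_colOp_arcFactor hne hα hβ hq _
    (mul_mem (mul_mem (lv_mem_withoutPoint hne) (rv_mem_withoutPoint hne)) hU), e2,
    pairing_lv_rv_arcFactor]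
  ring

end NCMatching

/-! ### Expansion of the coefficients over labellings -/

section Expansion

open MvPolynomial

variable {n : ℕ}

/-- The exponent vector of `∏ x ∈ I, ℓ_x * ∏ y ∈ J, ρ_y`. -/
noncomputable def exponent (I J : Finset (Fin n)) : Fin n ⊕ Fin n →₀ ℕ :=
  ∑ x ∈ I, Finsupp.single (Sum.inl x) 1 + ∑ y ∈ J, Finsupp.single (Sum.inr y) 1

lemma exponent_inl (I J : Finset (Fin n)) (x : Fin n) :
    exponent I J (Sum.inl x) = if x ∈ I then 1 else 0 := by
  classical
  simp [exponent, Finsupp.single_apply]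

lemma exponent_inr (I J : Finset (Fin n)) (x : Fin n) :
    exponent I J (Sum.inr x) = if x ∈ J then 1 else 0 := by
  classical
  simp [exponent, Finsupp.single_apply]

lemma prod_lv_mul_prod_rv (I J : Finset (Fin n)) :
    (∏ x ∈ I, lv x) * ∏ y ∈ J, rv y = monomial (exponent I J) (1 : ℝ) := by
  have h : monomial (exponent I J) (1 : ℝ) =
      monomial (∑ x ∈ I, Finsupp.single (Sum.inl x) 1) 1 *
        monomial (∑ y ∈ J, Finsupp.single (Sum.inr y) 1) 1 := by
    rw [monomial_mul, one_mul]; rfl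
  rw [h, monomial_sum_one, monomial_sum_one]
  rfl

lemma pairing_prod (α β : Finset (Fin n) → ℝ) (I J : Finset (Fin n)) :
    pairing α β ((∏ x ∈ I, lv x) * ∏ y ∈ J, rv y) = α I * β J := by
  rw [prod_lv_mul_prod_rv, pairing_monomial, monomialValue, if_pos]
  · congr 2
    · ext x; simp [mem_leftSet, exponent_inl]
    · ext x; simp [mem_rightSet, exponent_inr]
  · rintro (x | x)
    · rw [exponent_inl]; split_ifs <;> simp
    · rw [exponent_inr]; split_ifs <;> simp

/-- If `α` vanishes away from the sets of size `|T|`, then no further variable `ℓ_y` can be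
multiplied to `∏ x ∈ T, ℓ_x`. -/
lemma pairing_prod_lv_mul_lv {α β : Finset (Fin n) → ℝ} {T : Finset (Fin n)}
    (hα : ∀ I : Finset (Fin n), I.card ≠ T.card → α I = 0) (y : Fin n)
    (U : MvPolynomial (Fin n ⊕ Fin n) ℝ) :
    pairing α β ((∏ x ∈ T, lv x) * (lv y * U)) = 0 := by
  induction U using MvPolynomial.induction_on' with
  | monomial m c =>
    have h1 : monomial m c = c • monomial m (1 : ℝ) := by
      rw [smul_monomial, smul_eq_mul, mul_one]
    have h2 : (∏ x ∈ T, lv x) = monomial (exponent T ∅) (1 : ℝ) := by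
      rw [← prod_lv_mul_prod_rv]; simp
    rw [h1, mul_smul_comm, mul_smul_comm, map_smul, lv_mul_monomial, h2, monomial_mul, one_mul,
      pairing_monomial, monomialValue, smul_eq_mul]
    by_cases hm : IsMultilinear (exponent T ∅ + (Finsupp.single (Sum.inl y) 1 + m))
    · rw [if_pos hm, hα, zero_mul, mul_zero]
      have hy : y ∉ T := by
        intro hy
        have := hm (Sum.inl y)
        rw [Finsupp.add_apply, Finsupp.add_apply, exponent_inl, if_pos hy,
          Finsupp.single_eq_same] at this
        omega
      have hsub : insert y T ⊆ leftSet (exponent T ∅ + (Finsupp.single (Sum.inl y) 1 + m)) := by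
        intro x hx
        rw [mem_leftSet, Finsupp.add_apply, Finsupp.add_apply, exponent_inl]
        rcases Finset.mem_insert.mp hx with rfl | hx
        · rw [Finsupp.single_eq_same]; omega
        · rw [if_pos hx]; omega
      have := Finset.card_le_card hsub
      rw [Finset.card_insert_of_notMem hy] at this
      omega
    · rw [if_neg hm, mul_zero]
  | add a b ha hb => rw [mul_add, mul_add, map_add, ha, hb, add_zero]

namespace NCMatching

variable (c : NCMatching n)

/-- The variable of a point with a given label: `ℓ` for `L`, and `ρ` for `R` and `J`. -/
noncomputable def labelVar (a : Label) (x : Fin n) : MvPolynomial (Fin n ⊕ Fin n) ℝ :=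
  if a = Label.L then lv x else rv x

/-- The weight of an arc `{x, y}` with labels `a` and `b`, if `w x y` is the weight of marking it by
`J` in `x`. -/
def labelWeight (w : Fin n → Fin n → ℝ) (a b : Label) (x y : Fin n) : ℝ :=
  match a, b with
  | Label.L, Label.R => 1
  | Label.R, Label.L => 1
  | Label.J, Label.R => w x y
  | Label.R, Label.J => w y x
  | _, _ => 0

lemma arcFactor_eq_sum (w : Fin n → Fin n → ℝ) (x y : Fin n) :
    arcFactor x y (w x y + w y x) =
      ∑ a : Label × Label, C (labelWeight w a.1 a.2 x y) * (labelVar a.1 x * labelVar a.2 y) := by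
  have hu : (Finset.univ : Finset Label) = {Label.L, Label.R, Label.J} := rfl
  rw [Fintype.sum_prod_type, hu]
  simp [labelWeight, labelVar, arcFactor]
  ring

variable {S : Finset (Fin n)} (hS : ∀ x, x ∈ S ↔ c.τ x ≠ x)

/-- The other endpoint of an arc, for points of a set `S` that is the set of matched points. -/
def mate (x : S) : S := ⟨c.τ x, by
  have := (hS x).mp x.2
  rw [hS, c.involutive]; exact this.symm⟩

lemma mate_mate (x : S) : c.mate hS (c.mate hS x) = x := Subtype.ext (c.involutive x)

lemma mate_lt {x : S} (h : ¬ (x : Fin n) < c.τ x) :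
    (c.mate hS x : Fin n) < c.τ (c.mate hS x) := by
  change c.τ x < c.τ (c.τ x)
  rw [c.involutive]
  exact lt_of_le_of_ne (not_lt.mp h) ((hS x).mp x.2)

lemma not_mate_lt {x : S} (h : (x : Fin n) < c.τ x) :
    ¬ (c.mate hS x : Fin n) < c.τ (c.mate hS x) := by
  change ¬ c.τ x < c.τ (c.τ x)
  rw [c.involutive]
  exact not_lt.mpr h.le

/-- The first endpoints of the arcs. -/
abbrev Opener (c : NCMatching n) (S : Finset (Fin n)) : Type := {x : S // (x : Fin n) < c.τ x}

/-- A labelling of the matched points amounts to a pair of labels for every arc. -/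
def labellingEquiv : (S → Label) ≃ (Opener c S → Label × Label) where
  toFun μ i := (μ i.1, μ (c.mate hS i.1))
  invFun g x := if h : (x : Fin n) < c.τ x then (g ⟨x, h⟩).1 else
    (g ⟨c.mate hS x, c.mate_lt hS h⟩).2
  left_inv μ := by
    funext x
    by_cases h : (x : Fin n) < c.τ x
    · dsimp only
      rw [dif_pos h]
    · dsimp only
      rw [dif_neg h, mate_mate]
  right_inv g := by
    funext i
    refine Prod.ext ?_ ?_
    · dsimp only
      rw [dif_pos i.2]
    · dsimp only
      rw [dif_neg (c.not_mate_lt hS i.2)]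
      congr 2
      exact Subtype.ext (c.mate_mate hS i.1)

lemma prod_opener {M : Type*} [CommMonoid M] (F : S → M) :
    ∏ i : Opener c S, (F i.1 * F (c.mate hS i.1)) = ∏ x : S, F x := by
  rw [Finset.prod_mul_distrib, ← Finset.prod_filter_mul_prod_filter_not Finset.univ
    (fun x : S => (x : Fin n) < c.τ x) F]
  congr 1
  · rw [Finset.prod_subtype (p := fun x : S => (x : Fin n) < c.τ x)]
    simp
  · refine Finset.prod_bij (fun i _ => c.mate hS i.1) ?_ ?_ ?_ ?_
    · intro i _
      simp only [Finset.mem_filter, Finset.mem_univ, true_and]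
      exact c.not_mate_lt hS i.2
    · intro i _ j _ h
      have := congrArg (c.mate hS) h
      rw [mate_mate, mate_mate] at this
      exact Subtype.ext this
    · intro x hx
      simp only [Finset.mem_filter, Finset.mem_univ, true_and] at hx
      exact ⟨⟨c.mate hS x, c.mate_lt hS hx⟩, Finset.mem_univ _, c.mate_mate hS x⟩
    · intros; rfl

/-- The points with a given label. -/
def labelSet (μ : S → Label) (a : Label) : Finset (Fin n) :=
  (Finset.univ.filter fun l => μ l = a).map (Function.Embedding.subtype _)

lemma mem_labelSet {μ : S → Label} {a : Label} {x : Fin n} :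
    x ∈ labelSet μ a ↔ ∃ h : x ∈ S, μ ⟨x, h⟩ = a := by
  simp [labelSet]

lemma prod_labelVar (μ : S → Label) : ∏ x : S, labelVar (μ x) x =
    (∏ x ∈ labelSet μ Label.L, lv x) *
      ∏ x ∈ labelSet μ Label.R ∪ labelSet μ Label.J, rv x := by
  have h : labelSet μ Label.R ∪ labelSet μ Label.J =
      (Finset.univ.filter fun l => ¬ μ l = Label.L).map (Function.Embedding.subtype _) := by
    ext x
    simp only [Finset.mem_union, mem_labelSet, Finset.mem_map, Finset.mem_filter, Finset.mem_univ,
      true_and, Function.Embedding.subtype_apply, Subtype.exists, exists_and_right, exists_eq_right]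
    constructor
    · rintro (⟨h, h'⟩ | ⟨h, h'⟩) <;> exact ⟨h, by rw [h']; decide⟩
    · rintro ⟨h, h'⟩
      rcases h'' : μ ⟨x, h⟩
      · exact absurd h'' h'
      · exact Or.inl ⟨h, h''⟩
      · exact Or.inr ⟨h, h''⟩
  rw [h, labelSet, Finset.prod_map, Finset.prod_map]
  unfold labelVar
  rw [Finset.prod_ite]
  rfl

lemma prod_arcs_eq {S : Finset (Fin n)} (hS : ∀ x, x ∈ S ↔ c.τ x ≠ x)
    (f : Sym2 (Fin n) → MvPolynomial (Fin n ⊕ Fin n) ℝ) :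
    ∏ e ∈ c.arcs, f e = ∏ i : Opener c S, f s((i.1 : Fin n), c.τ i.1) := by
  symm
  refine Finset.prod_bij (fun i _ => s((i.1 : Fin n), c.τ i.1)) ?_ ?_ ?_ ?_
  · intro i _
    exact c.mem_arcs.mpr ⟨rfl, i.2.ne⟩
  · rintro ⟨i, hi⟩ _ ⟨j, hj⟩ _ h
    rcases Sym2.eq_iff.mp h with ⟨h1, -⟩ | ⟨h1, h2⟩
    · exact Subtype.ext (Subtype.ext h1)
    · dsimp only at h1 h2
      rw [h1, c.involutive] at hi
      exact absurd hi (not_lt.mpr hj.le)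
  · intro e he
    induction e with
    | h x y =>
      obtain ⟨rfl, h⟩ := c.mem_arcs.mp he
      rcases lt_or_gt_of_ne h with h' | h'
      · exact ⟨⟨⟨x, (hS x).mpr h.symm⟩, h'⟩, Finset.mem_univ _, rfl⟩
      · refine ⟨⟨⟨c.τ x, (hS _).mpr (by rw [c.involutive]; exact h)⟩,
          by dsimp only; rw [c.involutive]; exact h'⟩, Finset.mem_univ _, ?_⟩
        dsimp only
        rw [c.involutive, Sym2.eq_swap]
  · intros; rfl

/-- The pairing with the generating polynomial as a sum over all labellings of the matched
points. -/
lemma pairing_poly (α β : Finset (Fin n) → ℝ) {h : Fin n → ℝ} (w : Fin n → Fin n → ℝ)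
    (hw : ∀ x, c.τ x ≠ x → h x + h (c.τ x) = w x (c.τ x) + w (c.τ x) x) :
    pairing α β (c.poly h) = ∑ μ : S → Label,
      (∏ i : Opener c S, labelWeight w (μ i.1) (μ (c.mate hS i.1)) i.1 (c.τ i.1)) *
        (α (c.T ∪ labelSet μ Label.L) *
          β (c.T ∪ labelSet μ Label.R ∪ labelSet μ Label.J)) := by
  have h1 : c.poly h = ∑ μ : S → Label,
      (∏ i : Opener c S, labelWeight w (μ i.1) (μ (c.mate hS i.1)) i.1 (c.τ i.1)) •
        ((∏ x ∈ c.T ∪ labelSet μ Label.L, lv x) *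
          ∏ x ∈ c.T ∪ labelSet μ Label.R ∪ labelSet μ Label.J, rv x) := by
    rw [poly, c.prod_arcs_eq hS]
    have h2 : ∀ i : Opener c S, arcPoly h s((i.1 : Fin n), c.τ i.1) =
        ∑ a : Label × Label, C (labelWeight w a.1 a.2 i.1 (c.τ i.1)) *
          (labelVar a.1 i.1 * labelVar a.2 (c.τ i.1)) := by
      intro i
      rw [arcPoly_mk, hw _ i.2.ne', arcFactor_eq_sum]
    rw [Finset.prod_congr rfl fun i _ => h2 i, Finset.prod_univ_sum, Fintype.piFinset_univ,
      Finset.mul_sum]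
    symm
    refine Fintype.sum_equiv (c.labellingEquiv hS) _ _ fun μ => ?_
    have h3 : ∏ i : Opener c S, C (labelWeight w ((c.labellingEquiv hS μ) i).1
        ((c.labellingEquiv hS μ) i).2 i.1 (c.τ i.1)) *
        (labelVar ((c.labellingEquiv hS μ) i).1 (i.1 : Fin n) *
          labelVar ((c.labellingEquiv hS μ) i).2 (c.τ i.1)) =
        C (∏ i : Opener c S, labelWeight w (μ i.1) (μ (c.mate hS i.1)) i.1 (c.τ i.1)) *
          ∏ x : S, labelVar (μ x) (x : Fin n) := by
      rw [Finset.prod_mul_distrib, ← c.prod_opener hS (fun x => labelVar (μ x) (x : Fin n)),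
        map_prod]
      rfl
    rw [h3, prod_labelVar, Finset.union_assoc, Finset.prod_union, Finset.prod_union,
      Finset.prod_mul_distrib, smul_eq_C_mul]
    · ring
    · rw [Finset.disjoint_left]
      intro x hx hx'
      rw [Finset.mem_union, mem_labelSet, mem_labelSet] at hx'
      have : x ∈ S := by rcases hx' with ⟨h, -⟩ | ⟨h, -⟩ <;> exact h
      exact (hS x).mp this (c.fixed x hx)
    · rw [Finset.disjoint_left]
      intro x hx hx'
      rw [mem_labelSet] at hx'
      exact (hS x).mp hx'.1 (c.fixed x hx)
  rw [h1, map_sum]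
  refine Finset.sum_congr rfl fun μ _ => ?_
  rw [map_smul, pairing_prod, smul_eq_mul]

end NCMatching

end Expansion

/-! ### Positivity of the coefficients -/

namespace NCMatching

variable {n : ℕ} (c : NCMatching n)

lemma pairing_arcFactor_of_card {α β : Finset (Fin n) → ℝ} {T : Finset (Fin n)}
    (hα : ∀ I : Finset (Fin n), I.card ≠ T.card → α I = 0) (x y : Fin n) (z : ℝ)
    (U : MvPolynomial (Fin n ⊕ Fin n) ℝ) :
    pairing α β ((∏ x ∈ T, lv x) * (arcFactor x y z * U)) =
      z * pairing α β ((∏ x ∈ T, lv x) * (rv x * rv y * U)) := by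
  have : (∏ x ∈ T, lv x) * (arcFactor x y z * U) =
      (∏ x ∈ T, lv x) * (lv x * (rv y * U)) + (∏ x ∈ T, lv x) * (lv y * (rv x * U)) +
        MvPolynomial.C z * ((∏ x ∈ T, lv x) * (rv x * rv y * U)) := by
    unfold arcFactor; ring
  rw [this, map_add, map_add, pairing_prod_lv_mul_lv hα, pairing_prod_lv_mul_lv hα,
    pairing_C_mul, zero_add, zero_add]

/-- The matching consists of the `a` distinguished points `0, …, a - 1` and two arcs on the next
four points. -/
structure IsInitial (a : ℕ) : Prop where
  mem_T : ∀ x : Fin n, x ∈ c.T ↔ (x : ℕ) < a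
  matched : ∀ x : Fin n, c.τ x ≠ x ↔ a ≤ (x : ℕ) ∧ (x : ℕ) < a + 4

set_option maxHeartbeats 800000 in
/-- In an initial matching, the two arcs contribute `arcHeight` factors of opposite signs. -/
lemma IsInitial.exists_value {c : NCMatching n} {a : ℕ} (h : c.IsInitial a) (hn : a + 4 ≤ n)
    {α β : Finset (Fin n) → ℝ} (hα : ∀ I : Finset (Fin n), I.card ≠ a → α I = 0) (u v : ℕ) :
    ∃ x y : Fin n, (∀ z, c.τ z ≠ z → z = x ∨ z = c.τ x ∨ z = y ∨ z = c.τ y) ∧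
      c.value α β u v = -(c.arcHeight u v x * c.arcHeight u v y) *
        (α (Finset.univ.filter fun z => (z : ℕ) < a) *
          β (Finset.univ.filter fun z => (z : ℕ) < a + 4)) ∧
      c.arcHeight u v x * c.arcHeight u v y ≤ 0 := by
  have hT : c.T = Finset.univ.filter fun z : Fin n => (z : ℕ) < a := by
    ext x; simp [h.mem_T]
  have hcard : c.T.card = a := by
    rw [hT, Fin.card_filter_val_lt]
    omega
  have hsgn : ∀ (i : ℕ) (hi : i < 4), c.sgn ⟨a + i, by omega⟩ = (-1) ^ i := by
    intro i hi
    have : (c.support.filter (· < (⟨a + i, by omega⟩ : Fin n))) =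
        (Finset.univ.filter fun z : Fin n => (z : ℕ) < a + i) \
          (Finset.univ.filter fun z : Fin n => (z : ℕ) < a) := by
      ext x
      simp only [Finset.mem_filter, mem_support, h.matched, Fin.lt_def, Finset.mem_sdiff,
        Finset.mem_univ, true_and]
      omega
    rw [sgn, this, Finset.card_sdiff_of_subset, Fin.card_filter_val_lt, Fin.card_filter_val_lt]
    · congr 1; omega
    · intro x hx
      simp only [Finset.mem_filter, Finset.mem_univ, true_and] at hx ⊢
      omega
  set x0 : Fin n := ⟨a, by omega⟩ with hx0
  set x1 : Fin n := ⟨a + 1, by omega⟩ with hx1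
  set x2 : Fin n := ⟨a + 2, by omega⟩ with hx2
  set x3 : Fin n := ⟨a + 3, by omega⟩ with hx3
  have s0 : c.sgn x0 = 1 := by simpa using hsgn 0 (by norm_num)
  have s1 : c.sgn x1 = -1 := by simpa using hsgn 1 (by norm_num)
  have s2 : c.sgn x2 = 1 := by simpa using hsgn 2 (by norm_num)
  have s3 : c.sgn x3 = -1 := by
    have := hsgn 3 (by norm_num)
    rw [this]; norm_num
  have hm : ∀ z, c.τ z ≠ z ↔ z = x0 ∨ z = x1 ∨ z = x2 ∨ z = x3 := by
    intro z
    rw [h.matched]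
    simp only [hx0, hx1, hx2, hx3, Fin.ext_iff]
    omega
  have hi := c.involutive
  have v0 : (x0 : ℕ) = a := rfl
  have v1 : (x1 : ℕ) = a + 1 := rfl
  have v2 : (x2 : ℕ) = a + 2 := rfl
  have v3 : (x3 : ℕ) = a + 3 := rfl
  have d01 : x0 ≠ x1 := by simp [hx0, hx1]
  have d02 : x0 ≠ x2 := by simp [hx0, hx2]
  have d03 : x0 ≠ x3 := by simp [hx0, hx3]
  have d12 : x1 ≠ x2 := by simp [hx1, hx2]
  have d13 : x1 ≠ x3 := by simp [hx1, hx3]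
  have d23 : x2 ≠ x3 := by simp [hx2, hx3]
  have hns : c.τ x0 ≠ x2 := by
    intro h02
    have := c.nested x0 x1 (by rw [Fin.lt_def]; omega) (by rw [h02, Fin.lt_def]; omega)
    rw [h02, Fin.lt_def, Fin.lt_def] at this
    exact (hm x1).mpr (by simp) (Fin.ext (by omega))
  have hS : Finset.univ.filter (fun z : Fin n => (z : ℕ) < a + 4) =
      c.T ∪ {x0, x1, x2, x3} := by
    ext z
    simp only [hT, Finset.mem_filter, Finset.mem_univ, true_and, Finset.mem_union,
      Finset.mem_insert, Finset.mem_singleton, Fin.ext_iff, v0, v1, v2, v3]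
    omega
  have hdisj : Disjoint c.T {x0, x1, x2, x3} := by
    rw [Finset.disjoint_left]
    intro z hz hz'
    exact (hm z).mpr (by simpa using hz') (c.fixed z hz)
  have hprod : (∏ x ∈ c.T, lv x) * ((∏ x ∈ c.T, rv x) * (rv x0 * rv x1 * rv x2 * rv x3)) =
      (∏ x ∈ c.T, lv x) *
        ∏ x ∈ Finset.univ.filter (fun z : Fin n => (z : ℕ) < a + 4), rv x := by
    rw [hS, Finset.prod_union hdisj, Finset.prod_insert (by simp [d01, d02, d03]),
      Finset.prod_insert (by simp [d12, d13]), Finset.prod_insert (by simp [d23]),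
      Finset.prod_singleton]
    ring
  have hval : ∀ x x' y y' : Fin n, c.arcs = {s(x, x'), s(y, y')} → s(x, x') ≠ s(y, y') →
      rv x * rv x' * rv y * rv y' = rv x0 * rv x1 * rv x2 * rv x3 → c.τ x = x' → c.τ y = y' →
      c.value α β u v = -(c.arcHeight u v x * c.arcHeight u v y) *
        (α (Finset.univ.filter fun z => (z : ℕ) < a) *
          β (Finset.univ.filter fun z => (z : ℕ) < a + 4)) := by
    intro x x' y y' harcs hne hrv hx hy
    have hα' : ∀ I : Finset (Fin n), I.card ≠ c.T.card → α I = 0 := by rwa [hcard]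
    have e1 : c.poly (c.height u v) = (∏ x ∈ c.T, lv x) * (arcFactor x x' (c.arcHeight u v x) *
        (arcFactor y y' (c.arcHeight u v y) * ∏ x ∈ c.T, rv x)) := by
      rw [poly, harcs, Finset.prod_insert (by simpa using hne), Finset.prod_singleton, arcPoly_mk,
        arcPoly_mk, Finset.prod_mul_distrib, arcHeight, arcHeight, hx, hy]
      ring
    have e2 : (∏ x ∈ c.T, lv x) * (rv x * rv x' * (arcFactor y y' (c.arcHeight u v y) *
        ∏ x ∈ c.T, rv x)) = (∏ x ∈ c.T, lv x) * (arcFactor y y' (c.arcHeight u v y) *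
        (rv x * rv x' * ∏ x ∈ c.T, rv x)) := by ring
    have e3 : (∏ x ∈ c.T, lv x) * (rv y * rv y' * (rv x * rv x' * ∏ x ∈ c.T, rv x)) =
        (∏ x ∈ c.T, lv x) * ((∏ x ∈ c.T, rv x) * (rv x * rv x' * rv y * rv y')) := by ring
    rw [value, e1, pairing_arcFactor_of_card hα', e2, pairing_arcFactor_of_card hα', e3, hrv,
      hprod, pairing_prod, hT]
    ring
  have hcases : (c.τ x0 = x1 ∧ c.τ x1 = x0 ∧ c.τ x2 = x3 ∧ c.τ x3 = x2) ∨
      (c.τ x0 = x3 ∧ c.τ x3 = x0 ∧ c.τ x1 = x2 ∧ c.τ x2 = x1) := by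
    have := hi x0
    have := hi x1
    have := hi x2
    have := hi x3
    have := hm x0
    have := hm x1
    have := hm x2
    have := hm x3
    have := hm (c.τ x0)
    have := hm (c.τ x1)
    have := hm (c.τ x2)
    grind
  rcases hcases with ⟨t0, t1, t2, t3⟩ | ⟨t0, t3, t1, t2⟩
  · refine ⟨x0, x2, ?_, hval x0 x1 x2 x3 ?_ ?_ ?_ t0 t2, ?_⟩
    · intro z hz
      rw [t0, t2]
      have := (hm z).mp hz
      tauto
    · ext e
      induction e with
      | h x y =>
        rw [mem_arcs, Finset.mem_insert, Finset.mem_singleton, Sym2.eq_iff, Sym2.eq_iff]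
        have := hm x
        grind
    · rw [ne_eq, Sym2.eq_iff]; tauto
    · ring
    · have k0 : ∀ w : ℕ, c.cut w x0 + c.cut w x1 = if w = a + 1 then 1 else 0 := by
        intro w
        rw [cut, cut, s0, s1, v0, v1]
        split_ifs <;> first | omega | norm_num
      have k2 : ∀ w : ℕ, c.cut w x2 + c.cut w x3 = if w = a + 3 then 1 else 0 := by
        intro w
        rw [cut, cut, s2, s3, v2, v3]
        split_ifs <;> first | omega | norm_num
      have e : c.arcHeight u v x0 * c.arcHeight u v x2 =
          ((c.cut v x0 + c.cut v x1) - (c.cut u x0 + c.cut u x1)) *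
            ((c.cut v x2 + c.cut v x3) - (c.cut u x2 + c.cut u x3)) := by
        rw [arcHeight, arcHeight, t0, t2]
        unfold height
        ring
      rw [e, k0, k0, k2, k2]
      split_ifs <;> first | omega | norm_num
  · refine ⟨x0, x1, ?_, hval x0 x3 x1 x2 ?_ ?_ ?_ t0 t1, ?_⟩
    · intro z hz
      rw [t0, t1]
      have := (hm z).mp hz
      tauto
    · ext e
      induction e with
      | h x y =>
        rw [mem_arcs, Finset.mem_insert, Finset.mem_singleton, Sym2.eq_iff, Sym2.eq_iff]
        have := hm x
        grind
    · rw [ne_eq, Sym2.eq_iff]; tauto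
    · ring
    · have k0 : ∀ w : ℕ, c.cut w x0 + c.cut w x3 = if a < w ∧ w ≤ a + 3 then 1 else 0 := by
        intro w
        rw [cut, cut, s0, s3, v0, v3]
        split_ifs <;> first | omega | norm_num
      have k1 : ∀ w : ℕ, c.cut w x1 + c.cut w x2 = if w = a + 2 then -1 else 0 := by
        intro w
        rw [cut, cut, s1, s2, v1, v2]
        split_ifs <;> first | omega | norm_num
      have e : c.arcHeight u v x0 * c.arcHeight u v x1 =
          ((c.cut v x0 + c.cut v x3) - (c.cut u x0 + c.cut u x3)) *
            ((c.cut v x1 + c.cut v x2) - (c.cut u x1 + c.cut u x2)) := by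
        rw [arcHeight, arcHeight, t0, t1]
        unfold height
        ring
      rw [e, k0, k0, k1, k1]
      split_ifs <;> first | omega | norm_num

/-- If the only nonzero minors are those of the leading columns, then only the initial matchings
have nonzero coefficients. -/
lemma isInitial_of_value_ne_zero {a : ℕ} {α β : Finset (Fin n) → ℝ}
    (hα : ∀ I : Finset (Fin n), α I ≠ 0 → ∀ x : Fin n, x ∈ I ↔ (x : ℕ) < a)
    (hβ : ∀ I : Finset (Fin n), β I ≠ 0 → ∀ x : Fin n, x ∈ I ↔ (x : ℕ) < a + 4) {u v : ℕ}
    (hval : c.value α β u v ≠ 0) : c.IsInitial a := by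
  have hS := fun x => c.mem_support (x := x)
  rw [value, neg_ne_zero, c.pairing_poly hS α β (fun x _ => c.height u v x) fun _ _ => rfl] at hval
  obtain ⟨μ, -, hμ⟩ := Finset.exists_ne_zero_of_sum_ne_zero hval
  have hα' := hα _ (left_ne_zero_of_mul (right_ne_zero_of_mul hμ))
  have hβ' := hβ _ (right_ne_zero_of_mul (right_ne_zero_of_mul hμ))
  simp only [Finset.mem_union, mem_labelSet] at hα' hβ'
  have key : ∀ (x : Fin n) (hx : x ∈ c.support), μ ⟨x, hx⟩ ≠ Label.L := by
    intro x hx hL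
    have h1 : (x : ℕ) < a := (hα' x).mp (Or.inr ⟨hx, hL⟩)
    rcases (hβ' x).mpr (by omega) with (h | ⟨h, h'⟩) | ⟨h, h'⟩
    · exact (hS x).mp hx (c.fixed x h)
    · rw [hL] at h'; exact absurd h' (by decide)
    · rw [hL] at h'; exact absurd h' (by decide)
  have hT : ∀ x : Fin n, x ∈ c.T ↔ (x : ℕ) < a := by
    intro x
    rw [← hα' x]
    exact ⟨Or.inl, fun h => h.resolve_right fun ⟨hx, hL⟩ => key x hx hL⟩
  refine ⟨hT, fun x => ?_⟩
  rw [← hβ' x, ← hS x]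
  constructor
  · intro hx
    refine ⟨?_, ?_⟩
    · by_contra h
      exact (hS x).mp hx (c.fixed x ((hT x).mpr (by omega)))
    · rcases h' : μ ⟨x, hx⟩
      · exact absurd h' (key x hx)
      · exact Or.inl (Or.inr ⟨hx, h'⟩)
      · exact Or.inr ⟨hx, h'⟩
  · rintro ⟨h1, (h | ⟨h, -⟩) | ⟨h, -⟩⟩
    · have := (hT x).mp h; omega
    · exact h
    · exact h

/-- The column operations preserve nonnegativity of all coefficients. -/
lemma value_nonneg_step {p q : Fin n} (hpq : (q : ℕ) = p + 1) {t : ℝ} (ht : 0 ≤ t)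
    {α α' β β' : Finset (Fin n) → ℝ} (hα : IsColOp p q t α α') (hβ : IsColOp p q t β β')
    (h : ∀ (c : NCMatching n) (u v : ℕ), 0 ≤ c.value α β u v) (u v : ℕ) :
    0 ≤ c.value α' β' u v := by
  by_cases hτ : c.τ p = q
  · have hp : c.τ p ≠ p := by rw [hτ]; exact (ne_of_adjacent hpq).symm
    have hq : c.τ q ≠ q := by rw [← hτ, c.involutive, hτ]; exact ne_of_adjacent hpq
    rw [c.value_contract hpq hp hq hα hβ hτ]
    exact add_nonneg (h _ _ _) (mul_nonneg (mul_nonneg zero_le_two ht) (h _ _ _))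
  obtain ⟨u', v', hu, hv, -, he⟩ := c.exists_cuts_ne hpq hτ u v
  rw [he]
  by_cases hpT : p ∈ c.T
  · rw [c.value_of_distinguished hα hβ hpq hpT]; exact h c u' v'
  by_cases hqT : q ∈ c.T
  · by_cases hp : c.τ p = p
    · rw [c.value_split hα hβ hpq hp hpT hqT hu hv]
      exact add_nonneg (add_nonneg (h _ _ _) (mul_nonneg ht (h _ _ _)))
        (mul_nonneg (sq_nonneg t) (h _ _ _))
    · rw [c.value_swap_distinguished hα hβ hpq hp hqT hu hv]
      exact add_nonneg (h _ _ _) (mul_nonneg ht (h _ _ _))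
  by_cases hq : c.τ q = q
  · rw [c.value_of_free hα hβ hq hqT]; exact h c u' v'
  by_cases hp : c.τ p = p
  · rw [c.value_swap_free hα hβ hpq hp hpT hq hu hv]
    exact add_nonneg (h _ _ _) (mul_nonneg ht (h _ _ _))
  · rw [c.value_merge hpq hp hq hα hβ hτ hu hv]
    exact add_nonneg (h _ _ _) (mul_nonneg ht (h _ _ _))

end NCMatching

/-- The maximal minors of the first `m` rows, as a function of the column set. -/
noncomputable def minors (m n : ℕ) (M : ℕ → ℕ → ℝ) (I : Finset (Fin n)) : ℝ :=
  maxMinor (corner m n M) I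

lemma isColOp_minors {n : ℕ} {p q : Fin n} (hpq : (q : ℕ) = p + 1) (t : ℝ) (m : ℕ)
    (M : ℕ → ℕ → ℝ) : IsColOp p q t (minors m n M) (minors m n (addCol p t M)) :=
  fun I => maxMinor_corner_addCol hpq t m M I

lemma minors_of_card_ne {m n : ℕ} (M : ℕ → ℕ → ℝ) {I : Finset (Fin n)} (hI : I.card ≠ m) :
    minors m n M I = 0 := by
  rw [minors, maxMinor, dif_neg hI]

lemma minors_initial {m n : ℕ} (hm : m ≤ n) (M : ℕ → ℕ → ℝ) :
    minors m n M (Finset.univ.filter fun z : Fin n => (z : ℕ) < m) = (block M 0 0 m).det := by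
  have hc : (Finset.univ.filter fun z : Fin n => (z : ℕ) < m).card = m := by
    rw [Fin.card_filter_val_lt]; omega
  have hf := Finset.orderEmbOfFin_unique hc (f := Fin.castLE hm) (by simp)
    (Fin.strictMono_castLE hm)
  rw [minors, maxMinor, dif_pos hc]
  congr 1
  ext i j
  rw [Matrix.submatrix_apply, ← hf]
  simp [corner, block]

lemma eq_initial_of_minors_ne_zero {R m n : ℕ} (hm : m ≤ R) {M : ℕ → ℕ → ℝ}
    (hM : ∀ i j, i < R → i < j → j < n → M i j = 0) {I : Finset (Fin n)}
    (hI : minors m n M I ≠ 0) (hmn : m ≤ n) (x : Fin n) : x ∈ I ↔ (x : ℕ) < m := by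
  have hc : I.card = m := by
    by_contra hc; exact hI (minors_of_card_ne M hc)
  have hsub : I ⊆ Finset.univ.filter fun z : Fin n => (z : ℕ) < m := by
    intro z hz
    by_contra hz'
    simp only [Finset.mem_filter, Finset.mem_univ, true_and, not_lt] at hz'
    obtain ⟨j, hj⟩ : ∃ j, I.orderEmbOfFin hc j = z := by
      have : z ∈ Set.range (I.orderEmbOfFin hc) := by
        rw [Finset.range_orderEmbOfFin]; exact hz
      exact this
    apply hI
    rw [minors, maxMinor, dif_pos hc]
    apply Matrix.det_eq_zero_of_column_eq_zero j
    intro i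
    simp only [Matrix.submatrix_apply, hj, corner, Matrix.of_apply, id]
    exact hM i z (by omega) (by omega) z.2
  have := Finset.eq_of_subset_of_card_le hsub (by rw [Fin.card_filter_val_lt, hc]; omega)
  rw [this]
  simp

lemma block_det_of_lowerTriangular {R m n : ℕ} (hm : m ≤ R) (hmn : m ≤ n) {M : ℕ → ℕ → ℝ}
    (hM : ∀ i j, i < R → i < j → j < n → M i j = 0) (hd : ∀ i, i < R → 0 < M i i) :
    0 < (block M 0 0 m).det := by
  rw [Matrix.det_of_isLowerTriangular]
  · refine Finset.prod_pos fun i _ => ?_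
    simpa [block] using hd i (by omega)
  · intro i j hij
    have : (i : ℕ) < j := hij
    simpa [block] using hM i j (by omega) this (by omega)

namespace NCMatching

variable {n : ℕ} (c : NCMatching n)

/-- All coefficients are nonnegative. -/
theorem value_nonneg {a : ℕ} (hn : a + 4 ≤ n) {M : ℕ → ℕ → ℝ} (hM : ConsecutivePos (a + 4) n M)
    (u v : ℕ) : 0 ≤ c.value (minors a n M) (minors (a + 4) n M) u v := by
  refine ConsecutivePos.induction hn (fun M => ∀ (c : NCMatching n) (u v : ℕ),
    0 ≤ c.value (minors a n M) (minors (a + 4) n M) u v) ?_ ?_ hM c u v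
  · intro M hz hd c u v
    by_contra hneg
    have hinit : c.IsInitial a := c.isInitial_of_value_ne_zero
      (fun I hI => eq_initial_of_minors_ne_zero (by omega) hz hI (by omega))
      (fun I hI => eq_initial_of_minors_ne_zero le_rfl hz hI hn)
      (fun h => hneg (h ▸ le_rfl))
    obtain ⟨x, y, -, h1, h2⟩ := hinit.exists_value hn (α := minors a n M)
      (β := minors (a + 4) n M) (fun I hI => minors_of_card_ne M hI) u v
    rw [h1, minors_initial (by omega), minors_initial hn] at hneg
    have h3 := block_det_of_lowerTriangular (m := a) (by omega) (by omega) hz hd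
    have h4 := block_det_of_lowerTriangular (m := a + 4) (by omega) hn hz hd
    exact hneg (mul_nonneg (by linarith) (mul_pos h3 h4).le)
  · intro M p t hp ht h c u v
    exact c.value_nonneg_step (p := ⟨p, by omega⟩) (q := ⟨p + 1, hp⟩) rfl ht
      (isColOp_minors (p := ⟨p, by omega⟩) (q := ⟨p + 1, hp⟩) rfl t a M)
      (isColOp_minors (p := ⟨p, by omega⟩) (q := ⟨p + 1, hp⟩) rfl t (a + 4) M) h u v

/-! #### The potential of a matching -/

/-- The number of particles at a point: two at the distinguished points, one at the matched
points. -/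
def occ (x : Fin n) : ℕ := if x ∈ c.T then 2 else if c.τ x = x then 0 else 1

/-- The sum of the positions of all particles. It decreases when a column operation moves a
particle. -/
def potential : ℕ := ∑ x : Fin n, (x : ℕ) * c.occ x

lemma sum_occ : ∑ x, c.occ x = 2 * c.T.card + c.support.card := by
  have h : ∀ x, c.occ x = (if x ∈ c.T then 2 else 0) + if x ∈ c.support then 1 else 0 := by
    intro x
    have := c.fixed x
    simp only [occ, mem_support]
    split_ifs <;> simp_all
  simp only [h, Finset.sum_add_distrib, Finset.sum_ite_mem, Finset.univ_inter, Finset.sum_const,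
    smul_eq_mul, mul_one]
  ring

/-- Moving some mass from `q` to its predecessor `p` decreases the weighted sum. -/
lemma sum_move {p q : Fin n} (hpq : (q : ℕ) = p + 1) {f g : Fin n → ℕ}
    (h : ∀ x, x ≠ p → x ≠ q → g x = f x) (hs : g p + g q = f p + f q) (hlt : f p < g p) :
    ∑ x : Fin n, (x : ℕ) * g x < ∑ x : Fin n, (x : ℕ) * f x ∧ ∑ x, g x = ∑ x, f x := by
  have hq : q ∈ Finset.univ.erase p := by
    simp only [Finset.mem_erase, Finset.mem_univ, and_true]
    exact (ne_of_adjacent hpq).symm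
  have split : ∀ F : Fin n → ℕ,
      ∑ x, F x = F p + (F q + ∑ x ∈ (Finset.univ.erase p).erase q, F x) := fun F => by
    rw [Finset.add_sum_erase _ _ hq, Finset.add_sum_erase _ _ (Finset.mem_univ p)]
  have hrest : ∀ x ∈ (Finset.univ.erase p).erase q, g x = f x := by
    intro x hx
    simp only [Finset.mem_erase, Finset.mem_univ, and_true] at hx
    exact h x hx.2 hx.1
  rw [split, split (fun x => (x : ℕ) * f x), split g, split f, Finset.sum_congr rfl hrest,
    Finset.sum_congr rfl fun x hx => by rw [hrest x hx], hpq]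
  constructor
  · nlinarith
  · rw [← add_assoc, ← add_assoc, hs]

lemma occ_swapPoints {p q : Fin n} (hpq : (q : ℕ) = p + 1) (h : c.τ p = p ∨ c.τ q = q) (x : Fin n) :
    (c.swapPoints hpq h).occ x = c.occ (Equiv.swap p q x) := by
  unfold occ
  have h1 : x ∈ (c.swapPoints hpq h).T ↔ Equiv.swap p q x ∈ c.T := by
    simp [swapPoints]
  have h2 : (c.swapPoints hpq h).τ x = x ↔ c.τ (Equiv.swap p q x) = Equiv.swap p q x := by
    change Equiv.swap p q _ = x ↔ _
    rw [← Equiv.eq_symm_apply, Equiv.symm_swap]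
  simp only [h1, h2]

lemma potential_swapPoints {p q : Fin n} (hpq : (q : ℕ) = p + 1) (h : c.τ p = p ∨ c.τ q = q)
    (hlt : c.occ p < c.occ q) : (c.swapPoints hpq h).potential < c.potential ∧
      ∑ x, (c.swapPoints hpq h).occ x = ∑ x, c.occ x := by
  refine sum_move hpq ?_ ?_ ?_
  · intro x hp hq
    rw [occ_swapPoints, Equiv.swap_apply_of_ne_of_ne hp hq]
  · rw [occ_swapPoints, occ_swapPoints, Equiv.swap_apply_left, Equiv.swap_apply_right, add_comm]
  · rwa [occ_swapPoints, Equiv.swap_apply_left]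

lemma potential_remove {p q : Fin n} (hpq : (q : ℕ) = p + 1) (hp : c.τ p ≠ p) (hq : c.τ q ≠ q) :
    (c.remove hpq hp hq).potential < c.potential ∧
      ∑ x, (c.remove hpq hp hq).occ x = ∑ x, c.occ x := by
  have hne := ne_of_adjacent hpq
  have hpT := c.notMem_T hp
  have hqT := c.notMem_T hq
  have h1 : c.occ p = 1 := by simp [occ, hp, hpT]
  have h2 : c.occ q = 1 := by simp [occ, hq, hqT]
  have h3 : (c.remove hpq hp hq).occ p = 2 := by simp [occ, remove]
  have h4 : (c.remove hpq hp hq).occ q = 0 := by simp [occ, remove, hqT, hne.symm]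
  refine sum_move hpq ?_ ?_ ?_
  · intro x hxp hxq
    have h5 : x ∈ (c.remove hpq hp hq).T ↔ x ∈ c.T := by simp [remove, hxp]
    have h6 : (c.remove hpq hp hq).τ x = x ↔ c.τ x = x := by
      have := c.support_remove hpq hp hq
      have h7 : x ∈ c.support ↔ x ∈ (c.remove hpq hp hq).support := by
        rw [this]; simp [hxp, hxq]
      rw [mem_support, mem_support] at h7
      exact (not_iff_not.mp h7).symm
    simp only [occ, h5, h6]
  · rw [h1, h2, h3, h4]
  · rw [h1, h3]; norm_num

/-- Two different arcs are separated by the cuts `u` and `v`. -/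
def HasTwoSpecial (u v : ℕ) : Prop :=
  ∃ x y, c.τ x ≠ x ∧ c.τ y ≠ y ∧ y ≠ x ∧ y ≠ c.τ x ∧
    c.arcHeight u v x ≠ 0 ∧ c.arcHeight u v y ≠ 0

lemma HasTwoSpecial.swapPoints {c : NCMatching n} {u v : ℕ} (hc : c.HasTwoSpecial u v) {p q : Fin n}
    (hpq : (q : ℕ) = p + 1) (h : c.τ p = p ∨ c.τ q = q) (hu : u ≠ q) (hv : v ≠ q) :
    (c.swapPoints hpq h).HasTwoSpecial u v := by
  obtain ⟨x, y, hx, hy, h1, h2, h3, h4⟩ := hc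
  have hτ : ∀ z, (c.swapPoints hpq h).τ (Equiv.swap p q z) = Equiv.swap p q (c.τ z) := by
    intro z; simp [NCMatching.swapPoints]
  have hh : ∀ z, c.τ z ≠ z →
      (c.swapPoints hpq h).arcHeight u v (Equiv.swap p q z) = c.arcHeight u v z := by
    intro z hz
    rw [arcHeight, hτ, c.height_swapPoints hpq h hz hu hv,
      c.height_swapPoints hpq h (by rw [c.involutive]; exact hz.symm) hu hv, arcHeight]
  refine ⟨Equiv.swap p q x, Equiv.swap p q y, ?_, ?_, ?_, ?_, ?_, ?_⟩
  · rw [hτ]; exact fun h' => hx ((Equiv.swap p q).injective h')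
  · rw [hτ]; exact fun h' => hy ((Equiv.swap p q).injective h')
  · exact fun h' => h1 ((Equiv.swap p q).injective h')
  · rw [hτ]; exact fun h' => h2 ((Equiv.swap p q).injective h')
  · rwa [hh x hx]
  · rwa [hh y hy]

lemma remove_tau {p q : Fin n} (hpq : (q : ℕ) = p + 1) (hp : c.τ p ≠ p) (hq : c.τ q ≠ q)
    {z : Fin n} (hzp : z ≠ p) (hzq : z ≠ q) (hzp' : c.τ z ≠ p) (hzq' : c.τ z ≠ q) :
    (c.remove hpq hp hq).τ z = c.τ z := by
  simp [remove, hzp, hzq, hzp', hzq']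

lemma arcHeight_remove {p q : Fin n} (hpq : (q : ℕ) = p + 1) (hp : c.τ p ≠ p) (hq : c.τ q ≠ q)
    (u v : ℕ) {z : Fin n} (hzp : z ≠ p) (hzq : z ≠ q) (hzp' : c.τ z ≠ p) (hzq' : c.τ z ≠ q) :
    (c.remove hpq hp hq).arcHeight u v z = c.arcHeight u v z := by
  rw [arcHeight, c.remove_tau hpq hp hq hzp hzq hzp' hzq',
    c.height_congr (c.sgn_remove hpq hp hq hzq), c.height_congr (c.sgn_remove hpq hp hq hzq'),
    arcHeight]

/-- The arc obtained by merging two arcs has the sum of their heights. -/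
lemma arcHeight_remove_merged {p q : Fin n} (hpq : (q : ℕ) = p + 1) (hp : c.τ p ≠ p)
    (hq : c.τ q ≠ q) (hτ : c.τ p ≠ q) {u v : ℕ} (hu : u ≠ q) (hv : v ≠ q) :
    (c.remove hpq hp hq).τ (c.τ p) = c.τ q ∧
      (c.remove hpq hp hq).arcHeight u v (c.τ p) = c.arcHeight u v p + c.arcHeight u v q := by
  have h1 : (c.remove hpq hp hq).τ (c.τ p) = c.τ q := by
    simp [remove, hp, hτ, c.involutive]
  refine ⟨h1, ?_⟩
  have h2 := c.height_add_height_adjacent hpq (c.sgn_adjacent hpq hp) hu hv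
  rw [arcHeight, h1, c.height_congr (c.sgn_remove hpq hp hq hτ),
    c.height_congr (c.sgn_remove hpq hp hq hq), arcHeight, arcHeight]
  linarith

/-- Merging a special with a non-special arc does not change the number of special arcs. -/
lemma HasTwoSpecial.remove_merge {c : NCMatching n} {u v : ℕ} (hc : c.HasTwoSpecial u v)
    {p q : Fin n} (hpq : (q : ℕ) = p + 1) (hp : c.τ p ≠ p) (hq : c.τ q ≠ q) (hτ : c.τ p ≠ q)
    (hu : u ≠ q) (hv : v ≠ q) (hdiff : ¬ (c.arcHeight u v p = 0 ↔ c.arcHeight u v q = 0)) :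
    (c.remove hpq hp hq).HasTwoSpecial u v := by
  obtain ⟨x, y, hx, hy, h1, h2, h3, h4⟩ := hc
  obtain ⟨e1, e2⟩ := c.arcHeight_remove_merged hpq hp hq hτ hu hv
  have e3 := c.arcHeight_remove hpq hp hq u v (z := x)
  have e4 := c.arcHeight_remove hpq hp hq u v (z := y)
  have e5 := c.remove_tau hpq hp hq (z := x)
  have e6 := c.remove_tau hpq hp hq (z := y)
  have e7 := c.arcHeight_partner u v x
  have e8 := c.arcHeight_partner u v y
  have i1 := c.involutive x
  have i2 := c.involutive y
  have i3 := c.involutive p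
  have i4 := c.involutive q
  have e9 := (c.remove hpq hp hq).arcHeight_partner u v (c.τ p)
  have e10 := (c.remove hpq hp hq).involutive (c.τ p)
  have hne := ne_of_adjacent hpq
  rw [e1] at e9 e10
  by_cases hp0 : c.arcHeight u v p = 0
  · have hq0 : c.arcHeight u v q ≠ 0 := fun h => hdiff ⟨fun _ => h, fun _ => hp0⟩
    rw [hp0, zero_add] at e2
    refine ⟨if x = q then c.τ q else x, if y = q then c.τ q else y, ?_⟩
    split_ifs <;> grind
  · have hq0 : c.arcHeight u v q = 0 := by
      by_contra h; exact hdiff ⟨fun h' => absurd h' hp0, fun h' => absurd h' h⟩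
    rw [hq0, add_zero] at e2
    refine ⟨if x = p then c.τ p else x, if y = p then c.τ p else y, ?_⟩
    split_ifs <;> grind

/-- A column operation that moves a particle to a position with fewer particles contributes a
positive multiple of the coefficient of the matching after the move. -/
lemma value_pos_of_swap {p q : Fin n} (hpq : (q : ℕ) = p + 1) {t : ℝ} (ht : 0 < t)
    {α α' β β' : Finset (Fin n) → ℝ} (hα : IsColOp p q t α α') (hβ : IsColOp p q t β β')
    (hnn : ∀ (c : NCMatching n) (u v : ℕ), 0 ≤ c.value α β u v) (h : c.τ p = p ∨ c.τ q = q)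
    (hlt : c.occ p < c.occ q) {u v : ℕ} (hu : u ≠ q) (hv : v ≠ q)
    (hpos : 0 < (c.swapPoints hpq h).value α β u v) : 0 < c.value α' β' u v := by
  have hpT : p ∉ c.T := by
    intro hpT
    have h1 : c.occ p = 2 := by simp [occ, hpT]
    have h2 : c.occ q ≤ 2 := by unfold occ; split_ifs <;> omega
    omega
  by_cases hqT : q ∈ c.T
  · by_cases hp : c.τ p = p
    · rw [c.value_split hα hβ hpq hp hpT hqT hu hv]
      exact add_pos_of_nonneg_of_pos (add_nonneg (hnn _ _ _) (mul_nonneg ht.le (hnn _ _ _)))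
        (mul_pos (pow_pos ht 2) hpos)
    · rw [c.value_swap_distinguished hα hβ hpq hp hqT hu hv]
      exact add_pos_of_nonneg_of_pos (hnn _ _ _) (mul_pos ht hpos)
  · have hq : c.τ q ≠ q := by
      intro hq
      have h1 : c.occ q = 0 := by simp [occ, hqT, hq]
      omega
    have hp : c.τ p = p := h.resolve_right hq
    rw [c.value_swap_free hα hβ hpq hp hpT hq hu hv]
    exact add_pos_of_nonneg_of_pos (hnn _ _ _) (mul_pos ht hpos)

lemma occ_of_matched {x : Fin n} (hx : c.τ x ≠ x) : c.occ x = 1 := by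
  simp [occ, hx, c.notMem_T hx]

lemma matched_of_occ {x : Fin n} (hx : c.occ x = 1) : c.τ x ≠ x := by
  intro h
  unfold occ at hx
  split_ifs at hx
  omega

/-- If no particle can be moved, the occupation numbers decrease. -/
lemma occ_antitone (h : ∀ p q : Fin n, (q : ℕ) = p + 1 → ¬ c.occ p < c.occ q) {x y : Fin n}
    (hxy : x ≤ y) : c.occ y ≤ c.occ x := by
  have key : ∀ d : ℕ, ∀ x y : Fin n, (y : ℕ) = x + d → c.occ y ≤ c.occ x := by
    intro d
    induction d with
    | zero => intro x y h; rw [Fin.ext (show (y : ℕ) = x by omega)]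
    | succ d ih =>
      intro x y hy
      have h1 := ih x ⟨x + d, by omega⟩ rfl
      have h2 := h ⟨x + d, by omega⟩ y (by simp only; omega)
      omega
  exact key (y - x) x y (by rw [Fin.le_def] at hxy; omega)

lemma mem_iff_lt_card_of_lower {S : Finset (Fin n)} (hS : ∀ x y : Fin n, x ≤ y → y ∈ S → x ∈ S) (x : Fin n) :
    x ∈ S ↔ (x : ℕ) < S.card := by
  constructor
  · intro hx
    have : Finset.Iic x ⊆ S := fun z hz => hS z x (Finset.mem_Iic.mp hz) hx
    have := Finset.card_le_card this
    rw [Fin.card_Iic] at this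
    omega
  · intro hx
    by_contra hx'
    have : S ⊆ Finset.Iio x := fun z hz =>
      Finset.mem_Iio.mpr (lt_of_not_ge fun h => hx' (hS x z h hz))
    have := Finset.card_le_card this
    rw [Fin.card_Iio] at this
    omega

/-- If no particle can be moved and there are just four matched points, the matching is initial. -/
lemma isInitial_of_antitone {a : ℕ} (h : ∀ x y : Fin n, x ≤ y → c.occ y ≤ c.occ x)
    (hS : c.support.card = 4) (htot : ∑ x, c.occ x = 2 * (a + 2)) : c.IsInitial a := by
  rw [sum_occ, hS] at htot
  have hTcard : c.T.card = a := by omega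
  have hT : ∀ x, x ∈ c.T ↔ c.occ x = 2 := by
    intro x
    unfold occ
    split_ifs <;> simp_all
  have hTS : ∀ x, x ∈ c.T ∪ c.support ↔ 1 ≤ c.occ x := by
    intro x
    unfold occ
    rw [Finset.mem_union, mem_support]
    split_ifs <;> simp_all
  have hle : ∀ x, c.occ x ≤ 2 := by
    intro x
    unfold occ
    split_ifs <;> omega
  have h1 : ∀ x : Fin n, x ∈ c.T ↔ (x : ℕ) < a := by
    intro x
    rw [← hTcard]
    refine mem_iff_lt_card_of_lower (fun x y hxy hy => ?_) x
    rw [hT] at hy ⊢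
    have := h x y hxy
    have := hle x
    omega
  have hdisj : Disjoint c.T c.support := by
    rw [Finset.disjoint_left]
    intro x hx hx'
    exact (c.mem_support.mp hx') (c.fixed x hx)
  have h2 : ∀ x : Fin n, x ∈ c.T ∪ c.support ↔ (x : ℕ) < a + 4 := by
    intro x
    rw [← hTcard, ← hS, ← Finset.card_union_of_disjoint hdisj]
    refine mem_iff_lt_card_of_lower (fun x y hxy hy => ?_) x
    rw [hTS] at hy ⊢
    have := h x y hxy
    omega
  refine ⟨h1, fun x => ?_⟩
  rw [← h2 x, ← c.mem_support, Finset.mem_union]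
  have h3 := h1 x
  constructor
  · intro hx
    refine ⟨?_, Or.inr hx⟩
    by_contra hlt
    exact Finset.disjoint_left.mp hdisj (h3.mpr (by omega)) hx
  · rintro ⟨h4, h5 | h5⟩
    · have := h3.mp h5; omega
    · exact h5

lemma exists_adjacent_of_ne (hocc : ∀ x y : Fin n, x ≤ y → c.occ y ≤ c.occ x) {P : Fin n → Prop}
    {x y : Fin n} (hx : c.τ x ≠ x) (hy : c.τ y ≠ y) (hPx : P x) (hPy : ¬ P y) :
    ∃ p q : Fin n, (q : ℕ) = p + 1 ∧ c.τ p ≠ p ∧ c.τ q ≠ q ∧ ¬ (P p ↔ P q) := by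
  by_contra hno
  push Not at hno
  have key : ∀ d : ℕ, ∀ x y : Fin n, (y : ℕ) = x + d → c.τ x ≠ x → c.τ y ≠ y → (P x ↔ P y) := by
    intro d
    induction d with
    | zero => intro x y h _ _; rw [Fin.ext (show (y : ℕ) = x by omega)]
    | succ d ih =>
      intro x y h hx hy
      set z : Fin n := ⟨x + d, by omega⟩ with hz
      have h1 := hocc x z (by rw [Fin.le_def]; simp [hz])
      have h2 := hocc z y (by rw [Fin.le_def]; simp only [hz]; omega)
      rw [c.occ_of_matched hx] at h1
      rw [c.occ_of_matched hy] at h2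
      have hzm := c.matched_of_occ (x := z) (by omega)
      rw [ih x z rfl hx hzm]
      exact hno z y (by simp only [hz]; omega) hzm hy
  rcases le_total x y with h | h
  · exact hPy ((key (y - x) x y (by rw [Fin.le_def] at h; omega) hx hy).mp hPx)
  · exact hPy ((key (x - y) y x (by rw [Fin.le_def] at h; omega) hy hx).mpr hPx)

/-- An innermost arc connects neighbours, if the matched points form an interval. -/
lemma exists_short_arc (hocc : ∀ x y : Fin n, x ≤ y → c.occ y ≤ c.occ x) {x₀ : Fin n}
    (hx₀ : c.τ x₀ ≠ x₀) : ∃ p q : Fin n, (q : ℕ) = p + 1 ∧ c.τ p = q := by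
  have hne : (Finset.univ.filter fun x => x < c.τ x).Nonempty := by
    rcases lt_or_gt_of_ne hx₀ with h | h
    · exact ⟨c.τ x₀, by simpa [c.involutive] using h⟩
    · exact ⟨x₀, by simpa using h⟩
  obtain ⟨x, hx, hmin⟩ := Finset.exists_min_image _ (fun x => (c.τ x : ℕ) - x) hne
  simp only [Finset.mem_filter, Finset.mem_univ, true_and] at hx hmin
  refine ⟨x, c.τ x, ?_, rfl⟩
  by_contra hgap
  rw [Fin.lt_def] at hx
  set y : Fin n := ⟨x + 1, by omega⟩ with hy
  have hyv : (y : ℕ) = x + 1 := rfl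
  have h1 := hocc x y (by rw [Fin.le_def]; omega)
  have h2 := hocc y (c.τ x) (by rw [Fin.le_def]; omega)
  rw [c.occ_of_matched (x := x) (fun h => by rw [h] at hx; omega)] at h1
  rw [c.occ_of_matched (x := c.τ x) (by rw [c.involutive]; intro h; rw [← h] at hx; omega)] at h2
  have hym := c.matched_of_occ (x := y) (by omega)
  have h3 := c.nested x y (by rw [Fin.lt_def]; omega) (by rw [Fin.lt_def]; omega)
  rw [Fin.lt_def, Fin.lt_def] at h3
  have h4 : (c.τ y : ℕ) ≠ y := fun h => hym (Fin.ext h)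
  have h5 := hmin y (by rw [Fin.lt_def]; omega)
  omega

/-- Contracting an arc keeps two special arcs, if all arcs are special and there are at least
three arcs. -/
lemma hasTwoSpecial_contract {u v : ℕ} (hcard : 4 < c.support.card)
    (hall : ∀ x, c.τ x ≠ x → c.arcHeight u v x ≠ 0) {p q : Fin n} (hpq : (q : ℕ) = p + 1)
    (hp : c.τ p ≠ p) (hq : c.τ q ≠ q) (hτ : c.τ p = q) :
    (c.remove hpq hp hq).HasTwoSpecial u v := by
  obtain ⟨x, hx, hx'⟩ : ∃ x ∈ c.support, x ∉ ({p, q} : Finset (Fin n)) :=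
    Finset.exists_mem_notMem_of_card_lt_card ((Finset.card_le_two).trans_lt (by omega))
  obtain ⟨y, hy, hy'⟩ : ∃ y ∈ c.support, y ∉ ({p, q, x, c.τ x} : Finset (Fin n)) :=
    Finset.exists_mem_notMem_of_card_lt_card ((Finset.card_le_four).trans_lt (by omega))
  simp only [Finset.mem_insert, Finset.mem_singleton, not_or] at hx' hy'
  rw [mem_support] at hx hy
  have i1 := c.involutive x
  have i2 := c.involutive y
  have i3 := c.involutive p
  have hx1 : c.τ x ≠ p := by grind
  have hx2 : c.τ x ≠ q := by grind
  have hy1 : c.τ y ≠ p := by grind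
  have hy2 : c.τ y ≠ q := by grind
  refine ⟨x, y, ?_, ?_, hy'.2.2.1, ?_, ?_, ?_⟩
  · rwa [c.remove_tau hpq hp hq hx'.1 hx'.2 hx1 hx2]
  · rwa [c.remove_tau hpq hp hq hy'.1 hy'.2.1 hy1 hy2]
  · rw [c.remove_tau hpq hp hq hx'.1 hx'.2 hx1 hx2]; exact hy'.2.2.2
  · rw [c.arcHeight_remove hpq hp hq u v hx'.1 hx'.2 hx1 hx2]; exact hall x hx
  · rw [c.arcHeight_remove hpq hp hq u v hy'.1 hy'.2.1 hy1 hy2]; exact hall y hy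

/-- The coefficients of matchings with two special arcs are positive. In the induction, a positive
multiple `t` of a column is split off from the next one so that the coefficient of a matching with
smaller potential occurs; the base case is that of the initial matchings. -/
theorem value_pos {a : ℕ} (hn : a + 4 ≤ n) (c : NCMatching n) (u v : ℕ) (M : ℕ → ℕ → ℝ)
    (htot : ∑ x, c.occ x = 2 * (a + 2)) (hc : c.HasTwoSpecial u v)
    (hM : ConsecutivePos (a + 4) n M) : 0 < c.value (minors a n M) (minors (a + 4) n M) u v := by
  induction hN : c.potential using Nat.strong_induction_on generalizing c u v M with
  | h N ih =>
  -- the situation after splitting off a column operation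
  have split : ∀ p q : Fin n, (q : ℕ) = p + 1 → ∃ t : ℝ, 0 < t ∧ ∃ M', ConsecutivePos (a + 4) n M' ∧
      IsColOp p q t (minors a n M') (minors a n M) ∧
      IsColOp p q t (minors (a + 4) n M') (minors (a + 4) n M) := by
    intro p q hpq
    obtain ⟨t, ht, hM'⟩ := hM.exists_addCol_neg (p : ℕ)
    have h1 := isColOp_minors hpq t a (addCol p (-t) M)
    have h2 := isColOp_minors hpq t (a + 4) (addCol p (-t) M)
    rw [addCol_addCol_neg] at h1 h2
    exact ⟨t, ht, _, hM', h1, h2⟩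
  by_cases hmove : ∃ p q : Fin n, (q : ℕ) = p + 1 ∧ c.occ p < c.occ q
  · obtain ⟨p, q, hpq, hlt⟩ := hmove
    have hfix : c.τ p = p ∨ c.τ q = q := by
      by_contra h
      push Not at h
      rw [c.occ_of_matched h.1, c.occ_of_matched h.2] at hlt
      omega
    have hτ : c.τ p ≠ q := by
      have := c.involutive p
      have := ne_of_adjacent hpq
      grind
    obtain ⟨u', v', hu, hv, hh, he⟩ := c.exists_cuts_ne hpq hτ u v
    obtain ⟨t, ht, M', hM', h1, h2⟩ := split p q hpq
    rw [he]
    obtain ⟨hpot, hsum⟩ := c.potential_swapPoints hpq hfix hlt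
    refine c.value_pos_of_swap hpq ht h1 h2 (fun c u v => c.value_nonneg hn hM' u v) hfix hlt hu hv
      (ih _ (hN ▸ hpot) _ u' v' M' (hsum.trans htot) ?_ hM' rfl)
    refine HasTwoSpecial.swapPoints ?_ hpq hfix hu hv
    obtain ⟨x, y, hx, hy, h3, h4, h5, h6⟩ := hc
    exact ⟨x, y, hx, hy, h3, h4, by rwa [hh x hx], by rwa [hh y hy]⟩
  push Not at hmove
  have hocc : ∀ x y : Fin n, x ≤ y → c.occ y ≤ c.occ x := fun x y hxy =>
    c.occ_antitone (fun p q h => not_lt.mpr (hmove p q h)) hxy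
  obtain ⟨x, y, hx, hy, h3, h4, h5, h6⟩ := id hc
  have hfour : ({x, c.τ x, y, c.τ y} : Finset (Fin n)) ⊆ c.support := by
    intro z hz
    have i1 := c.involutive x
    have i2 := c.involutive y
    simp only [Finset.mem_insert, Finset.mem_singleton] at hz
    rw [mem_support]
    grind
  have hfour' : ({x, c.τ x, y, c.τ y} : Finset (Fin n)).card = 4 := by
    have i1 := c.involutive x
    have i2 := c.involutive y
    rw [Finset.card_insert_of_notMem, Finset.card_insert_of_notMem, Finset.card_insert_of_notMem,
      Finset.card_singleton]
    · simp; grind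
    · simp; grind
    · simp; grind
  have hge : 4 ≤ c.support.card := hfour' ▸ Finset.card_le_card hfour
  rcases hge.eq_or_lt with heq | hgt
  · have hinit := c.isInitial_of_antitone hocc heq.symm htot
    obtain ⟨x', y', h7, h8, h9⟩ := hinit.exists_value hn (α := minors a n M)
      (β := minors (a + 4) n M) (fun I hI => minors_of_card_ne M hI) u v
    rw [h8, minors_initial (by omega), minors_initial hn]
    refine mul_pos (neg_pos.mpr (lt_of_le_of_ne h9 ?_)) (mul_pos (hM a 0 (by omega) (by omega))
      (hM (a + 4) 0 le_rfl (by omega)))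
    have i1 := c.involutive x
    have i2 := c.involutive y
    have i3 := c.involutive x'
    have i4 := c.involutive y'
    have p1 := c.arcHeight_partner u v x'
    have p2 := c.arcHeight_partner u v y'
    have q1 := h7 x hx
    have q2 := h7 y hy
    apply mul_ne_zero <;> grind
  · by_cases hall : ∀ z, c.τ z ≠ z → c.arcHeight u v z ≠ 0
    · obtain ⟨p, q, hpq, hτ⟩ := c.exists_short_arc hocc hx
      have hp : c.τ p ≠ p := by rw [hτ]; exact (ne_of_adjacent hpq).symm
      have hq : c.τ q ≠ q := by rw [← hτ, c.involutive, hτ]; exact ne_of_adjacent hpq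
      obtain ⟨t, ht, M', hM', h1, h2⟩ := split p q hpq
      obtain ⟨hpot, hsum⟩ := c.potential_remove hpq hp hq
      rw [c.value_contract hpq hp hq h1 h2 hτ]
      exact add_pos_of_nonneg_of_pos (c.value_nonneg hn hM' u v)
        (mul_pos (mul_pos two_pos ht) (ih _ (hN ▸ hpot) _ u v M' (hsum.trans htot)
          (c.hasTwoSpecial_contract hgt hall hpq hp hq hτ) hM' rfl))
    · push Not at hall
      obtain ⟨z, hz, hz0⟩ := hall
      obtain ⟨p, q, hpq, hp, hq, hdiff⟩ := c.exists_adjacent_of_ne hocc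
        (P := fun z => c.arcHeight u v z = 0) hz hx hz0 h5
      have hτ : c.τ p ≠ q := by
        intro hτ
        have := c.arcHeight_partner u v p
        rw [hτ] at this
        exact hdiff (by rw [this])
      obtain ⟨u', v', hu, hv, hh, he⟩ := c.exists_cuts_ne hpq hτ u v
      obtain ⟨t, ht, M', hM', h1, h2⟩ := split p q hpq
      obtain ⟨hpot, hsum⟩ := c.potential_remove hpq hp hq
      have hc' : c.HasTwoSpecial u' v' :=
        ⟨x, y, hx, hy, h3, h4, by rwa [hh x hx], by rwa [hh y hy]⟩
      rw [he, c.value_merge hpq hp hq h1 h2 hτ hu hv]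
      exact add_pos_of_nonneg_of_pos (c.value_nonneg hn hM' u' v')
        (mul_pos ht (ih _ (hN ▸ hpot) _ u' v' M' (hsum.trans htot)
          (hc'.remove_merge hpq hp hq hτ hu hv (by rwa [hh p hp, hh q hq])) hM' rfl))

end NCMatching

/-! ### The coefficients as pairings -/

/-- The interval `[u, v)`, or the complement of the interval `[v, u)`. In both cases the indicator
function of the set differs from `[p < v] - [p < u]` by a constant, so that the arcs with exactly one
endpoint in the set are those separated by the cuts `u` and `v`, as measured by
`NCMatching.height`. -/
def IsCyclicInterval {n : ℕ} (I : Finset (Fin n)) (u v : ℕ) : Prop :=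
  (u ≤ v ∧ ∀ p : Fin n, p ∈ I ↔ u ≤ (p : ℕ) ∧ (p : ℕ) < v) ∨
    (v ≤ u ∧ ∀ p : Fin n, p ∈ I ↔ ¬ (v ≤ (p : ℕ) ∧ (p : ℕ) < u))

lemma mem_cyclicInterval_iff {n : ℕ} {i j : ℤ} (p : Fin n) (hji : j ≤ i + n) :
    p ∈ cyclicInterval n i j ↔
      (i % n < (p : ℕ) + 1 ∧ (p : ℕ) + 1 ≤ i % n + (j - i)) ∨
        (p : ℕ) + 1 + (n : ℤ) ≤ i % n + (j - i) := by
  have hn : (0 : ℤ) < n := by have := p.2; omega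
  have hp := p.2
  have h1 := Int.emod_nonneg i hn.ne'
  have h2 := Int.emod_lt_of_pos i hn
  have h3 := Int.emod_add_mul_ediv i n
  simp only [cyclicInterval, Finset.mem_filter, Finset.mem_univ, true_and]
  set r := i % n
  set s := i / n
  constructor
  · rintro ⟨m, hm1, hm2, hm3⟩
    obtain ⟨t, ht⟩ := hm3.symm.dvd
    have ht' : (n : ℤ) * t = n * (t - s) + n * s := by ring
    set d := t - s
    have hd0 : 0 ≤ d := by
      by_contra hneg
      have : (n : ℤ) * d ≤ n * (-1) := mul_le_mul_of_nonneg_left (by omega) hn.le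
      omega
    have hd1 : d ≤ 1 := by
      by_contra hbig
      have : (n : ℤ) * 2 ≤ n * d := mul_le_mul_of_nonneg_left (by omega) hn.le
      omega
    have hd : d = 0 ∨ d = 1 := by omega
    rcases hd with hd | hd <;> rw [hd] at ht'
    · left; omega
    · right; omega
  · rintro (h | h)
    · refine ⟨(p : ℕ) + 1 + n * s, by omega, by omega, ?_⟩
      simp [Int.ModEq]
    · refine ⟨(p : ℕ) + 1 + n + n * s, by omega, by omega, ?_⟩
      simp [Int.ModEq]

lemma isCyclicInterval_cyclicInterval {n : ℕ} (hn : 0 < n) {i j : ℤ} (hij : i ≤ j)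
    (hji : j ≤ i + n) : ∃ u v, IsCyclicInterval (cyclicInterval n i j) u v := by
  have hn' : (0 : ℤ) < n := by omega
  have h1 := Int.emod_nonneg i hn'.ne'
  have h2 := Int.emod_lt_of_pos i hn'
  have h3 := fun p : Fin n => mem_cyclicInterval_iff p hji
  set r := i % n
  by_cases h : r + (j - i) ≤ n
  · refine ⟨r.toNat, (r + (j - i)).toNat, Or.inl ⟨by omega, fun p => ?_⟩⟩
    have := p.2
    rw [h3]
    omega
  · refine ⟨r.toNat, (r + (j - i) - n).toNat, Or.inr ⟨by omega, fun p => ?_⟩⟩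
    have := p.2
    rw [h3]
    omega

namespace PartialMatching

variable {k n : ℕ} (x : PartialMatching k n)

/-- The non-crossing matching underlying a partial non-crossing matching. -/
def toNC : NCMatching n where
  τ := x.τ
  T := x.T
  involutive := x.involutive
  nested a b hab hb := by
    have hi := x.involutive
    rcases lt_trichotomy (x.τ b) b with h | h | h
    · refine ⟨?_, h.trans hb⟩
      rcases lt_trichotomy (x.τ b) a with h' | h' | h'
      · exact absurd ⟨hi b, rfl⟩ (x.noncrossing _ _ _ _ h' hab hb)
      · rw [← h', hi b] at hb; exact absurd hb (lt_irrefl _)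
      · exact h'
    · rw [h]; exact ⟨hab, hb⟩
    · refine ⟨hab.trans h, ?_⟩
      rcases lt_trichotomy (x.τ b) (x.τ a) with h' | h' | h'
      · exact h'
      · exact absurd (x.τ.injective h') hab.ne'
      · exact absurd ⟨rfl, rfl⟩ (x.noncrossing _ _ _ _ hab hb h')
  fixed a ha := by
    have := Finset.disjoint_left.mp x.disjoint ha
    rwa [Equiv.Perm.notMem_support] at this

lemma mem_support_iff (p : Fin n) : p ∈ x.τ.support ↔ x.toNC.τ p ≠ p := Equiv.Perm.mem_support

lemma card_pair_inter {a b : Fin n} (hab : a ≠ b) (I : Finset (Fin n)) :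
    (({a, b} : Finset (Fin n)) ∩ I).card = 1 ↔ ¬ (a ∈ I ↔ b ∈ I) := by
  by_cases ha : a ∈ I <;> by_cases hb : b ∈ I <;>
    simp [Finset.insert_inter_of_mem, Finset.insert_inter_of_notMem, ha, hb, hab]

/-- The weight of marking an arc in its endpoint `p`: the sign of `p`, if only `p` is in `I`. -/
noncomputable def markWeight (I : Finset (Fin n)) (p q : Fin n) : ℝ :=
  if p ∈ I ∧ q ∉ I then x.toNC.sgn p else 0

lemma arcHeight_eq_markWeight {I : Finset (Fin n)} {u v : ℕ} (hI : IsCyclicInterval I u v)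
    {p : Fin n} (hp : x.toNC.τ p ≠ p) :
    x.toNC.arcHeight u v p = x.markWeight I p (x.toNC.τ p) + x.markWeight I (x.toNC.τ p) p := by
  have hs := x.toNC.sgn_partner hp
  unfold NCMatching.arcHeight NCMatching.height NCMatching.cut markWeight
  rw [hs]
  obtain ⟨huv, hI⟩ | ⟨huv, hI⟩ := hI <;> simp only [hI] <;> split_ifs <;> first | omega | ring

/-- A chord separating two arcs whose endpoints are separated by `I` in the same direction is
special. -/
lemma special_of_separates {I : Finset (Fin n)} {u v : ℕ} (hI : IsCyclicInterval I u v)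
    {a b l r l' r' : Fin n} (hl : l ∈ I) (hr : r ∉ I) (hl' : l' ∈ I) (hr' : r' ∉ I)
    (h1 : a < l ∧ l < b) (h2 : a < r ∧ r < b) (h3 : l' < a ∨ b < l') (h4 : r' < a ∨ b < r') :
    ¬ (a ∈ I ↔ b ∈ I) := by
  simp only [Fin.lt_def] at *
  obtain ⟨huv, hI⟩ | ⟨huv, hI⟩ := hI <;> simp only [hI] at * <;> omega

/-- Two arcs separated by `I` cannot alternate. -/
lemma mem_Ioo_iff_of_cyclicInterval {I : Finset (Fin n)} {u v : ℕ} (hI : IsCyclicInterval I u v)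
    {l r l' r' : Fin n} (hl : l ∈ I) (hr : r ∉ I) (hl' : l' ∈ I) (hr' : r' ∉ I) :
    (l < r ∧ r < l') ↔ (l < r' ∧ r' < l') := by
  simp only [Fin.lt_def] at *
  have := fun h : r = l => hr (h ▸ hl)
  obtain ⟨huv, hI⟩ | ⟨huv, hI⟩ := hI <;> simp only [hI] at * <;> omega

/-- The matched points strictly between `l` and `l'`. -/
def gap (l l' : Fin n) : Finset (Fin n) := x.τ.support.filter fun a => l < a ∧ a < l'

lemma mem_gap {l l' a : Fin n} : a ∈ x.gap l l' ↔ x.τ a ≠ a ∧ l < a ∧ a < l' := by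
  simp [gap]

lemma sgn_mul_sgn {l l' : Fin n} (hl : x.τ l ≠ l) (hll : l < l') :
    x.toNC.sgn l * x.toNC.sgn l' = - (-1) ^ (x.gap l l').card := by
  have hsplit : x.toNC.support.filter (· < l') =
      insert l (x.toNC.support.filter (· < l) ∪ x.gap l l') := by
    ext y
    simp only [mem_gap, Finset.mem_filter, NCMatching.mem_support, Finset.mem_insert,
      Finset.mem_union]
    change x.τ y ≠ y ∧ y < l' ↔ y = l ∨ x.τ y ≠ y ∧ y < l ∨ x.τ y ≠ y ∧ l < y ∧ y < l'
    constructor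
    · rintro ⟨h1, h2⟩
      rcases lt_trichotomy y l with h | h | h <;> simp [h, h1, h2]
    · rintro (h | ⟨h1, h2⟩ | ⟨h1, -, h2⟩)
      · subst h; exact ⟨hl, hll⟩
      · exact ⟨h1, h2.trans hll⟩
      · exact ⟨h1, h2⟩
  unfold NCMatching.sgn
  rw [hsplit, Finset.card_insert_of_notMem (by simp [mem_gap]), Finset.card_union_of_disjoint,
    pow_succ, pow_add]
  · have : ((-1 : ℝ) ^ (x.toNC.support.filter (· < l)).card) ^ 2 = 1 := by
      rw [← pow_mul, mul_comm, pow_mul]; norm_num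
    linear_combination (- (-1 : ℝ) ^ (x.gap l l').card) * this
  · rw [Finset.disjoint_left]
    intro y h1 h2
    simp only [Finset.mem_filter, mem_gap] at h1 h2
    exact absurd h1.2 (not_lt.mpr h2.2.1.le)

/-- The points between `l` and `l'` on arcs that leave this interval and do not end in `l` or
`l'`. -/
def leaving (l l' : Fin n) : Finset (Fin n) :=
  (x.gap l l').filter fun a => x.τ a ∉ x.gap l l' ∧ a ≠ x.τ l ∧ a ≠ x.τ l'

lemma neg_one_pow_leaving {l l' : Fin n} (hne : l ≠ l')
    (h : x.τ l ∈ x.gap l l' ↔ x.τ l' ∈ x.gap l l') :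
    (-1 : ℝ) ^ (x.leaving l l').card = (-1) ^ (x.gap l l').card := by
  have hτ : ∀ a, x.τ (x.τ a) = a := x.involutive
  have hl : l ∉ x.gap l l' := by simp [mem_gap]
  have hl' : l' ∉ x.gap l l' := by simp [mem_gap]
  have hnr : x.τ l ≠ x.τ l' := fun h => hne (x.τ.injective h)
  set G := x.gap l l' with hG
  have heven : (-1 : ℝ) ^ (G.filter fun a => x.τ a ∈ G).card = 1 := by
    rw [← Finset.prod_const]
    refine Finset.prod_involution (fun y _ => x.τ y) ?_ ?_ ?_ ?_
    · intros; norm_num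
    · intro y hy _
      exact ((x.mem_gap).mp (Finset.mem_filter.mp hy).1).1
    · intro y hy
      rw [Finset.mem_filter] at hy ⊢
      rw [hτ]; exact hy.symm
    · intro y _; exact hτ y
  have h1 := Finset.card_filter_add_card_filter_not (s := G) fun a => x.τ a ∈ G
  rw [← h1, pow_add, heven, one_mul]
  by_cases hr : x.τ l ∈ G
  · have hr' := h.mp hr
    have h2 : (G.filter fun a => ¬ x.τ a ∈ G) = insert (x.τ l) (insert (x.τ l') (x.leaving l l')) := by
      ext a
      simp only [leaving, ← hG, Finset.mem_filter, Finset.mem_insert]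
      constructor
      · rintro ⟨ha, ha'⟩; tauto
      · rintro (rfl | rfl | ⟨ha, ha', -⟩)
        · exact ⟨hr, by rwa [hτ]⟩
        · exact ⟨hr', by rwa [hτ]⟩
        · exact ⟨ha, ha'⟩
    rw [h2, Finset.card_insert_of_notMem (by simp [leaving, hnr]),
      Finset.card_insert_of_notMem (by simp [leaving])]
    ring
  · have hr' := fun h' => hr (h.mpr h')
    congr 2
    refine Finset.filter_congr fun a ha => ⟨fun h => h.1, fun h => ⟨h, ?_, ?_⟩⟩
    · rintro rfl; exact hr ha
    · rintro rfl; exact hr' ha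

lemma arc_partner (a : Fin n) : x.arc (x.τ a) = x.arc a := by
  rw [arc, x.involutive, Finset.pair_comm]; rfl

lemma not_strictlyBetween_self {e : Finset (Fin n)} {l : Fin n} :
    ¬ StrictlyBetween e (x.arc l) (x.arc l) := by
  rintro ⟨a, b, -, -, ⟨h1, h2⟩ | ⟨h1, h2⟩⟩ <;>
  · have hl : l ∈ x.arc l := by simp [arc]
    exact Finset.disjoint_left.mp h2 hl (Finset.Ioo_subset_Icc_self (h1 hl))

lemma pair_subset_Ioo {a b l r : Fin n} :
    ({l, r} : Finset (Fin n)) ⊆ Finset.Ioo a b ↔ (a < l ∧ l < b) ∧ a < r ∧ r < b := by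
  simp [Finset.insert_subset_iff]

lemma disjoint_pair_Icc {a b l r : Fin n} :
    Disjoint ({l, r} : Finset (Fin n)) (Finset.Icc a b) ↔
      (l < a ∨ b < l) ∧ (r < a ∨ b < r) := by
  simp only [Finset.disjoint_insert_left, Finset.disjoint_singleton_left, Finset.mem_Icc, not_and_or,
    not_le]

/-- The chords through the points of `leaving l l'` separate the chords through `l` and `l'`. -/
lemma strictlyBetween_of_mem_leaving {a l l' : Fin n} (ha : a ∈ x.leaving l l') :
    StrictlyBetween (x.arc a) (x.arc l) (x.arc l') ∨
      StrictlyBetween (x.arc a) (x.arc l') (x.arc l) := by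
  have hτ : ∀ a, x.τ (x.τ a) = a := x.involutive
  simp only [leaving, Finset.mem_filter, mem_gap, hτ] at ha
  obtain ⟨⟨ha0, h1, h2⟩, h3, h4, h5⟩ := ha
  have hnest : ∀ p q : Fin n, p < q → q < x.τ p → p < x.τ q ∧ x.τ q < x.τ p := x.toNC.nested
  have n1 := hnest a l'
  have n2 := hnest (x.τ a) l
  have n3 := hnest a (x.τ l)
  have n4 := hnest (x.τ a) (x.τ l')
  have e1 : x.τ a ≠ l := fun h => h4 (by rw [← h, hτ])
  have e2 : x.τ a ≠ l' := fun h => h5 (by rw [← h, hτ])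
  have e3 : x.τ l ≠ x.τ a := fun h => h1.ne (x.τ.injective h)
  have e4 : x.τ l' ≠ x.τ a := fun h => h2.ne' (x.τ.injective h)
  simp only [hτ] at n2 n3 n4
  rcases lt_or_gt_of_ne e2 with h | h
  · -- the arc ends to the left of `l`
    left
    have hlt : x.τ a < l := by
      refine lt_of_le_of_ne (not_lt.mp fun h' => h3 ⟨ha0.symm, h', h⟩) e1
    refine ⟨x.τ a, a, hlt.trans h1, by rw [← arc_partner, arc, hτ], Or.inl ⟨?_, ?_⟩⟩
    · exact pair_subset_Ioo.mpr ⟨⟨hlt, h1⟩, n2 hlt h1⟩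
    · refine disjoint_pair_Icc.mpr ⟨Or.inr h2, ?_⟩
      rcases lt_or_gt_of_ne e4 with h' | h'
      · exact Or.inl h'
      · rcases lt_or_gt_of_ne h5 with h'' | h''
        · exact Or.inr h''
        · exact absurd (n4 h' h'').2 (not_lt.mpr h2.le)
  · right
    refine ⟨a, x.τ a, h2.trans h, rfl, Or.inl ⟨?_, ?_⟩⟩
    · exact pair_subset_Ioo.mpr ⟨⟨h2, h⟩, n1 h2 h⟩
    · refine disjoint_pair_Icc.mpr ⟨Or.inl h1, ?_⟩
      rcases lt_or_gt_of_ne h4 with h' | h'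
      · rcases lt_or_gt_of_ne e3 with h'' | h''
        · exact absurd (n3 h' h'').1 (not_lt.mpr h1.le)
        · exact Or.inr h''
      · exact Or.inl h'

/-- A chord that separates the chords through `l` and `l'` has exactly one endpoint between `l`
and `l'`. -/
lemma exists_mem_leaving {a l l' : Fin n} (ha : x.τ a ≠ a) (hll : l < l')
    (h : StrictlyBetween (x.arc a) (x.arc l) (x.arc l') ∨
      StrictlyBetween (x.arc a) (x.arc l') (x.arc l)) :
    ∃ b ∈ x.leaving l l', x.arc b = x.arc a := by
  have hτ : ∀ a, x.τ (x.τ a) = a := x.involutive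
  have key : ∃ p q, p < q ∧ x.arc a = {p, q} ∧
      ((x.arc l ⊆ Finset.Ioo p q ∧ Disjoint (x.arc l') (Finset.Icc p q)) ∨
        (x.arc l' ⊆ Finset.Ioo p q ∧ Disjoint (x.arc l) (Finset.Icc p q))) := by
    rcases h with ⟨p, q, h1, h2, h3⟩ | ⟨p, q, h1, h2, h3⟩
    · exact ⟨p, q, h1, h2, h3⟩
    · exact ⟨p, q, h1, h2, h3.symm⟩
  obtain ⟨p, q, hpq, he, hc⟩ := key
  have hτp : x.τ p = q ∧ x.τ q = p ∧ x.arc p = x.arc a ∧ x.arc q = x.arc a := by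
    have hp : p ∈ x.arc a := by simp [he]
    have hq : q ∈ x.arc a := by simp [he]
    simp only [arc, Finset.mem_insert, Finset.mem_singleton] at hp hq
    rcases hp with rfl | rfl <;> rcases hq with rfl | rfl
    · exact absurd hpq (lt_irrefl _)
    · exact ⟨rfl, hτ _, rfl, x.arc_partner _⟩
    · exact ⟨hτ _, rfl, x.arc_partner _, rfl⟩
    · exact absurd hpq (lt_irrefl _)
  obtain ⟨hp, hq, hap, haq⟩ := hτp
  simp only [arc] at hc
  rw [pair_subset_Ioo, pair_subset_Ioo, disjoint_pair_Icc, disjoint_pair_Icc] at hc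
  simp only [leaving, Finset.mem_filter, mem_gap, hτ]
  rcases hc with ⟨⟨h1, h2⟩, h3, h4⟩ | ⟨⟨h1, h2⟩, h3, h4⟩
  · refine ⟨q, ⟨⟨by rw [hq]; exact hpq.ne, h1.2, ?_⟩, ?_, ?_, ?_⟩, haq⟩
    · rcases h3 with h | h
      · exact absurd (h.trans h1.1) (not_lt.mpr hll.le)
      · exact h
    · rw [hq]; exact fun h => absurd h.2.1 (not_lt.mpr h1.1.le)
    · exact h2.2.ne'
    · rintro rfl
      rcases h4 with h | h
      · exact absurd h (not_lt.mpr hpq.le)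
      · exact lt_irrefl _ h
  · refine ⟨p, ⟨⟨by rw [hp]; exact hpq.ne', ?_, h1.1⟩, ?_, ?_, ?_⟩, hap⟩
    · rcases h3 with h | h
      · exact h
      · exact absurd (h1.2.trans h) (not_lt.mpr hll.le)
    · rw [hp]; exact fun h => absurd h.2.2 (not_lt.mpr h1.2.le)
    · rintro rfl
      rcases h4 with h | h
      · exact lt_irrefl _ h
      · exact absurd h (not_lt.mpr hpq.le)
    · exact h2.1.ne

lemma exists_of_mem_specialArcs {I e : Finset (Fin n)} (he : e ∈ x.specialArcs I) :
    ∃ a, x.τ a ≠ a ∧ e = x.arc a ∧ ¬ (a ∈ I ↔ x.τ a ∈ I) := by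
  obtain ⟨he, hI⟩ := Finset.mem_filter.mp he
  obtain ⟨a, ha, rfl⟩ := Finset.mem_image.mp he
  have ha := Equiv.Perm.mem_support.mp ha
  exact ⟨a, ha, rfl, (card_pair_inter ha.symm I).mp hI⟩

lemma special_of_strictlyBetween {I : Finset (Fin n)} {u v : ℕ} (hI : IsCyclicInterval I u v)
    {a l l' : Fin n} (ha : x.τ a ≠ a) (hl : l ∈ I) (hr : x.τ l ∉ I) (hl' : l' ∈ I)
    (hr' : x.τ l' ∉ I) (h : StrictlyBetween (x.arc a) (x.arc l) (x.arc l')) :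
    x.arc a ∈ x.specialArcs I := by
  refine Finset.mem_filter.mpr ⟨Finset.mem_image_of_mem _ (Equiv.Perm.mem_support.mpr ha), ?_⟩
  obtain ⟨p, q, hpq, he, hc⟩ := h
  rw [he, card_pair_inter hpq.ne]
  simp only [arc] at hc
  rw [pair_subset_Ioo, pair_subset_Ioo, disjoint_pair_Icc, disjoint_pair_Icc] at hc
  rcases hc with ⟨⟨h1, h2⟩, h3, h4⟩ | ⟨⟨h1, h2⟩, h3, h4⟩
  · exact special_of_separates hI hl hr hl' hr' h1 h2 h3 h4
  · exact special_of_separates hI hl' hr' hl hr h1 h2 h3 h4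

lemma numBetween_eq_card_leaving {I : Finset (Fin n)} {u v : ℕ} (hI : IsCyclicInterval I u v)
    {μ : x.τ.support → Label} {l l' : Fin n} (hll : l < l') (hl : l ∈ I) (hr : x.τ l ∉ I)
    (hl' : l' ∈ I) (hr' : x.τ l' ∉ I)
    (hJ : ∀ p : x.τ.support, μ p = Label.J ↔ (p : Fin n) = l ∨ (p : Fin n) = l') :
    x.numBetween I μ = (x.leaving l l').card := by
  have hS : ∀ p, p ∈ I → x.τ p ∉ I → p ∈ x.τ.support := fun p h1 h2 =>
    Equiv.Perm.mem_support.mpr fun h => h2 (h.symm ▸ h1)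
  classical
  symm
  refine Finset.card_bij (fun a _ => x.arc a) ?_ ?_ ?_
  · intro a ha
    have ha0 : x.τ a ≠ a := ((x.mem_gap).mp (Finset.mem_filter.mp ha).1).1
    have hb := x.strictlyBetween_of_mem_leaving ha
    refine Finset.mem_filter.mpr ⟨?_, ?_⟩
    · rcases hb with h | h
      · exact x.special_of_strictlyBetween hI ha0 hl hr hl' hr' h
      · exact x.special_of_strictlyBetween hI ha0 hl' hr' hl hr h
    · have j1 := (hJ ⟨l, hS l hl hr⟩).mpr (Or.inl rfl)
      have j2 := (hJ ⟨l', hS l' hl' hr'⟩).mpr (Or.inr rfl)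
      rcases hb with h | h
      · exact ⟨_, _, j1, j2, h⟩
      · exact ⟨_, _, j2, j1, h⟩
  · intro a ha b hb hab
    have hmem : a ∈ x.arc b := by rw [← hab]; simp [arc]
    simp only [arc, Finset.mem_insert, Finset.mem_singleton] at hmem
    rcases hmem with h | h
    · exact h
    · have h1 := (Finset.mem_filter.mp ha).1
      exact absurd (h ▸ h1) (Finset.mem_filter.mp hb).2.1
  · intro e he
    obtain ⟨he, l₁, l₂, h1, h2, hb⟩ := Finset.mem_filter.mp he
    obtain ⟨a, ha, rfl, -⟩ := x.exists_of_mem_specialArcs he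
    have : StrictlyBetween (x.arc a) (x.arc l) (x.arc l') ∨
        StrictlyBetween (x.arc a) (x.arc l') (x.arc l) := by
      rcases (hJ l₁).mp h1 with h1 | h1 <;> rcases (hJ l₂).mp h2 with h2 | h2 <;>
        rw [h1, h2] at hb
      · exact absurd hb x.not_strictlyBetween_self
      · exact Or.inl hb
      · exact Or.inr hb
      · exact absurd hb x.not_strictlyBetween_self
    obtain ⟨b, hb, hab⟩ := x.exists_mem_leaving ha hll this
    exact ⟨b, hb, hab⟩

lemma neg_one_pow_numBetween {I : Finset (Fin n)} {u v : ℕ} (hI : IsCyclicInterval I u v)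
    {μ : x.τ.support → Label} {l l' : Fin n} (hll : l < l') (hl : l ∈ I) (hr : x.τ l ∉ I)
    (hl' : l' ∈ I) (hr' : x.τ l' ∉ I)
    (hJ : ∀ p : x.τ.support, μ p = Label.J ↔ (p : Fin n) = l ∨ (p : Fin n) = l') :
    (-1 : ℝ) ^ x.numBetween I μ = - (x.toNC.sgn l * x.toNC.sgn l') := by
  have h0 : x.τ l ≠ l := fun h => hr (h.symm ▸ hl)
  have h0' : x.τ l' ≠ l' := fun h => hr' (h.symm ▸ hl')
  have h1 : x.τ (x.τ l) ≠ x.τ l := fun h => h0 (x.τ.injective h)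
  have h1' : x.τ (x.τ l') ≠ x.τ l' := fun h => h0' (x.τ.injective h)
  rw [x.numBetween_eq_card_leaving hI hll hl hr hl' hr' hJ, x.sgn_mul_sgn h0 hll, neg_neg,
    x.neg_one_pow_leaving hll.ne]
  rw [mem_gap, mem_gap, and_iff_right h1, and_iff_right h1']
  exact mem_Ioo_iff_of_cyclicInterval hI hl hr hl' hr'

lemma isMarking_card_J {I : Finset (Fin n)} {μ : x.τ.support → Label} (hμ : x.IsMarking I μ) :
    ∃ l l' : x.τ.support, (l : Fin n) < l' ∧
      (Finset.univ.filter fun p => μ p = Label.J) = {l, l'} := by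
  obtain ⟨l, l', hne, he⟩ := Finset.card_eq_two.mp hμ.card_J
  rcases lt_or_gt_of_ne (fun h => hne (Subtype.ext h) : (l : Fin n) ≠ l') with h | h
  · exact ⟨l, l', h, he⟩
  · exact ⟨l', l, h, by rw [he, Finset.pair_comm]⟩

open NCMatching in
/-- The weight of a marking in the expansion of the generating polynomial. -/
lemma prod_labelWeight {I : Finset (Fin n)} {u v : ℕ} (hI : IsCyclicInterval I u v)
    {μ : x.τ.support → Label} (hμ : x.IsMarking I μ) :
    ∏ i : Opener x.toNC x.τ.support, labelWeight (x.markWeight I) (μ i.1)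
        (μ (x.toNC.mate x.mem_support_iff i.1)) i.1 (x.toNC.τ i.1) =
      - (-1 : ℝ) ^ x.numBetween I μ := by
  obtain ⟨l, l', hll, he⟩ := x.isMarking_card_J hμ
  have hJ : ∀ p, μ p = Label.J ↔ p = l ∨ p = l' := by
    intro p
    have : p ∈ (Finset.univ.filter fun p => μ p = Label.J) ↔ p ∈ ({l, l'} : Finset _) := by rw [he]
    simpa using this
  have jl := hμ.of_J l ((hJ l).mpr (Or.inl rfl))
  have jl' := hμ.of_J l' ((hJ l').mpr (Or.inr rfl))
  rw [x.neg_one_pow_numBetween hI hll jl.1 jl.2.1 jl'.1 jl'.2.1 (fun p => by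
    rw [hJ, Subtype.ext_iff, Subtype.ext_iff]), neg_neg]
  have hterm : ∀ p : x.τ.support, labelWeight (x.markWeight I) (μ p)
        (μ (x.toNC.mate x.mem_support_iff p)) p (x.toNC.τ p) =
      (if μ p = Label.J then x.toNC.sgn p else 1) *
        if μ (x.toNC.mate x.mem_support_iff p) = Label.J then
          x.toNC.sgn (x.toNC.mate x.mem_support_iff p) else 1 := by
    intro p
    have hm : x.partner p = x.toNC.mate x.mem_support_iff p := rfl
    have hm' : x.partner (x.toNC.mate x.mem_support_iff p) = p :=
      x.toNC.mate_mate x.mem_support_iff p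
    have hτ : x.toNC.τ p = (x.toNC.mate x.mem_support_iff p : Fin n) := rfl
    have a1 := hμ.of_J p
    have a2 := hμ.of_J (x.toNC.mate x.mem_support_iff p)
    have a3 := hμ.of_not_J p
    rw [hm] at a1 a3
    rw [hm'] at a2
    rw [hτ]
    generalize x.toNC.mate x.mem_support_iff p = q at *
    by_cases hp : μ p = Label.J
    · obtain ⟨b1, b2, b3⟩ := a1 hp
      rw [hp, b3]
      simp [labelWeight, markWeight, b1, b2]
    · by_cases hq : μ q = Label.J
      · obtain ⟨b1, b2, b3⟩ := a2 hq
        rw [hq, b3]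
        simp [labelWeight, markWeight, b1, b2]
      · rcases a3 hp hq with ⟨b1, b2⟩ | ⟨b1, b2⟩ <;> rw [b1, b2] <;> simp [labelWeight]
  rw [Finset.prod_congr rfl fun i _ => hterm i.1, x.toNC.prod_opener x.mem_support_iff
    fun p => if μ p = Label.J then x.toNC.sgn p else 1, ← Finset.prod_filter, he,
    Finset.prod_pair (fun h => hll.ne (congrArg Subtype.val h))]

open NCMatching in
/-- A labelling that is not a marking does not contribute to the expansion of the generating
polynomial. -/
lemma prod_labelWeight_mul_eq_zero {I : Finset (Fin n)} {μ : x.τ.support → Label}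
    (hμ : ¬ x.IsMarking I μ) (hk : 2 ≤ k) {α : Finset (Fin n) → ℝ}
    (hα : ∀ K : Finset (Fin n), K.card ≠ k - 2 → α K = 0) :
    (∏ i : Opener x.toNC x.τ.support, labelWeight (x.markWeight I) (μ i.1)
        (μ (x.toNC.mate x.mem_support_iff i.1)) i.1 (x.toNC.τ i.1)) *
      α (x.T ∪ x.labelled μ Label.L) = 0 := by
  by_contra hne
  obtain ⟨h1, h2⟩ := mul_ne_zero_iff.mp hne
  rw [Finset.prod_ne_zero_iff] at h1
  have hpart : ∀ p, x.partner (x.partner p) = p := x.toNC.mate_mate x.mem_support_iff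
  have hw : ∀ p, labelWeight (x.markWeight I) (μ p) (μ (x.partner p)) p (x.partner p) ≠ 0 := by
    intro p
    by_cases hp : (p : Fin n) < x.toNC.τ p
    · exact h1 ⟨p, hp⟩ (Finset.mem_univ _)
    · have := h1 ⟨_, x.toNC.mate_lt x.mem_support_iff hp⟩ (Finset.mem_univ _)
      have h3 : labelWeight (x.markWeight I) (μ (x.partner p)) (μ (x.partner (x.partner p)))
        (x.partner p) (x.partner (x.partner p)) ≠ 0 := this
      rw [hpart] at h3
      intro h4
      apply h3
      revert h4
      cases μ p <;> cases μ (x.partner p) <;> simp [labelWeight]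
  have hofJ : ∀ l, μ l = Label.J →
      (l : Fin n) ∈ I ∧ (x.partner l : Fin n) ∉ I ∧ μ (x.partner l) = Label.R := by
    intro l hl
    have := hw l
    rw [hl] at this
    rcases h : μ (x.partner l) <;> rw [h] at this <;> simp [labelWeight, markWeight] at this
    tauto
  have hofnJ : ∀ l, μ l ≠ Label.J → μ (x.partner l) ≠ Label.J →
      (μ l = Label.L ∧ μ (x.partner l) = Label.R) ∨
        (μ l = Label.R ∧ μ (x.partner l) = Label.L) := by
    intro l hl hl'
    have := hw l
    rcases h : μ l <;> rcases h' : μ (x.partner l) <;> simp [h, h', labelWeight] at this hl hl' ⊢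
  refine hμ ⟨?_, hofJ, hofnJ⟩
  have hL : (x.T ∪ x.labelled μ Label.L).card = k - 2 := by
    by_contra h; exact h2 (hα _ h)
  have hdisj : Disjoint x.T (x.labelled μ Label.L) := by
    refine x.disjoint.mono_right fun p hp => ?_
    obtain ⟨q, -, rfl⟩ := Finset.mem_map.mp hp
    exact q.2
  rw [Finset.card_union_of_disjoint hdisj, labelled, Finset.card_map] at hL
  have hR : (Finset.univ.filter fun p => μ p = Label.R).card =
      (Finset.univ.filter fun p => ¬ μ p = Label.R).card := by
    refine Finset.card_nbij' x.partner x.partner ?_ ?_ (fun p _ => hpart p) (fun p _ => hpart p)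
    · intro p hp
      simp only [Finset.coe_filter, Finset.mem_univ, true_and, Set.mem_ofPred_eq] at hp ⊢
      have := hw p
      rw [hp] at this
      intro h
      rw [h] at this
      simp [labelWeight] at this
    · intro p hp
      simp only [Finset.coe_filter, Finset.mem_univ, true_and, Set.mem_ofPred_eq] at hp ⊢
      by_cases hJ : μ p = Label.J
      · exact (hofJ p hJ).2.2
      · by_cases hJ' : μ (x.partner p) = Label.J
        · have := (hofJ _ hJ').2.2
          rw [hpart] at this
          exact absurd this hp
        · rcases hofnJ p hJ hJ' with h | h
          · exact h.2
          · exact absurd h.1 hp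
  have hnR : (Finset.univ.filter fun p => ¬ μ p = Label.R).card =
      (Finset.univ.filter fun p => μ p = Label.L).card +
        (Finset.univ.filter fun p => μ p = Label.J).card := by
    rw [← Finset.card_union_of_disjoint]
    · congr 1
      ext p
      simp only [Finset.mem_filter, Finset.mem_univ, true_and, Finset.mem_union]
      cases μ p <;> simp
    · rw [Finset.disjoint_filter]
      intro p _ h
      rw [h]; decide
  have htot := Finset.card_filter_add_card_filter_not (s := Finset.univ) fun p => μ p = Label.R
  have huniv : (Finset.univ : Finset x.τ.support).card = x.τ.support.card := by
    rw [Finset.card_univ, Fintype.card_coe]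
  have := x.card_eq
  omega

/-- The sum over the markings is the value of the underlying non-crossing matching. -/
lemma sum_markings_eq_value {I : Finset (Fin n)} {u v : ℕ} (hI : IsCyclicInterval I u v)
    (hk : 2 ≤ k) {α : Finset (Fin n) → ℝ} (β : Finset (Fin n) → ℝ)
    (hα : ∀ K : Finset (Fin n), K.card ≠ k - 2 → α K = 0) [DecidablePred (x.IsMarking I)] :
    ∑ μ : x.τ.support → Label with x.IsMarking I μ,
      (-1 : ℝ) ^ x.numBetween I μ * α (x.T ∪ x.labelled μ Label.L) *
        β (x.T ∪ x.labelled μ Label.R ∪ x.labelled μ Label.J) =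
      x.toNC.value α β u v := by
  unfold NCMatching.value
  rw [x.toNC.pairing_poly x.mem_support_iff α β (x.markWeight I) fun p hp =>
    x.arcHeight_eq_markWeight hI hp, Finset.sum_filter, ← Finset.sum_neg_distrib]
  refine Finset.sum_congr rfl fun μ _ => ?_
  change _ = -(_ * (α (x.T ∪ x.labelled μ Label.L) *
        β (x.T ∪ x.labelled μ Label.R ∪ x.labelled μ Label.J)))
  by_cases hμ : x.IsMarking I μ
  · rw [if_pos hμ, x.prod_labelWeight hI hμ]
    ring
  · rw [if_neg hμ, ← mul_assoc, x.prod_labelWeight_mul_eq_zero hμ hk hα]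
    simp

lemma hasTwoSpecial {I : Finset (Fin n)} {u v : ℕ} (hI : IsCyclicInterval I u v)
    (h : 2 ≤ (x.specialArcs I).card) : x.toNC.HasTwoSpecial u v := by
  have hsgn : ∀ a, x.τ a ≠ a → ¬ (a ∈ I ↔ x.τ a ∈ I) → x.toNC.arcHeight u v a ≠ 0 := by
    intro a ha hne
    rw [x.arcHeight_eq_markWeight hI ha]
    change x.markWeight I a (x.τ a) + x.markWeight I (x.τ a) a ≠ 0
    have s1 := x.toNC.sgn_ne_zero a
    have s2 := x.toNC.sgn_ne_zero (x.τ a)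
    unfold markWeight
    by_cases h1 : a ∈ I <;> by_cases h2 : x.τ a ∈ I <;> simp [h1, h2, s1, s2] at hne ⊢
  obtain ⟨e, he, e', he', hne⟩ := Finset.one_lt_card.mp h
  obtain ⟨a, ha, rfl, hs⟩ := x.exists_of_mem_specialArcs he
  obtain ⟨b, hb, rfl, hs'⟩ := x.exists_of_mem_specialArcs he'
  refine ⟨a, b, ha, hb, ?_, ?_, hsgn a ha hs, hsgn b hb hs'⟩
  · rintro rfl; exact hne rfl
  · rintro rfl; exact hne (x.arc_partner a).symm

lemma sum_occ_toNC : ∑ p, x.toNC.occ p = 2 * k := by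
  have h : x.toNC.support = x.τ.support := by
    ext p
    rw [NCMatching.mem_support, mem_support_iff]
  rw [NCMatching.sum_occ, h]
  exact x.card_eq

end PartialMatching

/-! ### Complementary minors -/

section Duality

variable {m d n : ℕ}

lemma linearIndependent_row_of_maxMinor_ne_zero {A : Matrix (Fin m) (Fin n) ℝ}
    {I : Finset (Fin n)} (h : maxMinor A I ≠ 0) : LinearIndependent ℝ (row A) := by
  unfold maxMinor at h
  split_ifs at h with hI
  · let f : EuclideanSpace ℝ (Fin n) →ₗ[ℝ] (Fin m → ℝ) :=
      { toFun := fun v i => v (I.orderEmbOfFin hI i)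
        map_add' := fun v w => rfl
        map_smul' := fun c v => rfl }
    exact LinearIndependent.of_comp f (Matrix.linearIndependent_rows_of_det_ne_zero h)
  · exact absurd rfl h

/-- The square matrix with rows those of `A` and `B` and columns permuted by `f`. -/
def stack (A : Matrix (Fin m) (Fin n) ℝ) (B : Matrix (Fin d) (Fin n) ℝ)
    (f : Fin m ⊕ Fin d → Fin n) : Matrix (Fin m ⊕ Fin d) (Fin m ⊕ Fin d) ℝ :=
  (Matrix.fromRows A B).submatrix id f

/-- The enumeration of two complementary sets, each in increasing order. -/
def shuffle {I K : Finset (Fin n)} (hI : I.card = m) (hK : K.card = d) :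
    Fin m ⊕ Fin d → Fin n :=
  Sum.elim (I.orderEmbOfFin hI) (K.orderEmbOfFin hK)

lemma shuffle_bijective {I K : Finset (Fin n)} (hI : I.card = m) (hK : K.card = d)
    (h : ∀ p, p ∈ I ↔ p ∉ K) : Function.Bijective (shuffle hI hK) := by
  constructor
  · refine Function.Injective.sumElim (I.orderEmbOfFin hI).injective
      (K.orderEmbOfFin hK).injective fun i j hij => ?_
    exact (h _).mp (I.orderEmbOfFin_mem hI i) (hij ▸ K.orderEmbOfFin_mem hK j)
  · intro p
    by_cases hp : p ∈ K
    · have : p ∈ Set.range (K.orderEmbOfFin hK) := by rwa [Finset.range_orderEmbOfFin]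
      obtain ⟨i, rfl⟩ := this
      exact ⟨Sum.inr i, rfl⟩
    · have : p ∈ Set.range (I.orderEmbOfFin hI) := by
        rw [Finset.range_orderEmbOfFin]; exact (h p).mpr hp
      obtain ⟨i, rfl⟩ := this
      exact ⟨Sum.inl i, rfl⟩

/-- **Jacobi's complementary minor formula**, up to the sign in `det (stack A W _)`: the matrix with
rows `A` and the unit vectors of `K`, times the transpose of `stack A W`, is block triangular. -/
lemma maxMinor_mul_det_stack {A : Matrix (Fin m) (Fin n) ℝ} {W : Matrix (Fin d) (Fin n) ℝ}
    (hAW : A * Wᵀ = 0) {I K : Finset (Fin n)} (hI : I.card = m) (hK : K.card = d)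
    (h : ∀ p, p ∈ I ↔ p ∉ K) :
    maxMinor A I * (stack A W (shuffle hI hK)).det = (A * Aᵀ).det * maxMinor W K := by
  set e := Equiv.ofBijective _ (shuffle_bijective hI hK h) with he
  set AI := A.submatrix id (I.orderEmbOfFin hI)
  set AK := A.submatrix id (K.orderEmbOfFin hK)
  set WI := W.submatrix id (I.orderEmbOfFin hI)
  set WK := W.submatrix id (K.orderEmbOfFin hK)
  have hsum : ∀ {r s : ℕ} (P : Matrix (Fin r) (Fin n) ℝ) (Q : Matrix (Fin s) (Fin n) ℝ),
      P.submatrix id (I.orderEmbOfFin hI) * (Q.submatrix id (I.orderEmbOfFin hI))ᵀ +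
        P.submatrix id (K.orderEmbOfFin hK) * (Q.submatrix id (K.orderEmbOfFin hK))ᵀ =
      P * Qᵀ := by
    intro r s P Q
    ext i j
    simp only [Matrix.add_apply, Matrix.mul_apply, Matrix.submatrix_apply, Matrix.transpose_apply,
      id]
    rw [← e.sum_comp, Fintype.sum_sum_type]
    rfl
  have hstack : stack A W (shuffle hI hK) = Matrix.fromBlocks AI AK WI WK := by
    ext (i | i) (j | j) <;> rfl
  have h1 : Matrix.fromBlocks AI AK 0 1 * (stack A W (shuffle hI hK))ᵀ =
      Matrix.fromBlocks (A * Aᵀ) 0 AKᵀ WKᵀ := by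
    rw [hstack, Matrix.fromBlocks_transpose, Matrix.fromBlocks_multiply, hsum, hsum, hAW]
    simp
  have h2 := congrArg Matrix.det h1
  rw [Matrix.det_mul, Matrix.det_transpose, Matrix.det_fromBlocks_zero₂₁,
    Matrix.det_fromBlocks_zero₁₂, Matrix.det_one, mul_one, Matrix.det_transpose] at h2
  rw [maxMinor, maxMinor, dif_pos hI, dif_pos hK]
  exact h2

lemma det_stack_sq {A : Matrix (Fin m) (Fin n) ℝ} {W : Matrix (Fin d) (Fin n) ℝ}
    (hAW : A * Wᵀ = 0) {f : Fin m ⊕ Fin d → Fin n} (hf : Function.Bijective f) :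
    (stack A W f).det ^ 2 = (A * Aᵀ).det * (W * Wᵀ).det := by
  have h : stack A W f * (stack A W f)ᵀ = Matrix.fromBlocks (A * Aᵀ) 0 0 (W * Wᵀ) := by
    have hWA : W * Aᵀ = 0 := by
      have := congrArg Matrix.transpose hAW
      rwa [Matrix.transpose_mul, Matrix.transpose_transpose, Matrix.transpose_zero] at this
    rw [stack, Matrix.transpose_submatrix, ← Matrix.submatrix_mul _ _ _ f _ hf,
      Matrix.transpose_fromRows, Matrix.fromRows_mul_fromCols, hAW, hWA, Matrix.submatrix_id_id]
  have h2 := congrArg Matrix.det h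
  rwa [Matrix.det_mul, Matrix.det_transpose, Matrix.det_fromBlocks_zero₂₁, ← pow_two] at h2

lemma det_mul_transpose_ne_zero {A : Matrix (Fin m) (Fin n) ℝ} (h : LinearIndependent ℝ (row A)) :
    (A * Aᵀ).det ≠ 0 := by
  have := Matrix.det_gram_ne_zero_iff_linearIndependent.mpr h
  have h' : A * Aᵀ = Matrix.gram ℝ (row A) := by
    ext i j
    simp [Matrix.mul_apply, row, PiLp.inner_apply, mul_comm]
  rwa [h']

lemma orderEmbOfFin_map_swap {p q : Fin n} (hpq : (q : ℕ) = p + 1) {I : Finset (Fin n)}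
    (hI : I.card = m) (h : p ∉ I ∨ q ∉ I) (h' : (I.map (Equiv.swap p q).toEmbedding).card = m) :
    ⇑((I.map (Equiv.swap p q).toEmbedding).orderEmbOfFin h') =
      Equiv.swap p q ∘ I.orderEmbOfFin hI := by
  symm
  refine Finset.orderEmbOfFin_unique h' (fun i => ?_) fun i j hij => ?_
  · exact Finset.mem_map_of_mem _ (I.orderEmbOfFin_mem hI i)
  · have hi := I.orderEmbOfFin_mem hI i
    have hj := I.orderEmbOfFin_mem hI j
    refine (NCMatching.swap_lt_swap hpq ?_ ?_).mpr ((I.orderEmbOfFin hI).strictMono hij) <;>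
      rintro ⟨h1, h2⟩ <;> rw [h1] at hi <;> rw [h2] at hj <;> tauto

lemma det_stack_swap (A : Matrix (Fin m) (Fin n) ℝ) (W : Matrix (Fin d) (Fin n) ℝ)
    {f : Fin m ⊕ Fin d → Fin n} (hf : Function.Bijective f) {p q : Fin n} (hpq : p ≠ q) :
    (stack A W (Equiv.swap p q ∘ f)).det = - (stack A W f).det := by
  obtain ⟨i, rfl⟩ := hf.2 p
  obtain ⟨j, rfl⟩ := hf.2 q
  have hij : i ≠ j := fun h => hpq (congrArg f h)
  have h1 : Equiv.swap (f i) (f j) ∘ f = f ∘ Equiv.swap i j := by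
    funext x
    exact (hf.1.map_swap i j x).symm
  have h2 : stack A W (f ∘ Equiv.swap i j) = (stack A W f).submatrix id (Equiv.swap i j) := rfl
  rw [h1, h2, Matrix.det_permute', Equiv.Perm.sign_swap hij]
  simp

/-- The sign `∏ p ∈ K, (-1)^p` by which `altMap` multiplies the minor with column set `K`. -/
def altSign (K : Finset (Fin n)) : ℝ := ∏ p ∈ K, (-1) ^ (p : ℕ)

lemma altSign_mul_self (K : Finset (Fin n)) : altSign K * altSign K = 1 := by
  rw [altSign, ← Finset.prod_mul_distrib]
  refine Finset.prod_eq_one fun p _ => ?_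
  rw [← pow_add, Even.neg_one_pow ⟨_, rfl⟩]

lemma altSign_map_swap {p q : Fin n} (hpq : (q : ℕ) = p + 1) {K : Finset (Fin n)} (hp : p ∉ K)
    (hq : q ∈ K) : altSign (K.map (Equiv.swap p q).toEmbedding) = - altSign K := by
  have hne : p ≠ q := fun h => by rw [h] at hpq; omega
  rw [altSign, altSign, Finset.prod_map, ← Finset.mul_prod_erase K _ hq,
    ← Finset.mul_prod_erase K (fun p : Fin n => (-1 : ℝ) ^ (p : ℕ)) hq]
  have : ∀ x ∈ K.erase q, (-1 : ℝ) ^ ((Equiv.swap p q).toEmbedding x : ℕ) = (-1) ^ (x : ℕ) := by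
    intro x hx
    obtain ⟨h1, h2⟩ := Finset.mem_erase.mp hx
    have h3 : x ≠ p := fun h => hp (h ▸ h2)
    simp [Equiv.swap_apply_of_ne_of_ne h3 h1]
  rw [Finset.prod_congr rfl this]
  simp [hpq, pow_succ]

/-- The sign of the shuffle of `Kᶜ` and `K` is `altSign K` up to a constant, since both change their
sign if an element of `K` is replaced by its predecessor. -/
lemma det_stack_mul_altSign (A : Matrix (Fin m) (Fin n) ℝ) (W : Matrix (Fin d) (Fin n) ℝ)
    (I K : Finset (Fin n)) (hI : I.card = m) (hK : K.card = d) (h : ∀ p, p ∈ I ↔ p ∉ K) :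
    ∀ (I' K' : Finset (Fin n)) (hI' : I'.card = m) (hK' : K'.card = d)
      (_ : ∀ p, p ∈ I' ↔ p ∉ K'),
    altSign K' * (stack A W (shuffle hI' hK')).det = altSign K * (stack A W (shuffle hI hK)).det := by
  -- the induction ends at the lower set of cardinality `d`
  have hlow : ∀ K : Finset (Fin n), K.card = d →
      (¬ ∃ p q : Fin n, (q : ℕ) = p + 1 ∧ p ∉ K ∧ q ∈ K) →
      ∀ p : Fin n, p ∈ K ↔ (p : ℕ) < d := by
    intro K hK hlow p
    rw [← hK]
    refine NCMatching.mem_iff_lt_card_of_lower (fun x y hxy hy => ?_) p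
    have hdown : ∀ e : ℕ, ∀ y : Fin n, (y : ℕ) = x + e → y ∈ K → x ∈ K := by
      intro e
      induction e with
      | zero => intro y h hy; rwa [Fin.ext (show (x : ℕ) = y by omega)]
      | succ e ih =>
        intro y h hy
        refine ih ⟨x + e, by omega⟩ rfl ?_
        by_contra hc
        exact hlow ⟨_, y, h, hc, hy⟩
    exact hdown (y - x) y (by rw [Fin.le_def] at hxy; omega) hy
  have hex : ∀ N : ℕ, ∀ (I' K' : Finset (Fin n)) (hI' : I'.card = m) (hK' : K'.card = d)
      (_ : ∀ p, p ∈ I' ↔ p ∉ K'), ∑ p ∈ K', (p : ℕ) = N →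
      ∃ (I'' K'' : Finset (Fin n)) (hI'' : I''.card = m) (hK'' : K''.card = d),
        (∀ p, p ∈ I'' ↔ p ∉ K'') ∧ (∀ p : Fin n, p ∈ K'' ↔ (p : ℕ) < d) ∧
        altSign K' * (stack A W (shuffle hI' hK')).det =
          altSign K'' * (stack A W (shuffle hI'' hK'')).det := by
    intro N
    induction N using Nat.strong_induction_on with
    | _ N ih =>
      intro I' K' hI' hK' h' hN
      by_cases hmove : ∃ p q : Fin n, (q : ℕ) = p + 1 ∧ p ∉ K' ∧ q ∈ K'
      swap
      · exact ⟨I', K', hI', hK', h', hlow K' hK' hmove, rfl⟩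
      obtain ⟨p, q, hpq, hp, hq⟩ := hmove
      have hqI : q ∉ I' := fun hc => (h' q).mp hc hq
      have hIc : (I'.map (Equiv.swap p q).toEmbedding).card = m := by rwa [Finset.card_map]
      have hKc : (K'.map (Equiv.swap p q).toEmbedding).card = d := by rwa [Finset.card_map]
      have hcompl : ∀ x, x ∈ I'.map (Equiv.swap p q).toEmbedding ↔
          x ∉ K'.map (Equiv.swap p q).toEmbedding := by
        intro x
        rw [Finset.mem_map_equiv, Finset.mem_map_equiv]
        exact h' _
      have hsum : ∑ x ∈ K'.map (Equiv.swap p q).toEmbedding, (x : ℕ) < N := by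
        rw [← hN, Finset.sum_map]
        refine Finset.sum_lt_sum (fun x hx => ?_) ⟨q, hq, ?_⟩
        · have : x ≠ p := fun hc => hp (hc ▸ hx)
          by_cases hxq : x = q
          · simp [hxq, hpq]
          · simp [Equiv.swap_apply_of_ne_of_ne this hxq]
        · simp [hpq]
      obtain ⟨I'', K'', hI'', hK'', h1, h2, h3⟩ := ih _ hsum _ _ hIc hKc hcompl rfl
      refine ⟨I'', K'', hI'', hK'', h1, h2, ?_⟩
      rw [← h3, altSign_map_swap hpq hp hq]
      have hsh : shuffle hIc hKc = Equiv.swap p q ∘ shuffle hI' hK' := by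
        rw [shuffle, shuffle, orderEmbOfFin_map_swap hpq hI' (Or.inr hqI),
          orderEmbOfFin_map_swap hpq hK' (Or.inl hp), Sum.comp_elim]
      have hne : p ≠ q := fun h => by rw [h] at hpq; omega
      rw [hsh, det_stack_swap A W (shuffle_bijective hI' hK' h') hne]
      ring
  intro I' K' hI' hK' h'
  obtain ⟨I₁, K₁, hI₁, hK₁, h1, h2, h3⟩ := hex _ I K hI hK h rfl
  obtain ⟨I₂, K₂, hI₂, hK₂, h1', h2', h3'⟩ := hex _ I' K' hI' hK' h' rfl
  obtain rfl : K₁ = K₂ := by ext p; rw [h2, h2']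
  obtain rfl : I₁ = I₂ := by ext p; rw [h1, h1']
  rw [h3, h3']

lemma maxMinor_scale (W : Matrix (Fin d) (Fin n) ℝ) (u : Fin d → ℝ) {K : Finset (Fin n)}
    (hK : K.card = d) :
    maxMinor (Matrix.of fun i p => u i * ((-1) ^ (p : ℕ) * W i p)) K =
      (∏ i, u i) * (altSign K * maxMinor W K) := by
  rw [maxMinor, maxMinor, dif_pos hK, dif_pos hK]
  have h1 : altSign K = ∏ i, (-1 : ℝ) ^ (K.orderEmbOfFin hK i : ℕ) := by
    rw [altSign]
    have : K = Finset.univ.map (K.orderEmbOfFin hK).toEmbedding := by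
      rw [Finset.map_orderEmbOfFin_univ]
    conv_lhs => rw [this]
    rw [Finset.prod_map]
    rfl
  rw [h1, ← Matrix.det_mul_row, ← Matrix.det_mul_column]
  rfl

/-- The orthogonal complement of a point of the totally positive Grassmannian is mapped to the
totally positive Grassmannian by the alternating sign change. -/
theorem mem_image_altMap_of_orthogonal (hd : 0 < d) (hmd : m + d = n)
    {A : Matrix (Fin m) (Fin n) ℝ} {V : Submodule ℝ (EuclideanSpace ℝ (Fin n))}
    (hA : IsPositiveRep A Vᗮ) : V ∈ Submodule.map (altMap n) '' GrPos d n := by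
  have hm : Module.finrank ℝ Vᗮ = m := by
    rw [← hA.span_eq, finrank_span_eq_card hA.linearIndependent, Fintype.card_fin]
  have hV : Module.finrank ℝ V = d := by
    have := V.finrank_add_finrank_orthogonal
    rw [finrank_euclideanSpace_fin] at this
    omega
  let b := Module.finBasisOfFinrankEq ℝ V hV
  let W : Matrix (Fin d) (Fin n) ℝ := Matrix.of fun i p => (b i : EuclideanSpace ℝ (Fin n)) p
  have hW : ∀ i, row W i = b i := fun i => rfl
  have hWind : LinearIndependent ℝ (row W) :=
    b.linearIndependent.map' V.subtype (Submodule.ker_subtype V)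
  have hWspan : Submodule.span ℝ (Set.range (row W)) = V := by
    have : Set.range (row W) = V.subtype '' Set.range b := by
      rw [← Set.range_comp]; rfl
    rw [this, Submodule.span_image, b.span_eq, Submodule.map_top, Submodule.range_subtype]
  have hAW : A * Wᵀ = 0 := by
    ext i j
    have h1 : row A i ∈ Vᗮ := by
      rw [← hA.span_eq]; exact Submodule.subset_span ⟨i, rfl⟩
    have h2 := (Submodule.mem_orthogonal V _).mp h1 (row W j) (b j).2
    simpa [Matrix.mul_apply, row, PiLp.inner_apply, mul_comm] using h2
  set P := (A * Aᵀ).det with hP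
  have hP0 : P ≠ 0 := det_mul_transpose_ne_zero hA.linearIndependent
  -- the constant relating complementary minors
  have hex : ∃ K : Finset (Fin n), K.card = d := by
    obtain ⟨K, -, hK⟩ := Finset.exists_subset_card_eq
      (show d ≤ (Finset.univ : Finset (Fin n)).card by simp; omega)
    exact ⟨K, hK⟩
  obtain ⟨K₀, hK₀⟩ := hex
  have hcompl : ∀ {K : Finset (Fin n)}, K.card = d → (Kᶜ).card = m := by
    intro K hK
    rw [Finset.card_compl, hK, Fintype.card_fin]
    omega
  have hmem : ∀ (K : Finset (Fin n)) (p : Fin n), p ∈ Kᶜ ↔ p ∉ K := fun K p => Finset.mem_compl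
  set D := altSign K₀ * (stack A W (shuffle (hcompl hK₀) hK₀)).det with hD
  have hD0 : D ≠ 0 := by
    refine mul_ne_zero (left_ne_zero_of_mul (b := altSign K₀) (by simp [altSign_mul_self])) ?_
    have := det_stack_sq hAW (shuffle_bijective (hcompl hK₀) hK₀ (hmem K₀))
    have hne : (A * Aᵀ).det * (W * Wᵀ).det ≠ 0 :=
      mul_ne_zero hP0 (det_mul_transpose_ne_zero hWind)
    rw [← this] at hne
    exact fun h => hne (by rw [h]; norm_num)
  have hminor : ∀ K : Finset (Fin n), K.card = d →
      P * (altSign K * maxMinor W K) = D * maxMinor A Kᶜ := by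
    intro K hK
    have h1 := maxMinor_mul_det_stack hAW (hcompl hK) hK (hmem K)
    have h2 := det_stack_mul_altSign A W _ _ (hcompl hK₀) hK₀ (hmem K₀) _ _ (hcompl hK) hK (hmem K)
    rw [← hD] at h2
    rw [← h2, mul_left_comm, ← h1]
    ring
  -- rescaling one row turns the minors of `W` into the complementary minors of `A`
  let u : Fin d → ℝ := fun i => if i = ⟨0, hd⟩ then P / D else 1
  have hu0 : ∀ i, u i ≠ 0 := by
    intro i
    dsimp only [u]
    split_ifs
    · exact div_ne_zero hP0 hD0
    · exact one_ne_zero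
  have hu : ∏ i, u i = P / D := by simp [u]
  let B : Matrix (Fin d) (Fin n) ℝ := Matrix.of fun i p => u i * ((-1) ^ (p : ℕ) * W i p)
  have hpos : ∀ K : Finset (Fin n), K.card = d → 0 < maxMinor B K := by
    intro K hK
    have h1 : maxMinor B K = maxMinor A Kᶜ := by
      rw [maxMinor_scale W u hK, hu, div_mul_eq_mul_div, hminor K hK, mul_div_cancel_left₀ _ hD0]
    rw [h1]
    exact hA.minor_pos _ (hcompl hK)
  have hB : ∀ i, altMap n (row B i) = u i • row W i := by
    intro i
    ext p
    change (-1 : ℝ) ^ (p : ℕ) * (u i * ((-1) ^ (p : ℕ) * W i p)) = u i * W i p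
    have : (-1 : ℝ) ^ (p : ℕ) * (-1) ^ (p : ℕ) = 1 := by
      rw [← pow_add, Even.neg_one_pow ⟨_, rfl⟩]
    linear_combination (u i * W i p) * this
  refine ⟨_, ⟨B, linearIndependent_row_of_maxMinor_ne_zero (hpos K₀ hK₀).ne', rfl, hpos⟩, ?_⟩
  rw [Submodule.map_span, ← Set.range_comp]
  apply le_antisymm
  · rw [Submodule.span_le]
    rintro _ ⟨i, rfl⟩
    rw [Function.comp_apply, hB]
    exact V.smul_mem _ (b i).2
  · rw [← hWspan, Submodule.span_le]
    rintro _ ⟨i, rfl⟩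
    have h1 : row W i = (u i)⁻¹ • altMap n (row B i) := by
      rw [hB, smul_smul, inv_mul_cancel₀ (hu0 i), one_smul]
    rw [h1]
    exact Submodule.smul_mem _ _ (Submodule.subset_span ⟨i, rfl⟩)

end Duality

/-! ### Totally positive flags -/

section Flags

variable {m n : ℕ}

/-- Plücker coordinates are unique up to a common factor. -/
lemma IsPositiveRep.exists_maxMinor_eq {A B : Matrix (Fin m) (Fin n) ℝ}
    {V : Submodule ℝ (EuclideanSpace ℝ (Fin n))} (hA : IsPositiveRep A V)
    (hB : IsPositiveRep B V) (hmn : m ≤ n) :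
    ∃ c : ℝ, 0 < c ∧ ∀ I, maxMinor A I = c * maxMinor B I := by
  have h : ∀ i, ∃ g : Fin m → ℝ, ∑ j, g j • row B j = row A i := by
    intro i
    rw [← Submodule.mem_span_range_iff_exists_fun, hB.span_eq, ← hA.span_eq]
    exact Submodule.subset_span ⟨i, rfl⟩
  choose G hG using h
  have hAG : A = Matrix.of G * B := by
    ext i p
    have := congrArg (fun v : EuclideanSpace ℝ (Fin n) => v p) (hG i)
    simpa [row, Matrix.mul_apply] using this.symm
  have hminor : ∀ I, maxMinor A I = (Matrix.of G).det * maxMinor B I := by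
    intro I
    by_cases hI : I.card = m
    · rw [maxMinor, maxMinor, dif_pos hI, dif_pos hI, ← Matrix.det_mul, hAG]
      rfl
    · rw [maxMinor, maxMinor, dif_neg hI, dif_neg hI, mul_zero]
  refine ⟨_, ?_, hminor⟩
  obtain ⟨I, -, hI⟩ := Finset.exists_subset_card_eq
    (show m ≤ (Finset.univ : Finset (Fin n)).card by simpa using hmn)
  have h1 := hA.minor_pos I hI
  rw [hminor] at h1
  exact pos_of_mul_pos_left h1 (hB.minor_pos I hI).le

/-- A square matrix, extended by zeros. -/
def extendZero (M : Matrix (Fin n) (Fin n) ℝ) (i j : ℕ) : ℝ :=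
  if h : i < n ∧ j < n then M ⟨i, h.1⟩ ⟨j, h.2⟩ else 0

lemma extendZero_coe (M : Matrix (Fin n) (Fin n) ℝ) (i j : Fin n) : extendZero M i j = M i j := by
  simp [extendZero]

lemma corner_extendZero (M : Matrix (Fin n) (Fin n) ℝ) (hmn : m ≤ n) :
    corner m n (extendZero M) = M.submatrix (Fin.castLEOrderEmb hmn) id := by
  ext i j
  exact extendZero_coe M (Fin.castLE hmn i) j

lemma IsTotallyPositive.isPositiveRep {M : Matrix (Fin n) (Fin n) ℝ} (hM : IsTotallyPositive M)
    (hmn : m ≤ n) : IsPositiveRep (corner m n (extendZero M)) (firstRowsSpan M m) := by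
  have hpos : ∀ I : Finset (Fin n), I.card = m → 0 < maxMinor (corner m n (extendZero M)) I := by
    intro I hI
    rw [maxMinor, dif_pos hI, corner_extendZero M hmn, Matrix.submatrix_submatrix]
    exact hM m (Fin.castLEOrderEmb hmn) (I.orderEmbOfFin hI)
  refine ⟨?_, ?_, hpos⟩
  · obtain ⟨I, -, hI⟩ := Finset.exists_subset_card_eq
      (show m ≤ (Finset.univ : Finset (Fin n)).card by simpa using hmn)
    exact linearIndependent_row_of_maxMinor_ne_zero (hpos I hI).ne'
  · rw [firstRowsSpan, corner_extendZero M hmn]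
    congr 1
    ext w
    constructor
    · rintro ⟨i, rfl⟩
      exact ⟨Fin.castLE hmn i, i.2, rfl⟩
    · rintro ⟨r, hr, rfl⟩
      exact ⟨⟨r, hr⟩, rfl⟩

lemma IsTotallyPositive.consecutivePos {M : Matrix (Fin n) (Fin n) ℝ} (hM : IsTotallyPositive M)
    (R : ℕ) : ConsecutivePos R n (extendZero M) := by
  intro m j _ hjm
  have h : block (extendZero M) 0 j m = M.submatrix (Fin.castLEOrderEmb (by omega))
      (OrderEmbedding.ofStrictMono (fun i : Fin m => (⟨j + i, by omega⟩ : Fin n))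
        fun a b hab => by rw [Fin.lt_def] at hab ⊢; dsimp only; omega) := by
    ext a b
    have := extendZero_coe M ⟨0 + a, by omega⟩ ⟨j + b, by omega⟩
    refine this.trans ?_
    simp only [Matrix.submatrix_apply]
    congr 1
    exact Fin.ext (zero_add _)
  rw [h]
  exact hM _ _ _

end Flags

theorem isImmanantPositive_of_mem_flPos {k n : ℕ} (hk : 2 ≤ k) (hkn : k + 2 ≤ n)
    {Λ Λ' : Submodule ℝ (EuclideanSpace ℝ (Fin n))} (h : (Λᗮ, Λ') ∈ FlPos (k - 2) (k + 2) n) :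
    IsImmanantPositive k n Λ Λ' := by
  obtain ⟨M, hM, hΛ⟩ := h
  obtain ⟨h1, h2⟩ := Prod.mk.inj hΛ
  have hrep : IsPositiveRep (corner (k - 2) n (extendZero M)) Λᗮ :=
    h1 ▸ hM.isPositiveRep (by omega)
  have hrep' : IsPositiveRep (corner (k + 2) n (extendZero M)) Λ' :=
    h2 ▸ hM.isPositiveRep hkn
  refine ⟨⟨?_, _, hrep'⟩, ?_⟩
  · exact mem_image_altMap_of_orthogonal (by omega) (by omega) hrep
  intro A B hA hB i j hij hji x hx
  obtain ⟨u, v, hI⟩ := isCyclicInterval_cyclicInterval (n := n) (i := i) (j := j) (by omega)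
    (by omega) (by omega)
  obtain ⟨c, hc, hcA⟩ := hA.exists_maxMinor_eq hrep (by omega)
  obtain ⟨c', hc', hcB⟩ := hB.exists_maxMinor_eq hrep' hkn
  have hcoeff : x.coeff (cyclicInterval n i j) A B =
      c * c' * x.toNC.value (minors (k - 2) n (extendZero M)) (minors (k + 2) n (extendZero M))
        u v := by
    classical
    rw [← x.sum_markings_eq_value hI hk _ fun K hK => minors_of_card_ne _ hK,
      PartialMatching.coeff, Finset.mul_sum]
    refine Finset.sum_congr (by congr) fun μ _ => ?_
    rw [hcA, hcB]
    unfold minors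
    ring
  rw [hcoeff]
  refine mul_pos (mul_pos hc hc') ?_
  obtain ⟨a, rfl⟩ : ∃ a, k = a + 2 := ⟨k - 2, by omega⟩
  exact x.toNC.value_pos (a := a) hkn u v (extendZero M) x.sum_occ_toNC (x.hasTwoSpecial hI hx)
    (hM.consecutivePos _)

end TwoStepFlag


theorem theorem5p4 (k n : ℕ) (hk : 2 ≤ k) (hkn : k + 2 ≤ n)
    (Λ Λ' : Submodule ℝ (EuclideanSpace ℝ (Fin n)))
    (h : (Λᗮ, Λ') ∈ TwoStepFlag.FlPos (k - 2) (k + 2) n) :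
    TwoStepFlag.IsImmanantPositive k n Λ Λ' :=
  TwoStepFlag.isImmanantPositive_of_mem_flPos hk hkn h
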